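/- **Consistency of revised Split LBI.** *Model.* Let $n\ge 1$, $m\ge 2$, $X\in\mathbb R^{n\times p}$, $D\in\mathbb R^{m\times p}$ be fixed, and let $y=X\beta^\star+\epsilon$, where $\epsilon_1,\dots,\epsilon_n$ are i.i.d. and sub-Gaussian with parameter $\sigma^2$, $\sigma>0$, i.e. $\mathbb E\,e^{t\epsilon_i}\le e^{\sigma^2t^2/2}$ for all $t\in\mathbb R$. Write $X^*=X^T/n$, let $Q^\dagger$ be the Moore–Penrose pseudoinverse of $Q$, let $D_J$ be the submatrix of the rows of $D$ indexed by $J\subseteq\{1,\dots,m\}$, and let $S=\mathrm{supp}(D\beta^\star)$, $s=|S|$. Assume $s\ge 1$ and $\beta^\star\in\mathcal L:=\mathrm{Im}(X^T)+\mathrm{Im}(D^T)=(\ker X\cap\ker D)^\perp$. Let $\lambda_D,\Lambda_D,\Lambda_X>0$ be such that all nonzero singular values of $D$ and of $D_{S^c}$ are $\ge\lambda_D$, the largest singular value of $D$ is $\le\Lambda_D$, and that of $X^*X$ is $\le\Lambda_X^2$. Let $r'=\dim\{X\beta:\beta\in\ker D\}$, and let $\lambda_1$ be the smallest nonzero singular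 value of the restriction of $X/\sqrt n$ to $\ker D$ ($\lambda_1=+\infty$, i.e. $1/\lambda_1=0$, if $r'=0$). *Algorithm.* Let $\kappa,\alpha,\nu>0$, $\ell(\beta,\gamma)=\frac1{2n}\|y-X\beta\|_2^2+\frac1{2\nu}\|\gamma-D\beta\|_2^2$, $\beta_0=0$, $z_0=\gamma_0=0$, and $$\beta_{k+1}=\beta_k-\kappa\alpha\nabla_\beta\ell(\beta_k,\gamma_k),\quad z_{k+1}=z_k-\alpha\nabla_\gamma\ell(\beta_k,\gamma_k),\quad \gamma_{k+1}=\kappa\,\mathrm{sign}(z_{k+1})\max(|z_{k+1}|-1,0)\ \text{(coordinatewise)}.$$ Put $S_k=\mathrm{supp}(\gamma_k)$, $P_{S_k}=I-D_{S_k^c}^\dagger D_{S_k^c}$ (the orthogonal projection onto $\ker D_{S_k^c}$, equal to $I$ if $S_k^c=\varnothing$), and $\tilde\beta_k=P_{S_k}\beta_k$. *Assumptions.* Let $H(\nu)=\nabla^2\ell=\begin{pmatrix}X^*X+D^TD/\nu&-D^T/\nu\\-D/\nu&I_m/\nu\end{pmatrix}$ and $H=H(\nu)$, and let the index $(\beta,S)$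 denote the block of the $\beta$-coordinates and the $\gamma_S$-coordinates. * (RSC) There is $\lambda>0$ with $\beta^TX^*X\beta\ge\lambda\|\beta\|_2^2$ for all $\beta\in\mathcal L$ with $D_{S^c}\beta=0$. * (IRR($\nu$)) For some $\eta\in(0,1]$: $\sup_{\rho\in[-1,1]^s}\big\|H_{S^c,(\beta,S)}H_{(\beta,S),(\beta,S)}^\dagger\binom{0_p}{\rho}\big\|_\infty\le1-\eta$. *Conclusion.* There is a constant $C>0$ such that for every $\nu'>0$ $$(\beta^T,\gamma_S^T)\,H_{(\beta,S),(\beta,S)}(\nu')\binom{\beta}{\gamma_S}\ \ge\ \frac{C}{1+\nu'}\left\|\binom{\beta}{\gamma_S}\right\|_2^2\qquad(\beta\in\mathcal L,\ \gamma_S\in\mathbb R^s).\qquad(*)$$ Let $C>0$ be any constant for which $(*)$ holds at $\nu'=\nu$. Put $\lambda_H=C/(1+\nu)$, suppose $\kappa\alpha\|H\|_2<2$, and put $$\lambda_H'=\lambda_H\Big(1-\tfrac12\kappa\alpha\|H\|_2\Big)>0,\qquad \bar\tau=\frac{\eta}{8\sigma}\cdot\frac{\lambda_D}{\Lambda_X}\sqrt{\frac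 n{\log m}}.$$ Suppose further that $5\alpha<\bar\tau$ and $$\kappa\ge\frac4\eta\Big(1+\frac1{\lambda_D}+\frac{\Lambda_X}{\lambda_1\lambda_D}\Big)\Big(1+\sqrt{\tfrac{2(1+\nu\Lambda_X^2+\Lambda_D^2)}{\lambda_H'\nu}}\Big)\Big((1+\Lambda_D)\|\beta^\star\|_2+\frac{2\sigma}{\lambda_H'}\Big(\frac{\Lambda_X}{\lambda_D}+\frac{\Lambda_X}{\lambda_D^2}+\frac{\lambda_H'\lambda_D^2+\Lambda_X^2}{\lambda_1\lambda_D^2}\Big)\Big),$$ and let $\bar k=\lfloor\bar\tau/\alpha\rfloor$. Then: 1. (Sign consistency.) If $$\min_{j\in S}|(D\beta^\star)_j|\ \ge\ \frac{16\sigma}{\eta\lambda_H'(1-5\alpha/\bar\tau)}\cdot\frac{\Lambda_X\Lambda_D}{\lambda_D^2}\big(2\log s+5+\log\max(1,8\Lambda_D)\big)\sqrt{\frac{\log m}n},$$ then with probability at least $1-8/m-3e^{-4n/5}$ we have $\mathrm{sign}(D\tilde\beta_{\bar k})=\mathrm{sign}(D\beta^\star)$. 2. ($\ell_2$ consistency.)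 With probability at least $1-8/m-2r'/m^2-3e^{-4n/5}$, $$\|\tilde\beta_{\bar k}-\beta^\star\|_2\le\frac{80\sigma}{\eta\lambda_H'(1-\alpha/\bar\tau)}\cdot\frac{\Lambda_X(\Lambda_D+\lambda_D^2)}{\lambda_D^3}\sqrt{\frac{s\log m}n}+\frac{2\sigma}{\lambda_H'}\Big(\frac{\Lambda_X}{\lambda_D^2}+\frac{\lambda_H'\lambda_D^2+\Lambda_X^2}{\lambda_1\lambda_D^2}\Big)\sqrt{\frac{r'\log m}n}+2\big\|D_{S_{\bar k}^c}^\dagger D_{S_{\bar k}^c\cap S}\beta^\star\big\|_2,$$ where $D_{S_{\bar k}^c\cap S}\beta^\star$ is extended by zero to a vector indexed by $S_{\bar k}^c$; and on the same event the last term can be dropped if $S_{\bar k}\supseteq S$. -/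

import Mathlib

open Matrix MeasureTheory ProbabilityTheory

namespace SplitLBI

/-! ### Moore-Penrose pseudoinverse of a real matrix -/

/-- The four Penrose equations. -/
structure IsMoorePenrose {ι κ : Type*} [Fintype ι] [Fintype κ]
    (Q : Matrix ι κ ℝ) (P : Matrix κ ι ℝ) : Prop where
  mul_mul_left : Q * P * Q = Q
  mul_mul_right : P * Q * P = P
  symm_left : (Q * P)ᵀ = Q * P
  symm_right : (P * Q)ᵀ = P * Q

theorem IsMoorePenrose.unique {ι κ : Type*} [Fintype ι] [Fintype κ]
    {Q : Matrix ι κ ℝ} {P R : Matrix κ ι ℝ} (hP : IsMoorePenrose Q P) (hR : IsMoorePenrose Q R) :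
    P = R := by
  have e1 : Q * P = Q * R := by
    calc Q * P = (Q * P)ᵀ := hP.symm_left.symm
      _ = ((Q * R) * (Q * P))ᵀ := by
          rw [← Matrix.mul_assoc (Q * R) Q P, hR.mul_mul_left]
      _ = (Q * P) * (Q * R) := by rw [Matrix.transpose_mul, hP.symm_left, hR.symm_left]
      _ = Q * R := by rw [← Matrix.mul_assoc (Q * P) Q R, hP.mul_mul_left]
  have e2 : P * Q = R * Q := by
    calc P * Q = (P * Q)ᵀ := hP.symm_right.symm
      _ = ((P * Q) * (R * Q))ᵀ := by
          rw [Matrix.mul_assoc P Q (R * Q), ← Matrix.mul_assoc Q R Q, hR.mul_mul_left]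
      _ = (R * Q) * (P * Q) := by rw [Matrix.transpose_mul, hP.symm_right, hR.symm_right]
      _ = R * Q := by rw [Matrix.mul_assoc R Q (P * Q), ← Matrix.mul_assoc Q P Q, hP.mul_mul_left]
  calc P = P * Q * P := hP.mul_mul_right.symm
    _ = R * Q * R := by rw [e2, Matrix.mul_assoc, e1, ← Matrix.mul_assoc]
    _ = R := hR.mul_mul_right

theorem exists_isMoorePenrose {ι κ : Type*} [Fintype ι] [Fintype κ] (Q : Matrix ι κ ℝ) :
    ∃ P : Matrix κ ι ℝ, IsMoorePenrose Q P := by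
  classical
  have hA : (Qᵀ * Q).IsHermitian := by
    simpa using Matrix.isHermitian_conjTranspose_mul_self Q
  obtain ⟨U, d, hU, hd⟩ : ∃ (U : Matrix κ κ ℝ) (d : κ → ℝ),
      Uᵀ * U = 1 ∧ Qᵀ * Q = U * diagonal d * Uᵀ := by
    refine ⟨hA.eigenvectorUnitary, hA.eigenvalues, ?_, ?_⟩
    · have h := Unitary.coe_star_mul_self hA.eigenvectorUnitary
      simpa [Matrix.star_eq_conjTranspose] using h
    · have h := hA.spectral_theorem
      rw [Unitary.conjStarAlgAut_apply] at h
      simpa [Matrix.star_eq_conjTranspose, Function.comp_def] using h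
  have key : ∀ a b : κ → ℝ, (U * diagonal a * Uᵀ) * (U * diagonal b * Uᵀ)
      = U * diagonal (fun i => a i * b i) * Uᵀ := by
    intro a b
    calc (U * diagonal a * Uᵀ) * (U * diagonal b * Uᵀ)
        = U * diagonal a * (Uᵀ * U) * diagonal b * Uᵀ := by simp only [Matrix.mul_assoc]
      _ = U * (diagonal a * diagonal b) * Uᵀ := by
          rw [hU, Matrix.mul_one]; simp only [Matrix.mul_assoc]
      _ = _ := by rw [diagonal_mul_diagonal]
  have ksymm : ∀ a : κ → ℝ, (U * diagonal a * Uᵀ)ᵀ = U * diagonal a * Uᵀ := by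
    intro a
    simp [Matrix.transpose_mul, Matrix.mul_assoc]
  set G : Matrix κ κ ℝ := U * diagonal (fun i => (d i)⁻¹) * Uᵀ with hG
  have hGt : Gᵀ = G := ksymm _
  have hAGA : (Qᵀ * Q) * G * (Qᵀ * Q) = Qᵀ * Q := by
    rw [hd, hG, key, key]
    congr 2
    ext i j
    by_cases h : d i = 0 <;> simp [diagonal_apply, h]
  have hGAG : G * (Qᵀ * Q) * G = G := by
    rw [hd, hG, key, key]
    congr 2
    ext i j
    by_cases h : d i = 0 <;> simp [diagonal_apply, h]
  have hGA : (G * (Qᵀ * Q))ᵀ = G * (Qᵀ * Q) := by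
    rw [hd, hG, key, ksymm]
  have hQ : Q * G * (Qᵀ * Q) = Q := by
    have h0 : (Q * G * (Qᵀ * Q) - Q)ᵀ * (Q * G * (Qᵀ * Q) - Q) = 0 := by
      have h1 : Qᵀ * (Q * G * (Qᵀ * Q) - Q) = 0 := by
        rw [Matrix.mul_sub, sub_eq_zero]
        calc Qᵀ * (Q * G * (Qᵀ * Q)) = (Qᵀ * Q) * G * (Qᵀ * Q) := by
              simp only [Matrix.mul_assoc]
          _ = _ := hAGA
      have h2 : (Q * G * (Qᵀ * Q) - Q)ᵀ = ((Qᵀ * Q) * G - 1) * Qᵀ := by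
        simp only [Matrix.transpose_sub, Matrix.transpose_mul, hGt, Matrix.sub_mul,
          Matrix.transpose_transpose, Matrix.one_mul, Matrix.mul_assoc]
      rw [h2, Matrix.mul_assoc, h1, Matrix.mul_zero]
    have h3 : (Q * G * (Qᵀ * Q) - Q)ᴴ * (Q * G * (Qᵀ * Q) - Q) = 0 := by
      simpa [Matrix.conjTranspose_eq_transpose_of_trivial] using h0
    exact sub_eq_zero.mp (Matrix.conjTranspose_mul_self_eq_zero.mp h3)
  refine ⟨G * Qᵀ, ?_, ?_, ?_, ?_⟩
  · calc Q * (G * Qᵀ) * Q = Q * G * (Qᵀ * Q) := by simp only [Matrix.mul_assoc]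
      _ = Q := hQ
  · calc G * Qᵀ * Q * (G * Qᵀ) = G * (Qᵀ * Q) * G * Qᵀ := by simp only [Matrix.mul_assoc]
      _ = G * Qᵀ := by rw [hGAG]
  · rw [Matrix.transpose_mul, Matrix.transpose_mul, hGt, Matrix.transpose_transpose,
      Matrix.mul_assoc]
  · rw [Matrix.mul_assoc]; exact hGA

/-- The Moore-Penrose pseudoinverse `Q†`. -/
noncomputable def pinv {ι κ : Type*} [Fintype ι] [Fintype κ] (Q : Matrix ι κ ℝ) : Matrix κ ι ℝ :=
  (exists_isMoorePenrose Q).choose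

theorem pinv_isMoorePenrose {ι κ : Type*} [Fintype ι] [Fintype κ] (Q : Matrix ι κ ℝ) :
    IsMoorePenrose Q (pinv Q) :=
  (exists_isMoorePenrose Q).choose_spec

/-! ### Norms, supports, submatrices -/

/-- The Euclidean norm of a vector given by its coordinates. -/
noncomputable def l2norm {ι : Type*} [Fintype ι] (v : ι → ℝ) : ℝ := ‖WithLp.toLp 2 v‖

/-- The spectral norm of a square matrix. -/
noncomputable def specNorm {ι : Type*} [Fintype ι] [DecidableEq ι] (Q : Matrix ι ι ℝ) : ℝ :=
  ‖Matrix.toEuclideanCLM (n := ι) (𝕜 := ℝ) Q‖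

open Classical in
/-- The support of a vector. -/
noncomputable def supp {m : ℕ} (v : Fin m → ℝ) : Finset (Fin m) :=
  Finset.univ.filter (fun j => v j ≠ 0)

/-- `D_J`: the rows of `D` with index in `J`. -/
def rows {m p : ℕ} (D : Matrix (Fin m) (Fin p) ℝ) (J : Finset (Fin m)) :
    Matrix {j // j ∈ J} (Fin p) ℝ :=
  D.submatrix Subtype.val id

/-- `X* = Xᵀ / n`. -/
noncomputable def nstar {n p : ℕ} (X : Matrix (Fin n) (Fin p) ℝ) : Matrix (Fin p) (Fin n) ℝ :=
  (n : ℝ)⁻¹ • Xᵀ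

/-! ### The Split LBI iteration -/

/-- Coordinatewise shrinkage `S(z, 1) = sign(z) max(|z| - 1, 0)`, the proximal map of the
`ℓ₁`-norm. -/
noncomputable def shrink {m : ℕ} (z : Fin m → ℝ) : Fin m → ℝ :=
  fun j => Real.sign (z j) * max (|z j| - 1) 0

/-- The gradient in `β` of `ℓ(β, γ) = ‖y - X β‖² / (2 n) + ‖γ - D β‖² / (2 ν)`. -/
noncomputable def gradBeta {n m p : ℕ} (X : Matrix (Fin n) (Fin p) ℝ) (D : Matrix (Fin m) (Fin p) ℝ)
    (y : Fin n → ℝ) (ν : ℝ) (β : Fin p → ℝ) (γ : Fin m → ℝ) : Fin p → ℝ :=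
  nstar X *ᵥ (X *ᵥ β - y) + ν⁻¹ • (Dᵀ *ᵥ (D *ᵥ β - γ))

/-- The gradient in `γ` of `ℓ(β, γ) = ‖y - X β‖² / (2 n) + ‖γ - D β‖² / (2 ν)`. -/
noncomputable def gradGamma {m p : ℕ} (D : Matrix (Fin m) (Fin p) ℝ)
    (ν : ℝ) (β : Fin p → ℝ) (γ : Fin m → ℝ) : Fin m → ℝ :=
  ν⁻¹ • (γ - D *ᵥ β)

/-- The state `(β, z, γ)` of the iteration. -/
structure State (p m : ℕ) where
  β : Fin p → ℝ
  z : Fin m → ℝ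
  γ : Fin m → ℝ

/-- The Split LBI iterates, started at zero. -/
noncomputable def iter {n m p : ℕ} (X : Matrix (Fin n) (Fin p) ℝ) (D : Matrix (Fin m) (Fin p) ℝ)
    (y : Fin n → ℝ) (ν κ α : ℝ) : ℕ → State p m
  | 0 => ⟨0, 0, 0⟩
  | k + 1 =>
    let s := iter X D y ν κ α k
    let z' := s.z - α • gradGamma D ν s.β s.γ
    ⟨s.β - (κ * α) • gradBeta X D y ν s.β s.γ, z', κ • shrink z'⟩

/-- `P_J = I - D_{Jᶜ}† D_{Jᶜ}`, the orthogonal projection onto `ker D_{Jᶜ}`; it is the identity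
when `Jᶜ` is empty. -/
noncomputable def proj {m p : ℕ} (D : Matrix (Fin m) (Fin p) ℝ) (J : Finset (Fin m)) :
    Matrix (Fin p) (Fin p) ℝ :=
  1 - pinv (rows D Jᶜ) * rows D Jᶜ

/-- `S_k = supp(γ_k)`. -/
noncomputable def suppIter {n m p : ℕ} (X : Matrix (Fin n) (Fin p) ℝ)
    (D : Matrix (Fin m) (Fin p) ℝ) (y : Fin n → ℝ) (ν κ α : ℝ) (k : ℕ) : Finset (Fin m) :=
  supp (iter X D y ν κ α k).γ

/-- The revised iterate `P_{S_k} β_k`. -/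
noncomputable def betaTilde {n m p : ℕ} (X : Matrix (Fin n) (Fin p) ℝ)
    (D : Matrix (Fin m) (Fin p) ℝ) (y : Fin n → ℝ) (ν κ α : ℝ) (k : ℕ) : Fin p → ℝ :=
  proj D (suppIter X D y ν κ α k) *ᵥ (iter X D y ν κ α k).β

/-! ### Hessian, identifiable subspace, assumptions -/

/-- The Hessian `H(ν)` of the split loss. -/
noncomputable def hess {n m p : ℕ} (X : Matrix (Fin n) (Fin p) ℝ) (D : Matrix (Fin m) (Fin p) ℝ)
    (ν : ℝ) : Matrix (Fin p ⊕ Fin m) (Fin p ⊕ Fin m) ℝ :=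
  Matrix.fromBlocks (nstar X * X + ν⁻¹ • (Dᵀ * D)) (-(ν⁻¹ • Dᵀ)) (-(ν⁻¹ • D)) (ν⁻¹ • 1)

/-- `H_{(β,S),(β,S)}(ν)`. -/
noncomputable def hessSS {n m p : ℕ} (X : Matrix (Fin n) (Fin p) ℝ) (D : Matrix (Fin m) (Fin p) ℝ)
    (ν : ℝ) (S : Finset (Fin m)) : Matrix (Fin p ⊕ {j // j ∈ S}) (Fin p ⊕ {j // j ∈ S}) ℝ :=
  (hess X D ν).submatrix (Sum.map id Subtype.val) (Sum.map id Subtype.val)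

/-- `H_{Sᶜ,(β,S)}(ν)`. -/
noncomputable def hessScS {n m p : ℕ} (X : Matrix (Fin n) (Fin p) ℝ) (D : Matrix (Fin m) (Fin p) ℝ)
    (ν : ℝ) (S : Finset (Fin m)) : Matrix {j // j ∈ Sᶜ} (Fin p ⊕ {j // j ∈ S}) ℝ :=
  (hess X D ν).submatrix (fun j => Sum.inr j.val) (Sum.map id Subtype.val)

/-- `L = (ker X ∩ ker D)^⊥ = Im Xᵀ + Im Dᵀ`. -/
def identSpace {n m p : ℕ} (X : Matrix (Fin n) (Fin p) ℝ) (D : Matrix (Fin m) (Fin p) ℝ) :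
    Submodule ℝ (Fin p → ℝ) :=
  LinearMap.range Xᵀ.mulVecLin ⊔ LinearMap.range Dᵀ.mulVecLin

/-- Restricted strong convexity:
`βᵀ X* X β ≥ λ ‖β‖²` on `L ∩ {β : D_{Sᶜ} β = 0}` for some `λ > 0`. -/
def RSC {n m p : ℕ} (X : Matrix (Fin n) (Fin p) ℝ) (D : Matrix (Fin m) (Fin p) ℝ)
    (S : Finset (Fin m)) : Prop :=
  ∃ lam : ℝ, 0 < lam ∧ ∀ β ∈ identSpace X D, rows D Sᶜ *ᵥ β = 0 →
    lam * l2norm β ^ 2 ≤ β ⬝ᵥ ((nstar X * X) *ᵥ β)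

/-- Restricted strong convexity of the split loss, with constant `C / (1 + ν)`, on
`L ⊕ ℝ^S`. -/
def RSCSplit {n m p : ℕ} (X : Matrix (Fin n) (Fin p) ℝ) (D : Matrix (Fin m) (Fin p) ℝ)
    (S : Finset (Fin m)) (C ν : ℝ) : Prop :=
  ∀ β ∈ identSpace X D, ∀ γ : {j // j ∈ S} → ℝ,
    C / (1 + ν) * l2norm (Sum.elim β γ) ^ 2 ≤
      Sum.elim β γ ⬝ᵥ (hessSS X D ν S *ᵥ Sum.elim β γ)

/-- The irrepresentable condition at `ν` with constant `η`. The norm is the sup norm. -/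
def IRR {n m p : ℕ} (X : Matrix (Fin n) (Fin p) ℝ) (D : Matrix (Fin m) (Fin p) ℝ)
    (S : Finset (Fin m)) (ν η : ℝ) : Prop :=
  ∀ ρ : {j // j ∈ S} → ℝ, (∀ j, ρ j ∈ Set.Icc (-1 : ℝ) 1) →
    ‖(hessScS X D ν S * pinv (hessSS X D ν S)) *ᵥ Sum.elim (0 : Fin p → ℝ) ρ‖ ≤ 1 - η

/-! ### Constants -/

/-- Every nonzero singular value of `Q` is at least `c`, i.e. `λ_{min,+}(Q) ≥ c`
(with the minimum over the empty set being `+∞`). -/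
def PosSingularGE {ι : Type*} [Fintype ι] {p : ℕ} (Q : Matrix ι (Fin p) ℝ) (c : ℝ) : Prop :=
  ∀ i : ℕ, (Matrix.toEuclideanLin Q).singularValues i ≠ 0 →
    c ≤ (Matrix.toEuclideanLin Q).singularValues i

/-- The largest singular value. Mathlib lists the singular values in decreasing order from
index `0`. -/
noncomputable def maxSingular {ι : Type*} [Fintype ι] {p : ℕ} (Q : Matrix ι (Fin p) ℝ) : ℝ :=
  (Matrix.toEuclideanLin Q).singularValues 0

/-- The restriction of `X / √n` to `ker D`. In an orthonormal basis of `ker D`, given by the columns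
of a matrix `W`, this is the matrix `X W / √n`. -/
noncomputable def restrKer {n m p : ℕ} (X : Matrix (Fin n) (Fin p) ℝ)
    (D : Matrix (Fin m) (Fin p) ℝ) :
    LinearMap.ker (Matrix.toEuclideanLin D) →ₗ[ℝ] EuclideanSpace ℝ (Fin n) :=
  (Real.sqrt n)⁻¹ • (Matrix.toEuclideanLin X ∘ₗ (LinearMap.ker (Matrix.toEuclideanLin D)).subtype)

/-- `r' = dim {X β : β ∈ ker D}`. -/
noncomputable def rPrime {n m p : ℕ} (X : Matrix (Fin n) (Fin p) ℝ)
    (D : Matrix (Fin m) (Fin p) ℝ) : ℕ :=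
  Module.finrank ℝ ((LinearMap.ker D.mulVecLin).map X.mulVecLin)

/-- `1 / λ₁`, where `λ₁` is the smallest nonzero singular value of the restriction of `X / √n` to
`ker D`, and `λ₁ = +∞` if there is none. The nonzero singular values are those with index below
the rank `r'`. -/
noncomputable def invLamOne {n m p : ℕ} (X : Matrix (Fin n) (Fin p) ℝ)
    (D : Matrix (Fin m) (Fin p) ℝ) : ℝ :=
  if rPrime X D = 0 then 0 else 1 / (restrKer X D).singularValues (rPrime X D - 1)

/-- The constants `λ_D, Λ_D, Λ_X` bound the singular values of `D`, `D_{Sᶜ}` and `X* X`. -/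
structure ConstBounds {n m p : ℕ} (X : Matrix (Fin n) (Fin p) ℝ) (D : Matrix (Fin m) (Fin p) ℝ)
    (S : Finset (Fin m)) (lamD LamD LamX : ℝ) : Prop where
  lamD_pos : 0 < lamD
  LamD_pos : 0 < LamD
  LamX_pos : 0 < LamX
  lamD_le : PosSingularGE D lamD
  lamD_le_compl : PosSingularGE (rows D Sᶜ) lamD
  le_LamD : maxSingular D ≤ LamD
  le_LamX : maxSingular (nstar X * X) ≤ LamX ^ 2

/-- The lower bound required of `κ`, as a function of `lam` (to be `λ_H'`); `b` is `‖β⋆‖₂` and `q`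
is `1 / λ₁`. -/
noncomputable def kappaBound (η ν σ lamD LamD LamX q b lam : ℝ) : ℝ :=
  4 / η * (1 + 1 / lamD + LamX * q / lamD)
    * (1 + Real.sqrt (2 * (1 + ν * LamX ^ 2 + LamD ^ 2) / (lam * ν)))
    * ((1 + LamD) * b
      + 2 * σ / lam * (LamX / lamD + LamX / lamD ^ 2
        + (lam * lamD ^ 2 + LamX ^ 2) * q / lamD ^ 2))

/-- `τ̄`. -/
noncomputable def tauBar (n m : ℕ) (σ η lamD LamX : ℝ) : ℝ :=
  η / (8 * σ) * (lamD / LamX) * Real.sqrt (n / Real.log m)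

/-- `λ_H' = λ_H (1 - κ α ‖H‖₂ / 2)` with `λ_H = C / (1 + ν)`. -/
noncomputable def lamHPrime {n m p : ℕ} (X : Matrix (Fin n) (Fin p) ℝ)
    (D : Matrix (Fin m) (Fin p) ℝ) (C ν κ α : ℝ) : ℝ :=
  C / (1 + ν) * (1 - κ * α * specNorm (hess X D ν) / 2)

/-- The minimal signal strength; `lam` is `λ_H'` and `tau` is `τ̄`. -/
noncomputable def signalBound (n m s : ℕ) (σ η lamD LamD LamX α lam tau : ℝ) : ℝ :=
  16 * σ / (η * lam * (1 - 5 * α / tau)) * (LamX * LamD / lamD ^ 2)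
    * (2 * Real.log s + 5 + Real.log (max 1 (8 * LamD))) * Real.sqrt (Real.log m / n)

/-- The `ℓ₂` error bound without the support-mismatch term; `lam` is `λ_H'`, `tau` is `τ̄`,
`q` is `1 / λ₁`, and `r` is `r'`. -/
noncomputable def errorBound (n m s r : ℕ) (σ η lamD LamD LamX q α lam tau : ℝ) : ℝ :=
  80 * σ / (η * lam * (1 - α / tau)) * (LamX * (LamD + lamD ^ 2) / lamD ^ 3)
      * Real.sqrt (s * Real.log m / n)
    + 2 * σ / lam * (LamX / lamD ^ 2 + (lam * lamD ^ 2 + LamX ^ 2) * q / lamD ^ 2)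
      * Real.sqrt (r * Real.log m / n)

/-- `‖D_{Jᶜ}† D_{Jᶜ ∩ S} β‖₂`, where `D_{Jᶜ ∩ S} β` is extended by zero to a vector indexed
by `Jᶜ`. -/
noncomputable def mismatch {m p : ℕ} (D : Matrix (Fin m) (Fin p) ℝ) (J S : Finset (Fin m))
    (β : Fin p → ℝ) : ℝ :=
  l2norm (pinv (rows D Jᶜ) *ᵥ (fun j => if j.val ∈ S then (D *ᵥ β) j.val else 0))

end SplitLBI

open SplitLBI

namespace SplitLBI

/-! ### Scalar recursions -/

/-! As long as `γ` vanishes off `S`, the scheme is a linearized Bregman iteration on the coordinates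
`(β, γ_S)` alone. Its quadratic loss is minimized at the oracle estimator `(β⋆ + u, D_S(β⋆ + u))`,
where `u` is a linear image of the noise. Write `e` for the root of the excess energy divided by
`λ_H` (`GoodRun.gap`); by restricted convexity it dominates the distance to the oracle. Each step
lowers the Bregman potential `P` by at least `α λ_H' e²`, and `e` never increases (`potential_step`,
`energy_step`).

Two comparisons close the recursion. Always `P ≤ (17/8) √s e`, and `P ≤ (17/8) e² / g` when every
oracle signal on `S` is at least `g` (`potential_le_sqrt`, `potential_le_of_gap`). The first makes
`P` decay like `1/k` and leaves `e` of order `√s / (λ_H' τ̄)` at the stopping time (`terminal_le`),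
which is the `ℓ₂` rate. The second adds geometric decay, which trades the factor `√s` for `log s`
(`terminal_le_of_gap`); then `e` falls below the signal and all signs are right.

It remains to show that no inactive row enters before `τ̄` (`GoodRun.no_false_positive`). Summing
the updates expresses `z` on `Sᶜ` through the weak solution of one linear problem with three
sources: the noise times the elapsed time, `β_k / κ`, and `z_S`. The irrepresentable condition
handles `z_S`, large `κ` handles `β_k / κ`, and `τ̄` is chosen so that the noise uses at most `η/4`
(`abs_dual_le`). Strong induction makes this consistent with the Bregman estimates that bound `β_k`
and `z_S`.

The noise enters only through its norm and finitely many fixed linear functionals of it. Their sizes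
come from energy estimates for the split form in which `γ_S` has been eliminated (`coercive_sparse`,
`norm_response`), and their tails from sub-Gaussian bounds. The random support causes no further
union bound: the projection onto `ker D_{S_kᶜ}` is controlled by those onto `ker D` and `ker D_{Sᶜ}`
(`norm_nested_proj_le`). -/

theorem le_inv_of_quadratic_decrease {P e : ℕ → ℝ} {a b : ℝ} {N : ℕ} (ha : 0 < a) (hb : 0 < b)
    (hP : ∀ k ≤ N, 0 ≤ P k) (hstep : ∀ k < N, P (k + 1) ≤ P k - a * e k ^ 2)
    (hPe : ∀ k ≤ N, P k ≤ b * e k) :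
    ∀ k ≤ N, (k : ℝ) * (a * P k) ≤ b ^ 2 := by
  intro k
  induction k with
  | zero => intro _; simp; positivity
  | succ k ih =>
    intro hk
    have h1 := ih (by omega)
    have hPk := hP k (by omega)
    have hPk1 := hP (k + 1) hk
    have h2 := hstep k (by omega)
    have h3 := hPe k (by omega)
    have h4 : P k ^ 2 ≤ b ^ 2 * e k ^ 2 := by
      rw [← mul_pow]; exact pow_le_pow_left₀ hPk h3 2
    -- In the normalization `y = a P / b²` the recursion reads `y' ≤ y - y²`, and `(1 - k y)(1 - y)
    -- ≥ 0` carries `k y ≤ 1` to the next index. If `y` exceeded `1`, the next potential would be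
    -- negative.
    set y : ℝ := a * P k / b ^ 2 with hy
    have hb2 : 0 < b ^ 2 := by positivity
    have hyP : a * P k = y * b ^ 2 := by rw [hy]; field_simp
    have h5 : a * P (k + 1) ≤ (y - y ^ 2) * b ^ 2 := by
      have : a * (a * e k ^ 2) ≥ y ^ 2 * b ^ 2 := by
        have : y ^ 2 * b ^ 2 = a ^ 2 * P k ^ 2 / b ^ 2 := by rw [hy]; field_simp
        rw [this, ge_iff_le, div_le_iff₀ hb2]
        nlinarith [sq_nonneg a]
      nlinarith
    have hy0 : 0 ≤ y := by positivity
    have hky : (k : ℝ) * y ≤ 1 := by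
      rw [hyP] at h1
      by_contra hcon
      push Not at hcon
      nlinarith
    have hy1 : y ≤ 1 := by
      by_contra hcon
      push Not at hcon
      have : 0 ≤ a * P (k + 1) := by positivity
      nlinarith [mul_pos (show 0 < y * (y - 1) by nlinarith) hb2]
    have h6 : ((k : ℝ) + 1) * (y - y ^ 2) ≤ 1 := by
      nlinarith [mul_nonneg (sub_nonneg.2 hky) (sub_nonneg.2 hy1)]
    push_cast
    have hk0 : (0 : ℝ) ≤ (k : ℝ) + 1 := by positivity
    calc ((k : ℝ) + 1) * (a * P (k + 1)) ≤ ((k : ℝ) + 1) * ((y - y ^ 2) * b ^ 2) :=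
          mul_le_mul_of_nonneg_left h5 hk0
      _ = (((k : ℝ) + 1) * (y - y ^ 2)) * b ^ 2 := by ring
      _ ≤ 1 * b ^ 2 := by gcongr
      _ = b ^ 2 := one_mul _

/-- Since `e` is nonincreasing, each step between `h` and `N` lowers the potential by at least `a (e
N)²`. -/
theorem window_sum_le {P e : ℕ → ℝ} {a : ℝ} {N : ℕ} (ha : 0 < a)
    (hP : ∀ k ≤ N, 0 ≤ P k) (hstep : ∀ k < N, P (k + 1) ≤ P k - a * e k ^ 2)
    (hmono : ∀ k < N, e (k + 1) ≤ e k) (he : ∀ k ≤ N, 0 ≤ e k) (h : ℕ) (hh : h ≤ N) :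
    ((N : ℝ) - h) * (a * e N ^ 2) ≤ P h := by
  have hle : ∀ j, h + j ≤ N → e N ≤ e (N - j) := by
    intro j
    induction j with
    | zero => intro _; simp
    | succ j ih =>
      intro hj
      refine (ih (by omega)).trans ?_
      have := hmono (N - (j + 1)) (by omega)
      rwa [show N - (j + 1) + 1 = N - j by omega] at this
  have hle' : ∀ k, h ≤ k → k ≤ N → e N ≤ e k := by
    intro k hk hkN
    have := hle (N - k) (by omega)
    rwa [show N - (N - k) = k by omega] at this
  have key : ∀ j, h + j ≤ N → P (h + j) + j * (a * e N ^ 2) ≤ P h := by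
    intro j
    induction j with
    | zero => intro _; simp
    | succ j ih =>
      intro hj
      have h1 := ih (by omega)
      have h2 := hstep (h + j) (by omega)
      have h3 : e N ^ 2 ≤ e (h + j) ^ 2 :=
        pow_le_pow_left₀ (he N le_rfl) (hle' _ (by omega) (by omega)) 2
      have h4 := mul_le_mul_of_nonneg_left h3 ha.le
      rw [← add_assoc]
      push_cast
      linarith
  have h1 := key (N - h) (by omega)
  rw [show h + (N - h) = N by omega, Nat.cast_sub hh] at h1
  linarith [hP N le_rfl]

theorem geometric_decrease {P e : ℕ → ℝ} {a b : ℝ} {N : ℕ} (ha : 0 < a) (hb : 0 < b)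
    (hP : ∀ k ≤ N, 0 ≤ P k) (hstep : ∀ k < N, P (k + 1) ≤ P k - a * e k ^ 2)
    (hPe : ∀ k ≤ N, P k ≤ b * e k ^ 2) (h j : ℕ) (hj : h + j ≤ N) :
    P (h + j) ≤ P h * Real.exp (-(j * a / b)) := by
  induction j with
  | zero => simp
  | succ j ih =>
    have h1 := ih (by omega)
    have h2 := hstep (h + j) (by omega)
    have h3 := hPe (h + j) (by omega)
    have h4 : P (h + j + 1) ≤ P (h + j) * (1 - a / b) := by
      have : a * P (h + j) / b ≤ a * e (h + j) ^ 2 := by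
        rw [div_le_iff₀ hb]; nlinarith
      have h5 : P (h + j) * (1 - a / b) = P (h + j) - a * P (h + j) / b := by ring
      linarith
    have h5 : 1 - a / b ≤ Real.exp (-(a / b)) := by
      have := Real.add_one_le_exp (-(a / b)); linarith
    rw [← add_assoc]
    calc P (h + j + 1) ≤ P (h + j) * (1 - a / b) := h4
      _ ≤ P (h + j) * Real.exp (-(a / b)) :=
          mul_le_mul_of_nonneg_left h5 (hP _ (by omega))
      _ ≤ P h * Real.exp (-(j * a / b)) * Real.exp (-(a / b)) := by gcongr
      _ = _ := by rw [mul_assoc, ← Real.exp_add]; congr 2; push_cast; ring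

/-- The first half of the run makes the potential small through the `1/k` decay; the second half
spends what is left, and the last `e` is the smallest one. -/
theorem terminal_le {P e : ℕ → ℝ} {a b : ℝ} {N : ℕ} (ha : 0 < a) (hb : 0 < b) (hN : 2 ≤ N)
    (hP : ∀ k ≤ N, 0 ≤ P k) (hstep : ∀ k < N, P (k + 1) ≤ P k - a * e k ^ 2)
    (hmono : ∀ k < N, e (k + 1) ≤ e k) (he : ∀ k ≤ N, 0 ≤ e k)
    (hPe : ∀ k ≤ N, P k ≤ b * e k) :
    e N * (a * N) ≤ 5 / 2 * b := by
  have h1 := window_sum_le ha hP hstep hmono he (N / 2) (by omega)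
  have h2 := le_inv_of_quadratic_decrease ha hb hP hstep hPe (N / 2) (by omega)
  set h : ℝ := ((N / 2 : ℕ) : ℝ) with hh
  have h3 : (N : ℝ) - 1 ≤ 2 * h := by
    have : N ≤ 2 * (N / 2) + 1 := by omega
    have : (N : ℝ) ≤ 2 * h + 1 := by rw [hh]; exact_mod_cast this
    linarith
  have h4 : 2 * h ≤ N := by
    have : 2 * (N / 2) ≤ N := by omega
    rw [hh]; exact_mod_cast this
  have hN' : (2 : ℝ) ≤ N := by exact_mod_cast hN
  have h0 : 0 ≤ h := by positivity
  -- Integer halving loses at most one half from `N / 2`, so for `N ≥ 2` the product stays above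
  -- `4/25 N²`; this is the square of `2/5 N`, which is where `5/2` comes from.
  have h5 : (4 / 25 : ℝ) * N ^ 2 ≤ h * (N - h) := by nlinarith
  have h6 : (h * (N - h)) * (a * e N) ^ 2 ≤ b ^ 2 := by
    calc (h * (N - h)) * (a * e N) ^ 2 = h * (a * ((N - h) * (a * e N ^ 2))) := by ring
      _ ≤ h * (a * P (N / 2)) := by gcongr
      _ ≤ b ^ 2 := h2
  have h7 : (2 / 5 * (e N * (a * N))) ^ 2 ≤ b ^ 2 := by
    calc (2 / 5 * (e N * (a * N))) ^ 2 = (4 / 25 * (N : ℝ) ^ 2) * (a * e N) ^ 2 := by ring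
      _ ≤ (h * (N - h)) * (a * e N) ^ 2 := by gcongr
      _ ≤ b ^ 2 := h6
  have := le_of_sq_le_sq h7 hb.le
  linarith

/-- Three phases: `1/k` decay for time `b R / g`, geometric decay for time `b log s / g`, which
divides the potential by `s` and cancels the `s` left by the first phase, then a window of time `b R
/ g` in which `e` is read off. The term `2 a` pays for rounding up the first two lengths. -/
theorem terminal_le_of_gap {P e : ℕ → ℝ} {a b s g R : ℝ} {N : ℕ} (ha : 0 < a) (hb : 0 < b)
    (hs : 1 ≤ s) (hg : 0 < g) (hR : 0 < R)
    (hP : ∀ k ≤ N, 0 ≤ P k) (hstep : ∀ k < N, P (k + 1) ≤ P k - a * e k ^ 2)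
    (hmono : ∀ k < N, e (k + 1) ≤ e k) (he : ∀ k ≤ N, 0 ≤ e k)
    (hPe : ∀ k ≤ N, P k ≤ b * Real.sqrt s * e k) (hPg : ∀ k ≤ N, P k ≤ b / g * e k ^ 2)
    (hN : b * (2 * R + Real.log s) / g + 2 * a ≤ a * N) :
    R * e N ≤ g := by
  have hlog : 0 ≤ Real.log s := Real.log_nonneg hs
  have hs0 : 0 < s := by linarith
  set h₁ : ℕ := ⌈b * R / (g * a)⌉₊ with hh1
  set h₂ : ℕ := ⌈b * Real.log s / (g * a)⌉₊ with hh2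
  have l1 : b * R / (g * a) ≤ h₁ := Nat.le_ceil _
  have l2 : b * Real.log s / (g * a) ≤ h₂ := Nat.le_ceil _
  have u1 : (h₁ : ℝ) < b * R / (g * a) + 1 := Nat.ceil_lt_add_one (by positivity)
  have u2 : (h₂ : ℝ) < b * Real.log s / (g * a) + 1 := Nat.ceil_lt_add_one (by positivity)
  have e1 : a * (b * R / (g * a)) = b * R / g := by field_simp
  have e2 : a * (b * Real.log s / (g * a)) = b * Real.log s / g := by field_simp
  have l1' : b * R / g ≤ a * h₁ := by rw [← e1]; gcongr
  have l2' : b * Real.log s / g ≤ a * h₂ := by rw [← e2]; gcongr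
  have u1' : a * h₁ ≤ b * R / g + a := by rw [← e1]; nlinarith
  have u2' : a * h₂ ≤ b * Real.log s / g + a := by rw [← e2]; nlinarith
  have hsplit : b * (2 * R + Real.log s) / g = 2 * (b * R / g) + b * Real.log s / g := by ring
  have hbR : 0 < b * R / g := by positivity
  have l3 : b * R / g ≤ a * (N - (h₁ + h₂)) := by
    rw [hsplit] at hN; linarith
  have hle : h₁ + h₂ ≤ N := by
    have : (h₁ : ℝ) + h₂ ≤ N := by
      by_contra hcon
      push Not at hcon
      nlinarith
    exact_mod_cast this
  have hb' : 0 < b * Real.sqrt s := by positivity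
  have k1 := le_inv_of_quadratic_decrease ha hb' hP hstep hPe h₁ (by omega)
  have k2 := geometric_decrease ha (by positivity : 0 < b / g) hP hstep hPg h₁ h₂ hle
  have k3 := window_sum_le ha hP hstep hmono he (h₁ + h₂) hle
  push_cast at k3
  have k4 : Real.exp (-(h₂ * a / (b / g))) ≤ 1 / s := by
    rw [one_div, ← Real.exp_log hs0, ← Real.exp_neg]
    apply Real.exp_le_exp.2
    apply neg_le_neg
    rw [le_div_iff₀ (by positivity)]
    calc Real.log s * (b / g) = b * Real.log s / g := by ring
      _ ≤ a * h₂ := l2'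
      _ = _ := by ring
  have hP1 := hP h₁ (by omega)
  rw [mul_pow, Real.sq_sqrt hs0.le] at k1
  have k5 : (b * R / g) * P h₁ ≤ b ^ 2 * s :=
    le_trans (by
      calc (b * R / g) * P h₁ ≤ (a * h₁) * P h₁ := by gcongr
        _ = h₁ * (a * P h₁) := by ring) k1
  have k6 : (b * R / g) * e N ^ 2 ≤ P h₁ * (1 / s) := by
    calc (b * R / g) * e N ^ 2 ≤ (a * (N - (h₁ + h₂))) * e N ^ 2 := by gcongr
      _ = (N - (h₁ + h₂)) * (a * e N ^ 2) := by ring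
      _ ≤ P (h₁ + h₂) := k3
      _ ≤ P h₁ * Real.exp (-(h₂ * a / (b / g))) := k2
      _ ≤ P h₁ * (1 / s) := by gcongr
  have k7 : (b * R / g) ^ 2 * e N ^ 2 ≤ b ^ 2 := by
    calc (b * R / g) ^ 2 * e N ^ 2 = (b * R / g) * ((b * R / g) * e N ^ 2) := by ring
      _ ≤ (b * R / g) * (P h₁ * (1 / s)) := by gcongr
      _ = ((b * R / g) * P h₁) * (1 / s) := by ring
      _ ≤ (b ^ 2 * s) * (1 / s) := by gcongr
      _ = b ^ 2 := by field_simp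
  have k8 : (b / g * (R * e N)) ^ 2 ≤ b ^ 2 := by
    calc _ = (b * R / g) ^ 2 * e N ^ 2 := by ring
      _ ≤ _ := k7
  have k9 := le_of_sq_le_sq k8 hb.le
  have : b / g * (R * e N) ≤ b / g * g := by rw [div_mul_cancel₀ _ hg.ne']; exact k9
  exact le_of_mul_le_mul_left this (by positivity)

/-! ### Descent along a linearized Bregman path -/

/-- `w` and `ρ` follow the linearized Bregman iteration, for `N` steps, for the quadratic loss with
Hessian `M` and minimizer `w₀`; the penalty is the weighted `ℓ₁`-norm with weights `c`, and `ρ k` is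
a subgradient of it at `w k`. -/
structure IsBregmanPath {ι : Type*} [Fintype ι] (M : Matrix ι ι ℝ) (c : ι → ℝ) (κ α : ℝ)
    (w₀ : ι → ℝ) (w ρ : ℕ → ι → ℝ) (N : ℕ) : Prop where
  step : ∀ k < N, ∀ i, ρ (k + 1) i - ρ k i + (w (k + 1) i - w k i) / κ
    = -(α * (M *ᵥ (w k - w₀)) i)
  abs_le : ∀ k i, |ρ k i| ≤ c i
  mul_eq : ∀ k i, ρ k i * w k i = c i * |w k i|

/-- The quadratic energy `dᵀ M d`. -/
def energy {ι : Type*} [Fintype ι] (M : Matrix ι ι ℝ) (d : ι → ℝ) : ℝ := d ⬝ᵥ (M *ᵥ d)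

/-- The Bregman potential. -/
noncomputable def potential {ι : Type*} [Fintype ι] (c : ι → ℝ) (κ : ℝ) (w₀ w ρ : ι → ℝ) : ℝ :=
  ∑ i, (c i * |w₀ i| - ρ i * w₀ i + (w i - w₀ i) ^ 2 / (2 * κ))

section Bregman

variable {ι : Type*} [Fintype ι] {M : Matrix ι ι ℝ} {c : ι → ℝ} {κ α : ℝ}
  {w₀ : ι → ℝ} {w ρ : ℕ → ι → ℝ} {N : ℕ}

theorem mul_le_of_subgradient {c r a : ℝ} (h : |r| ≤ c) : r * a ≤ c * |a| := by
  calc r * a ≤ |r * a| := le_abs_self _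
    _ = |r| * |a| := abs_mul _ _
    _ ≤ c * |a| := by gcongr

theorem potential_nonneg (hκ : 0 < κ) (h : IsBregmanPath M c κ α w₀ w ρ N) (k : ℕ) :
    0 ≤ potential c κ w₀ (w k) (ρ k) := by
  refine Finset.sum_nonneg fun i _ => ?_
  have h1 := mul_le_of_subgradient (a := w₀ i) (h.abs_le k i)
  have : 0 ≤ (w k i - w₀ i) ^ 2 / (2 * κ) := by positivity
  linarith

/-- Coordinatewise, the potential change falls short of the linear term plus `κ α² g² / 2` by `r w'
+ κ r² / 2`, where `w'` is the new iterate, `r` the increment of the subgradient and `g` the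
gradient. The subgradient inequality gives `r w' ≥ 0`. The assumed bound on `M²` then turns the
squared gradient into energy. -/
theorem potential_step (hκ : 0 < κ) (h : IsBregmanPath M c κ α w₀ w ρ N) {H : ℝ}
    (hM : ∀ d : ι → ℝ, (M *ᵥ d) ⬝ᵥ (M *ᵥ d) ≤ H * energy M d) {k : ℕ} (hk : k < N) :
    potential c κ w₀ (w (k + 1)) (ρ (k + 1)) ≤ potential c κ w₀ (w k) (ρ k)
      - α * (1 - κ * α * H / 2) * energy M (w k - w₀) := by
  have h1 : potential c κ w₀ (w (k + 1)) (ρ (k + 1)) ≤ potential c κ w₀ (w k) (ρ k)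
      - α * energy M (w k - w₀)
      + κ * α ^ 2 / 2 * ((M *ᵥ (w k - w₀)) ⬝ᵥ (M *ᵥ (w k - w₀))) := by
    unfold potential energy dotProduct
    rw [Finset.mul_sum, Finset.mul_sum, ← Finset.sum_sub_distrib, ← Finset.sum_add_distrib]
    refine Finset.sum_le_sum fun i _ => ?_
    have hs := h.step k hk i
    set g := (M *ᵥ (w k - w₀)) i
    have hw : ρ k i * w (k + 1) i ≤ ρ (k + 1) i * w (k + 1) i := by
      rw [h.mul_eq]; exact mul_le_of_subgradient (h.abs_le k i)
    have hg : α * g = -(ρ (k + 1) i - ρ k i + (w (k + 1) i - w k i) / κ) := by linarith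
    have e1 : κ * α ^ 2 / 2 * (g * g) = κ / 2 * (α * g) ^ 2 := by ring
    have e2 : α * ((w k - w₀) i * g) = (w k i - w₀ i) * (α * g) := by
      simp only [Pi.sub_apply]; ring
    rw [e1, e2, hg]
    set r := ρ (k + 1) i - ρ k i with hr
    have : κ / 2 * (-(r + (w (k + 1) i - w k i) / κ)) ^ 2
        = κ / 2 * r ^ 2 + r * (w (k + 1) i - w k i) + (w (k + 1) i - w k i) ^ 2 / (2 * κ) := by
      field_simp; ring
    rw [this]
    have e3 : (w (k + 1) i - w₀ i) ^ 2 / (2 * κ) = (w k i - w₀ i) ^ 2 / (2 * κ)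
        + (w k i - w₀ i) * ((w (k + 1) i - w k i) / κ) + (w (k + 1) i - w k i) ^ 2 / (2 * κ) := by
      field_simp; ring
    rw [e3]
    have : 0 ≤ κ / 2 * r ^ 2 := by positivity
    have e4 : ρ (k + 1) i = ρ k i + r := by rw [hr]; ring
    rw [e4] at hw ⊢
    nlinarith
  have h2 := hM (w k - w₀)
  have h3 : κ * α ^ 2 / 2 * ((M *ᵥ (w k - w₀)) ⬝ᵥ (M *ᵥ (w k - w₀)))
      ≤ κ * α ^ 2 / 2 * (H * energy M (w k - w₀)) :=
    mul_le_mul_of_nonneg_left h2 (by positivity)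
  calc _ ≤ _ := h1
    _ ≤ potential c κ w₀ (w k) (ρ k) - α * energy M (w k - w₀)
      + κ * α ^ 2 / 2 * (H * energy M (w k - w₀)) := by linarith
    _ = _ := by ring

/-- Monotonicity of the subdifferential makes the increment `δ` a descent direction, with `κ α ⟨δ, M
d⟩ ≤ -‖δ‖²`. The step-size condition lets this absorb the second-order term. -/
theorem energy_step (hκ : 0 < κ) (hα : 0 < α) (hsymm : Mᵀ = M)
    (h : IsBregmanPath M c κ α w₀ w ρ N) {H : ℝ}
    (hM : ∀ d : ι → ℝ, energy M d ≤ H * (d ⬝ᵥ d)) (hH : κ * α * H ≤ 2) {k : ℕ} (hk : k < N) :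
    energy M (w (k + 1) - w₀) ≤ energy M (w k - w₀) := by
  set d := w k - w₀ with hd
  set δ := w (k + 1) - w k with hδ
  have hsum : w (k + 1) - w₀ = d + δ := by rw [hd, hδ]; abel
  have hexp : energy M (d + δ) = energy M d + 2 * (δ ⬝ᵥ (M *ᵥ d)) + energy M δ := by
    unfold energy
    have hs : d ⬝ᵥ (M *ᵥ δ) = δ ⬝ᵥ (M *ᵥ d) := by
      rw [dotProduct_mulVec, ← mulVec_transpose, hsymm, dotProduct_comm]
    rw [mulVec_add, add_dotProduct, dotProduct_add, dotProduct_add, hs]; ring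
  have hcross : (κ * α) * (δ ⬝ᵥ (M *ᵥ d)) ≤ -(δ ⬝ᵥ δ) := by
    unfold dotProduct
    rw [Finset.mul_sum, ← Finset.sum_neg_distrib]
    refine Finset.sum_le_sum fun i _ => ?_
    have hs := h.step k hk i
    rw [← hd] at hs
    have h1 : ρ k i * w (k + 1) i ≤ ρ (k + 1) i * w (k + 1) i := by
      rw [h.mul_eq]; exact mul_le_of_subgradient (h.abs_le k i)
    have h2 : ρ (k + 1) i * w k i ≤ ρ k i * w k i := by
      rw [h.mul_eq]; exact mul_le_of_subgradient (h.abs_le (k + 1) i)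
    have hδi : δ i = w (k + 1) i - w k i := by rw [hδ]; rfl
    have h3 : 0 ≤ (ρ (k + 1) i - ρ k i) * δ i := by rw [hδi]; nlinarith
    have h4 : κ * α * (δ i * (M *ᵥ d) i) = -(κ * ((ρ (k + 1) i - ρ k i) * δ i)) - δ i * δ i := by
      have : α * (M *ᵥ d) i = -(ρ (k + 1) i - ρ k i + δ i / κ) := by rw [hδi]; linarith
      calc κ * α * (δ i * (M *ᵥ d) i) = κ * δ i * (α * (M *ᵥ d) i) := by ring
        _ = _ := by rw [this]; field_simp; ring
    rw [h4]
    have := mul_nonneg hκ.le h3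
    linarith
  rw [hsum, hexp]
  have h5 := hM δ
  have h6 : 0 ≤ δ ⬝ᵥ δ := Finset.sum_nonneg fun i _ => mul_self_nonneg _
  have hκα : 0 < κ * α := by positivity
  have h7 : κ * α * energy M δ ≤ 2 * (δ ⬝ᵥ δ) := by
    calc κ * α * energy M δ ≤ κ * α * (H * (δ ⬝ᵥ δ)) := by gcongr
      _ = (κ * α * H) * (δ ⬝ᵥ δ) := by ring
      _ ≤ 2 * (δ ⬝ᵥ δ) := by gcongr
  nlinarith

/-- A Bregman distance of a weighted `ℓ₁`-norm is at most twice the weighted `ℓ₁`-distance, to which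
Cauchy–Schwarz applies. -/
theorem potential_le_sqrt (h : IsBregmanPath M c κ α w₀ w ρ N) (k : ℕ) :
    potential c κ w₀ (w k) (ρ k) ≤ 2 * Real.sqrt (∑ i, c i ^ 2) *
      Real.sqrt ((w k - w₀) ⬝ᵥ (w k - w₀)) + ((w k - w₀) ⬝ᵥ (w k - w₀)) / (2 * κ) := by
  have h1 : potential c κ w₀ (w k) (ρ k) ≤ ∑ i, (2 * (c i * |w k i - w₀ i|)
      + (w k i - w₀ i) ^ 2 / (2 * κ)) := by
    refine Finset.sum_le_sum fun i _ => ?_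
    have h1 := mul_le_of_subgradient (a := w k i - w₀ i) (h.abs_le k i)
    have h2 := h.mul_eq k i
    have hc : 0 ≤ c i := (abs_nonneg _).trans (h.abs_le k i)
    have h3 : c i * |w₀ i| ≤ c i * |w k i| + c i * |w k i - w₀ i| := by
      rw [← mul_add]
      gcongr
      have := abs_sub_abs_le_abs_sub (w₀ i) (w k i)
      rw [abs_sub_comm] at this
      linarith
    nlinarith
  refine h1.trans ?_
  rw [Finset.sum_add_distrib, ← Finset.mul_sum, ← Finset.sum_div]
  have h2 : ∑ i, c i * |w k i - w₀ i| ≤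
      Real.sqrt (∑ i, c i ^ 2) * Real.sqrt ((w k - w₀) ⬝ᵥ (w k - w₀)) := by
    refine (Real.sum_mul_le_sqrt_mul_sqrt _ _ _).trans (le_of_eq ?_)
    simp [dotProduct, pow_two]
  have h3 : ∑ i, (w k i - w₀ i) ^ 2 = (w k - w₀) ⬝ᵥ (w k - w₀) := by
    simp [dotProduct, pow_two]
  rw [h3]
  linarith

/-- If `|w - w₀| < |w₀|` in a coordinate, then `w` and `w₀` have the same sign, the subgradient at
`w` is also one at `w₀`, and the `ℓ₁` part vanishes. Otherwise `|w - w₀| ≥ g`, so the linear bound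
is at most a quadratic one divided by `g`. -/
theorem potential_le_of_gap (h : IsBregmanPath M c κ α w₀ w ρ N) {g : ℝ} (hg : 0 < g)
    (hc : ∀ i, c i ≤ 1) (hgap : ∀ i, c i = 0 ∨ g ≤ |w₀ i|) (k : ℕ) :
    potential c κ w₀ (w k) (ρ k) ≤ (2 / g + 1 / (2 * κ)) * ((w k - w₀) ⬝ᵥ (w k - w₀)) := by
  unfold potential dotProduct
  rw [Finset.mul_sum]
  refine Finset.sum_le_sum fun i _ => ?_
  simp only [Pi.sub_apply]
  have hab := h.abs_le k i
  have hc0 : 0 ≤ c i := (abs_nonneg _).trans hab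
  have h2 := h.mul_eq k i
  suffices c i * |w₀ i| - ρ k i * w₀ i ≤ 2 / g * (w k i - w₀ i) ^ 2 by
    have e : (2 / g + 1 / (2 * κ)) * ((w k i - w₀ i) * (w k i - w₀ i))
        = 2 / g * (w k i - w₀ i) ^ 2 + (w k i - w₀ i) ^ 2 / (2 * κ) := by ring
    rw [e]; linarith
  rcases hgap i with h0 | hgi
  · rw [h0] at hab
    have : ρ k i = 0 := abs_eq_zero.1 (le_antisymm hab (abs_nonneg _))
    rw [h0, this]
    have : 0 ≤ 2 / g * (w k i - w₀ i) ^ 2 := by positivity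
    linarith
  · by_cases hlt : |w k i - w₀ i| < |w₀ i|
    · have hpos : 0 < w k i * w₀ i := by
        by_contra hcon
        push Not at hcon
        have := sq_lt_sq.2 hlt
        nlinarith [sq_nonneg (w k i)]
      have hw0 : w k i ≠ 0 := fun h0 => by simp [h0] at hpos
      have heq : c i * |w₀ i| - ρ k i * w₀ i = 0 := by
        have h3 : |w k i| * |w₀ i| = w k i * w₀ i := by rw [← abs_mul, abs_of_pos hpos]
        have h4 : (c i * |w₀ i| - ρ k i * w₀ i) * |w k i| ^ 2 = 0 := by
          rw [sub_mul]
          have e1 : c i * |w₀ i| * |w k i| ^ 2 = c i * |w k i| * (|w k i| * |w₀ i|) := by ring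
          have e2 : ρ k i * w₀ i * |w k i| ^ 2 = (ρ k i * w k i) * (w k i * w₀ i) := by
            rw [sq_abs]; ring
          rw [e1, e2, h2, h3]; ring
        rcases mul_eq_zero.1 h4 with h5 | h5
        · exact h5
        · exact absurd h5 (by positivity)
      rw [heq]; positivity
    · push Not at hlt
      have h1 := mul_le_of_subgradient (a := w k i - w₀ i) hab
      have h3 : c i * |w₀ i| ≤ c i * |w k i| + c i * |w k i - w₀ i| := by
        rw [← mul_add]
        gcongr
        have := abs_sub_abs_le_abs_sub (w₀ i) (w k i)
        rw [abs_sub_comm] at this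
        linarith
      have h4 : c i * |w₀ i| - ρ k i * w₀ i ≤ 2 * (c i * |w k i - w₀ i|) := by nlinarith
      have h5 : c i * |w k i - w₀ i| ≤ 1 * |w k i - w₀ i| := by
        gcongr; exact hc i
      have h6 : g * |w k i - w₀ i| ≤ (w k i - w₀ i) ^ 2 := by
        rw [← sq_abs, pow_two]
        gcongr
        exact hgi.trans hlt
      have h7 : |w k i - w₀ i| ≤ 1 / g * (w k i - w₀ i) ^ 2 := by
        rw [one_div, inv_mul_eq_div, le_div_iff₀ hg]; linarith
      have e : 2 / g * (w k i - w₀ i) ^ 2 = 2 * (1 / g * (w k i - w₀ i) ^ 2) := by ring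
      rw [e]; linarith

end Bregman

end SplitLBI

namespace SplitLBI

/-! ### The split quadratic form on inner product spaces -/

section Form

set_option linter.unusedSectionVars false

open RealInnerProductSpace

variable {V Y G F : Type*}
  [NormedAddCommGroup V] [InnerProductSpace ℝ V] [FiniteDimensional ℝ V]
  [NormedAddCommGroup Y] [InnerProductSpace ℝ Y] [FiniteDimensional ℝ Y]
  [NormedAddCommGroup G] [InnerProductSpace ℝ G] [FiniteDimensional ℝ G]
  [NormedAddCommGroup F] [InnerProductSpace ℝ F] [FiniteDimensional ℝ F]

/-- A functional that kills `ker T` is represented by a vector of `(ker T)ᗮ`, which is the range of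
`T* T`; a preimage may be projected off the kernel at no cost. -/
theorem exists_inner_map_eq {W : Type*} [NormedAddCommGroup W] [InnerProductSpace ℝ W]
    [FiniteDimensional ℝ W] (T : V →ₗ[ℝ] W) (ℓ : V →ₗ[ℝ] ℝ) (hℓ : ∀ v, T v = 0 → ℓ v = 0) :
    ∃ φ ∈ (LinearMap.ker T)ᗮ, ∀ v, ⟪T φ, T v⟫ = ℓ v := by
  set f : V := (InnerProductSpace.toDual ℝ V).symm (LinearMap.toContinuousLinearMap ℓ) with hf
  have hfv : ∀ v, ⟪f, v⟫ = ℓ v := fun v => by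
    rw [hf, InnerProductSpace.toDual_symm_apply]; rfl
  have hmem : f ∈ (LinearMap.ker T)ᗮ := by
    rw [Submodule.mem_orthogonal']
    intro u hu
    rw [hfv]
    exact hℓ u hu
  rw [LinearMap.orthogonal_ker, ← LinearMap.range_adjoint_comp_self] at hmem
  obtain ⟨φ, hφ⟩ := hmem
  refine ⟨φ - (LinearMap.ker T).starProjection φ,
    Submodule.sub_starProjection_mem_orthogonal φ, fun v => ?_⟩
  have h0 : T ((LinearMap.ker T).starProjection φ) = 0 :=
    Submodule.starProjection_apply_mem (LinearMap.ker T) φ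
  rw [map_sub, h0, sub_zero, ← hfv, ← hφ, LinearMap.comp_apply, LinearMap.adjoint_inner_left]

/-- The bilinear form `⟨x u, x v⟩ + ⟨B u, B v⟩ / ν`. -/
noncomputable def splitForm (x : V →ₗ[ℝ] Y) (B : V →ₗ[ℝ] F) (ν : ℝ) (u v : V) : ℝ :=
  ⟪x u, x v⟫ + ν⁻¹ * ⟪B u, B v⟫

/-- Quantitative hypotheses on `x`, on `A` (the active rows) and on `B` (the inactive rows). -/
structure SplitBounds (x : V →ₗ[ℝ] Y) (A : V →ₗ[ℝ] G) (B : V →ₗ[ℝ] F)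
    (ν lamH lamD LamD LamX q : ℝ) : Prop where
  ν_pos : 0 < ν
  lamH_pos : 0 < lamH
  mul_le_one : ν * lamH ≤ 1
  lamD_pos : 0 < lamD
  LamD_pos : 0 < LamD
  LamX_pos : 0 < LamX
  q_nonneg : 0 ≤ q
  coercive : ∀ v ∈ (LinearMap.ker x ⊓ (LinearMap.ker A ⊓ LinearMap.ker B))ᗮ, ∀ γ : G,
    lamH * (‖v‖ ^ 2 + ‖γ‖ ^ 2) ≤ ‖x v‖ ^ 2 + ν⁻¹ * ‖B v‖ ^ 2 + ν⁻¹ * ‖A v - γ‖ ^ 2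
  lower : ∀ v ∈ (LinearMap.ker A ⊓ LinearMap.ker B)ᗮ,
    lamD ^ 2 * ‖v‖ ^ 2 ≤ ‖A v‖ ^ 2 + ‖B v‖ ^ 2
  upper : ∀ v, ‖A v‖ ^ 2 + ‖B v‖ ^ 2 ≤ LamD ^ 2 * ‖v‖ ^ 2
  lower_compl : ∀ v ∈ (LinearMap.ker B)ᗮ, lamD * ‖v‖ ≤ ‖B v‖
  bound_x : ∀ v, ‖x v‖ ≤ LamX * ‖v‖
  lower_ker : ∀ v ∈ (LinearMap.ker x ⊓ (LinearMap.ker A ⊓ LinearMap.ker B))ᗮ,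
    v ∈ LinearMap.ker A ⊓ LinearMap.ker B → ‖v‖ ≤ q * ‖x v‖

namespace SplitBounds

variable {x : V →ₗ[ℝ] Y} {A : V →ₗ[ℝ] G} {B : V →ₗ[ℝ] F} {ν lamH lamD LamD LamX q : ℝ}

/-- Allows working modulo the common kernel, where no data are visible: every vector has a
representative in its orthogonal complement, on which coercivity is available. -/
theorem sub_proj_mem_and_maps (x : V →ₗ[ℝ] Y) (A : V →ₗ[ℝ] G) (B : V →ₗ[ℝ] F) (v : V) :
    ∃ w ∈ (LinearMap.ker x ⊓ (LinearMap.ker A ⊓ LinearMap.ker B))ᗮ,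
      v - w ∈ LinearMap.ker x ⊓ (LinearMap.ker A ⊓ LinearMap.ker B) ∧
      x w = x v ∧ A w = A v ∧ B w = B v := by
  set K := LinearMap.ker x ⊓ (LinearMap.ker A ⊓ LinearMap.ker B) with hK
  have hk : K.starProjection v ∈ K := Submodule.starProjection_apply_mem K v
  refine ⟨v - K.starProjection v, Submodule.sub_starProjection_mem_orthogonal v, by rwa [sub_sub_cancel],
    ?_, ?_, ?_⟩
  · rw [map_sub, LinearMap.mem_ker.1 hk.1, sub_zero]
  · rw [map_sub, LinearMap.mem_ker.1 hk.2.1, sub_zero]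
  · rw [map_sub, LinearMap.mem_ker.1 hk.2.2, sub_zero]

theorem eq_zero_of_form_eq_zero (h : SplitBounds x A B ν lamH lamD LamD LamX q) {v : V}
    (hv : v ∈ (LinearMap.ker x ⊓ (LinearMap.ker A ⊓ LinearMap.ker B))ᗮ) (hx : x v = 0)
    (hB : B v = 0) : v = 0 := by
  have h1 := h.coercive v hv (A v)
  rw [hx, hB] at h1
  simp only [norm_zero, sub_self] at h1
  have h2 := h.lamH_pos
  have h3 : ‖v‖ ^ 2 ≤ 0 := by
    by_contra hcon
    push Not at hcon
    have := mul_pos h2 (show 0 < ‖v‖ ^ 2 + ‖A v‖ ^ 2 by positivity)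
    norm_num at h1
    linarith
  have : ‖v‖ = 0 := by nlinarith [norm_nonneg v]
  exact norm_eq_zero.1 this

/-- Coercivity forces `A v = 0` as well, so the kernel of the split form is the common kernel
although `A` does not occur in the form. -/
theorem mem_ker_of_maps_eq_zero (h : SplitBounds x A B ν lamH lamD LamD LamX q) {v : V}
    (hx : x v = 0) (hB : B v = 0) :
    v ∈ LinearMap.ker x ⊓ (LinearMap.ker A ⊓ LinearMap.ker B) := by
  obtain ⟨w, hw, hvw, h1, h2, h3⟩ := sub_proj_mem_and_maps x A B v
  have : w = 0 := h.eq_zero_of_form_eq_zero hw (h1.trans hx) (h3.trans hB)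
  rwa [this, sub_zero] at hvw

/-- The form is the Gram form of `v ↦ (x v, ν^(-1/2) B v)`, whose kernel is the common kernel, so
the only compatibility condition is vanishing there. -/
theorem exists_solution (h : SplitBounds x A B ν lamH lamD LamD LamX q) (ℓ : V →ₗ[ℝ] ℝ)
    (hℓ : ∀ v ∈ LinearMap.ker x ⊓ (LinearMap.ker A ⊓ LinearMap.ker B), ℓ v = 0) :
    ∃ b ∈ (LinearMap.ker x ⊓ (LinearMap.ker A ⊓ LinearMap.ker B))ᗮ,
      ∀ v, splitForm x B ν b v = ℓ v := by
  let T : V →ₗ[ℝ] WithLp 2 (Y × F) :=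
    (WithLp.linearEquiv 2 ℝ (Y × F)).symm.toLinearMap ∘ₗ (x.prod (Real.sqrt ν⁻¹ • B))
  have hν : 0 < ν⁻¹ := inv_pos.2 h.ν_pos
  have hT : ∀ u v, ⟪T u, T v⟫ = splitForm x B ν u v := by
    intro u v
    rw [WithLp.prod_inner_apply]
    change ⟪x u, x v⟫ + ⟪Real.sqrt ν⁻¹ • B u, Real.sqrt ν⁻¹ • B v⟫ = _
    rw [real_inner_smul_left, real_inner_smul_right, ← mul_assoc, Real.mul_self_sqrt hν.le]
    rfl
  have hker : ∀ v, T v = 0 → x v = 0 ∧ B v = 0 := by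
    intro v hv
    have h1 : ⟪T v, T v⟫ = 0 := by rw [hv, inner_zero_left]
    rw [hT, splitForm, real_inner_self_eq_norm_sq, real_inner_self_eq_norm_sq] at h1
    have h2 : 0 ≤ ν⁻¹ * ‖B v‖ ^ 2 := by positivity
    have h3 : ‖x v‖ ^ 2 = 0 := by nlinarith [sq_nonneg ‖x v‖]
    have h4 : ν⁻¹ * ‖B v‖ ^ 2 = 0 := by linarith
    refine ⟨by simpa using h3, ?_⟩
    rcases mul_eq_zero.1 h4 with h5 | h5
    · exact absurd h5 hν.ne'
    · simpa using h5
  obtain ⟨b, -, hbv⟩ := exists_inner_map_eq T ℓ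
    fun v hv => hℓ v (h.mem_ker_of_maps_eq_zero (hker v hv).1 (hker v hv).2)
  obtain ⟨w, hw, -, h1, -, h3⟩ := sub_proj_mem_and_maps x A B b
  refine ⟨w, hw, fun v => ?_⟩
  rw [← hbv, hT, splitForm, splitForm, h1, h3]

theorem maps_eq_zero_of_forall (h : SplitBounds x A B ν lamH lamD LamD LamX q) {b : V}
    (hb : splitForm x B ν b b = 0) : x b = 0 ∧ B b = 0 := by
  rw [splitForm, real_inner_self_eq_norm_sq, real_inner_self_eq_norm_sq] at hb
  have hν : 0 < ν⁻¹ := inv_pos.2 h.ν_pos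
  have h2 : 0 ≤ ν⁻¹ * ‖B b‖ ^ 2 := by positivity
  have h3 : ‖x b‖ ^ 2 = 0 := by nlinarith [sq_nonneg ‖x b‖]
  have h4 : ν⁻¹ * ‖B b‖ ^ 2 = 0 := by linarith
  refine ⟨by simpa using h3, ?_⟩
  rcases mul_eq_zero.1 h4 with h5 | h5
  · exact absurd h5 hν.ne'
  · simpa using h5

theorem splitForm_sub_left (u u' v : V) :
    splitForm x B ν (u - u') v = splitForm x B ν u v - splitForm x B ν u' v := by
  simp only [splitForm, map_sub, inner_sub_left]; ring

theorem splitForm_add_left (u u' v : V) :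
    splitForm x B ν (u + u') v = splitForm x B ν u v + splitForm x B ν u' v := by
  simp only [splitForm, map_add, inner_add_left]; ring

theorem splitForm_smul_left (c : ℝ) (u v : V) :
    splitForm x B ν (c • u) v = c * splitForm x B ν u v := by
  simp only [splitForm, map_smul, real_inner_smul_left]; ring

/-- The response of the oracle estimator to the noise. -/
theorem exists_noiseMap (h : SplitBounds x A B ν lamH lamD LamD LamX q) :
    ∃ U : Y →ₗ[ℝ] V, ∀ e, U e ∈ (LinearMap.ker x ⊓ (LinearMap.ker A ⊓ LinearMap.ker B))ᗮ ∧
      ∀ v, splitForm x B ν (U e) v = ⟪e, x v⟫ := by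
  have hex : ∀ e : Y, ∃ b ∈ (LinearMap.ker x ⊓ (LinearMap.ker A ⊓ LinearMap.ker B))ᗮ,
      ∀ v, splitForm x B ν b v = ⟪e, x v⟫ := by
    intro e
    obtain ⟨b, hb, hbv⟩ := h.exists_solution ((innerₛₗ ℝ e) ∘ₗ x) (by
      intro v hv
      simp [LinearMap.mem_ker.1 hv.1])
    exact ⟨b, hb, fun v => by rw [hbv]; rfl⟩
  choose U hU hUv using hex
  -- Solutions orthogonal to the common kernel are unique; this is what makes the pointwise choice
  -- linear.
  have huniq : ∀ b b' : V, b ∈ (LinearMap.ker x ⊓ (LinearMap.ker A ⊓ LinearMap.ker B))ᗮ →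
      b' ∈ (LinearMap.ker x ⊓ (LinearMap.ker A ⊓ LinearMap.ker B))ᗮ →
      (∀ v, splitForm x B ν b v = splitForm x B ν b' v) → b = b' := by
    intro b b' hb hb' hv
    have h1 := h.maps_eq_zero_of_forall (b := b - b') (by
      rw [splitForm_sub_left, hv, sub_self])
    exact sub_eq_zero.1 (h.eq_zero_of_form_eq_zero (Submodule.sub_mem _ hb hb') h1.1 h1.2)
  refine ⟨{ toFun := U, map_add' := ?_, map_smul' := ?_ }, fun e => ⟨hU e, hUv e⟩⟩
  · intro e e'
    refine huniq _ _ (hU _) (Submodule.add_mem _ (hU _) (hU _)) fun v => ?_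
    rw [splitForm_add_left, hUv, hUv, hUv, inner_add_left]
  · intro c e
    refine huniq _ _ (hU _) (Submodule.smul_mem _ _ (hU _)) fun v => ?_
    rw [RingHom.id_apply, splitForm_smul_left, hUv, hUv, real_inner_smul_left]

/-- Coercivity in `(v, γ)` yields coercivity in `(A v, B v)` with the same constant and no loss from
`ν`. The point is to test with `(t w, A w)` and optimize `t`, rather than to take `γ = A v`. -/
theorem coercive_sparse (h : SplitBounds x A B ν lamH lamD LamD LamX q) (v : V) :
    lamH * (‖A v‖ ^ 2 + ‖B v‖ ^ 2) ≤ ‖x v‖ ^ 2 + ν⁻¹ * ‖B v‖ ^ 2 := by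
  obtain ⟨w, hw, -, h1, h2, h3⟩ := sub_proj_mem_and_maps x A B v
  rw [← h1, ← h2, ← h3]
  have hν := h.ν_pos
  have hν' : 0 < ν⁻¹ := inv_pos.2 hν
  have hl := h.lamH_pos
  set a := ‖A w‖ ^ 2 with ha
  set b := ‖B w‖ ^ 2 with hb
  set X := ‖x w‖ ^ 2 with hX
  have ha0 : 0 ≤ a := by positivity
  have hb0 : 0 ≤ b := by positivity
  have hX0 : 0 ≤ X := by positivity
  set E := X + ν⁻¹ * b with hE
  have key : ∀ t : ℝ, lamH * a ≤ t ^ 2 * E + ν⁻¹ * ((t - 1) ^ 2 * a) := by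
    intro t
    have h4 := h.coercive (t • w) (Submodule.smul_mem _ _ hw) (A w)
    have h5 : A (t • w) - A w = (t - 1) • A w := by rw [map_smul, sub_smul, one_smul]
    rw [h5, map_smul, map_smul, norm_smul, norm_smul, norm_smul, norm_smul, mul_pow, mul_pow,
      mul_pow, mul_pow, Real.norm_eq_abs, sq_abs, Real.norm_eq_abs, sq_abs, ← ha, ← hb, ← hX] at h4
    have h6 : 0 ≤ lamH * (t ^ 2 * ‖w‖ ^ 2) := by positivity
    rw [hE]
    nlinarith
  have hbE : lamH * b ≤ ν⁻¹ * b := by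
    have : lamH ≤ ν⁻¹ := by
      rw [← one_div, le_div_iff₀ hν]; linarith [h.mul_le_one]
    gcongr
  rcases h.mul_le_one.lt_or_eq with hlt | heq
  -- This `t` gives `λ_H a ≤ (1 - ν λ_H) E`, and `λ_H b ≤ ν λ_H E` holds trivially; the two
  -- coefficients of `E` add up to one.
  · have h4 := key (1 - ν * lamH)
    have h5 : ν⁻¹ * ((1 - ν * lamH - 1) ^ 2 * a) = ν * lamH ^ 2 * a := by field_simp; ring
    rw [h5] at h4
    have h6 : (1 - ν * lamH) * (lamH * a) ≤ (1 - ν * lamH) * ((1 - ν * lamH) * E) := by nlinarith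
    have h7 := le_of_mul_le_mul_left h6 (by linarith)
    have h8 : lamH * b ≤ ν * lamH * E := by
      have : ν * lamH * E = ν * lamH * X + lamH * b := by rw [hE]; field_simp
      rw [this]
      have : 0 ≤ ν * lamH * X := by positivity
      linarith
    nlinarith
  · have hlν : lamH = ν⁻¹ := by rw [← one_div, eq_div_iff hν.ne']; linarith
    have ha' : a = 0 := by
      by_contra hne
      have hapos : 0 < a := lt_of_le_of_ne ha0 (Ne.symm hne)
      have hE0 : 0 ≤ E := by positivity
      set c := ν⁻¹ * a with hc
      have hcpos : 0 < c := by positivity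
      -- In the degenerate case `ν λ_H = 1` the minimizing `t` gives a value strictly below `c`,
      -- which contradicts the bound unless `a = 0`.
      have h4 := key (c / (E + c))
      rw [hlν, ← hc] at h4
      have h5 : ν⁻¹ * ((c / (E + c) - 1) ^ 2 * a) = (c / (E + c) - 1) ^ 2 * c := by
        rw [hc]; ring
      rw [h5] at h4
      have hEc : 0 < E + c := by positivity
      have h6 : (c / (E + c)) ^ 2 * E + (c / (E + c) - 1) ^ 2 * c
          = c - c ^ 2 / (E + c) := by field_simp; ring
      rw [h6] at h4
      have : 0 < c ^ 2 / (E + c) := by positivity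
      linarith
    rw [ha', zero_add]
    linarith

/-- The fitted value on `x (ker D)` is irrelevant for `A u` and `B u`. Subtracting `a ∈ ker D` with
`x a` equal to the projection of the noise makes `x (u - a)` orthogonal to that subspace, so its
energy pairs only with the rest of the noise and with the component of `u` off `ker D`. Hence `q`
does not appear. -/
theorem norm_response (h : SplitBounds x A B ν lamH lamD LamD LamX q) {e : Y} {u : V}
    (hu : ∀ v, splitForm x B ν u v = ⟪e, x v⟫) :
    lamH * (‖A u‖ ^ 2 + ‖B u‖ ^ 2) ≤
      LamX * ‖e‖ * ‖u - (LinearMap.ker A ⊓ LinearMap.ker B).starProjection u‖ := by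
  set K := LinearMap.ker A ⊓ LinearMap.ker B with hK
  set R := K.map x with hR
  have hu0 : K.starProjection u ∈ K := Submodule.starProjection_apply_mem K u
  obtain ⟨a, haK, hae⟩ : ∃ a ∈ K, x a = R.starProjection e :=
    Submodule.mem_map.1 (Submodule.starProjection_apply_mem R e)
  have hAv : A (u - a) = A u := by rw [map_sub, LinearMap.mem_ker.1 haK.1, sub_zero]
  have hBv : B (u - a) = B u := by rw [map_sub, LinearMap.mem_ker.1 haK.2, sub_zero]
  have h1 := h.coercive_sparse (u - a)
  rw [hAv, hBv] at h1
  have hres : ∀ r ∈ R, ⟪e - x u, r⟫ = 0 := by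
    intro r hr
    obtain ⟨k, hk, rfl⟩ := Submodule.mem_map.1 hr
    have := hu k
    rw [splitForm, LinearMap.mem_ker.1 hk.2, inner_zero_right, mul_zero, add_zero] at this
    rw [inner_sub_left, this, sub_self]
  have hproj : ∀ r ∈ R, ⟪e - R.starProjection e, r⟫ = 0 := by
    intro r hr
    exact Submodule.inner_left_of_mem_orthogonal hr (Submodule.sub_starProjection_mem_orthogonal e)
  have hxv : x (u - a) = x u - R.starProjection e := by rw [map_sub, hae]
  have hP : R.starProjection e ∈ R := Submodule.starProjection_apply_mem R e
  have hdiff : ∀ r ∈ R, ⟪x (u - a), r⟫ = 0 := by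
    intro r hr
    have := hres r hr
    have h2 := hproj r hr
    rw [hxv]
    rw [inner_sub_left] at *
    linarith
  have h2 := hu (u - a)
  rw [splitForm, hBv, real_inner_self_eq_norm_sq] at h2
  have h3 : ⟪x u, x (u - a)⟫ = ‖x (u - a)‖ ^ 2 := by
    have : x u = x (u - a) + R.starProjection e := by rw [hxv]; abel
    rw [this, inner_add_left, real_inner_self_eq_norm_sq, real_inner_comm, hdiff _ hP, add_zero]
  rw [h3] at h2
  have h4 : ⟪e, x (u - a)⟫ = ⟪e - R.starProjection e, x (u - K.starProjection u)⟫ := by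
    have e1 : ⟪e - R.starProjection e, x (u - K.starProjection u)⟫
        = ⟪e - R.starProjection e, x u⟫ := by
      rw [map_sub, inner_sub_right, hproj _ (Submodule.mem_map_of_mem hu0), sub_zero]
    have e2 : ⟪R.starProjection e, x (u - a)⟫ = 0 := by rw [real_inner_comm]; exact hdiff _ hP
    have e3 : ⟪e - R.starProjection e, x (u - a)⟫ = ⟪e - R.starProjection e, x u⟫ := by
      rw [hxv, inner_sub_right, hproj _ hP, sub_zero]
    rw [e1, ← e3, inner_sub_left, e2, sub_zero]
  have h5 : ‖e - R.starProjection e‖ ≤ ‖e‖ := by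
    rw [← Submodule.starProjection_orthogonal_val]
    exact Submodule.norm_starProjection_apply_le _ _
  calc lamH * (‖A u‖ ^ 2 + ‖B u‖ ^ 2) ≤ _ := h1
    _ = ⟪e - R.starProjection e, x (u - K.starProjection u)⟫ := by rw [h2, h4]
    _ ≤ ‖e - R.starProjection e‖ * ‖x (u - K.starProjection u)‖ := real_inner_le_norm _ _
    _ ≤ ‖e‖ * (LamX * ‖u - K.starProjection u‖) := by
        gcongr
        exact h.bound_x _
    _ = _ := by ring

theorem lower_sub_proj (h : SplitBounds x A B ν lamH lamD LamD LamX q) (u : V) :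
    lamD ^ 2 * ‖u - (LinearMap.ker A ⊓ LinearMap.ker B).starProjection u‖ ^ 2
      ≤ ‖A u‖ ^ 2 + ‖B u‖ ^ 2 := by
  have hu0 : (LinearMap.ker A ⊓ LinearMap.ker B).starProjection u
    ∈ LinearMap.ker A ⊓ LinearMap.ker B := Submodule.starProjection_apply_mem _ u
  have := h.lower _ (Submodule.sub_starProjection_mem_orthogonal (K :=
    LinearMap.ker A ⊓ LinearMap.ker B) u)
  rwa [map_sub, map_sub, LinearMap.mem_ker.1 hu0.1, LinearMap.mem_ker.1 hu0.2, sub_zero,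
    sub_zero] at this

theorem norm_sub_proj_le (h : SplitBounds x A B ν lamH lamD LamD LamX q) {e : Y} {u : V}
    (hu : ∀ v, splitForm x B ν u v = ⟪e, x v⟫) :
    ‖u - (LinearMap.ker A ⊓ LinearMap.ker B).starProjection u‖
      ≤ LamX / (lamH * lamD ^ 2) * ‖e‖ := by
  have h1 := h.norm_response hu
  have h2 := h.lower_sub_proj u
  set z := ‖u - (LinearMap.ker A ⊓ LinearMap.ker B).starProjection u‖
  have hz : 0 ≤ z := norm_nonneg _
  have hl := h.lamH_pos
  have hd := h.lamD_pos
  have hX := h.LamX_pos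
  rw [div_mul_eq_mul_div, le_div_iff₀ (by positivity)]
  rcases hz.eq_or_lt with h0 | hpos
  · rw [← h0, zero_mul]; positivity
  · have : z * (z * (lamH * lamD ^ 2)) ≤ z * (LamX * ‖e‖) := by nlinarith
    exact le_of_mul_le_mul_left this hpos

theorem norm_maps_le (h : SplitBounds x A B ν lamH lamD LamD LamX q) {e : Y} {u : V}
    (hu : ∀ v, splitForm x B ν u v = ⟪e, x v⟫) :
    ‖A u‖ ≤ LamX / (lamH * lamD) * ‖e‖ := by
  have h1 := h.norm_response hu
  have h2 := h.norm_sub_proj_le hu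
  have hl := h.lamH_pos
  have hd := h.lamD_pos
  have hX := h.LamX_pos
  have h3 : lamH * ‖A u‖ ^ 2 ≤ LamX * ‖e‖ * (LamX / (lamH * lamD ^ 2) * ‖e‖) := by
    calc lamH * ‖A u‖ ^ 2 ≤ lamH * (‖A u‖ ^ 2 + ‖B u‖ ^ 2) := by
          have : 0 ≤ ‖B u‖ ^ 2 := by positivity
          gcongr; linarith
      _ ≤ _ := h1
      _ ≤ _ := by gcongr
  have h4 : ‖A u‖ ^ 2 ≤ (LamX / (lamH * lamD) * ‖e‖) ^ 2 := by
    have : lamH * (LamX / (lamH * lamD) * ‖e‖) ^ 2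
        = LamX * ‖e‖ * (LamX / (lamH * lamD ^ 2) * ‖e‖) := by field_simp
    rw [← this] at h3
    exact le_of_mul_le_mul_left h3 hl
  exact le_of_sq_le_sq h4 (by positivity)

/-- Inner products of the fitted kernel component with directions in `x (ker D)`. -/
theorem inner_proj_eq {e : Y} {u : V} (hu : ∀ v, splitForm x B ν u v = ⟪e, x v⟫) {r : Y}
    (hr : r ∈ (LinearMap.ker A ⊓ LinearMap.ker B).map x) :
    ⟪r, x ((LinearMap.ker A ⊓ LinearMap.ker B).starProjection u)⟫
      = ⟪r, e - x (u - (LinearMap.ker A ⊓ LinearMap.ker B).starProjection u)⟫ := by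
  obtain ⟨k, hk, rfl⟩ := Submodule.mem_map.1 hr
  have := hu k
  rw [splitForm, LinearMap.mem_ker.1 hk.2, inner_zero_right, mul_zero, add_zero] at this
  rw [inner_sub_right, map_sub, inner_sub_right, real_inner_comm e, ← this, real_inner_comm (x u)]
  ring

theorem proj_mem (u : V) (hu : u ∈ (LinearMap.ker x ⊓ (LinearMap.ker A ⊓ LinearMap.ker B))ᗮ) :
    (LinearMap.ker A ⊓ LinearMap.ker B).starProjection u
      ∈ (LinearMap.ker x ⊓ (LinearMap.ker A ⊓ LinearMap.ker B))ᗮ := by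
  have h1 : u - (LinearMap.ker A ⊓ LinearMap.ker B).starProjection u
      ∈ (LinearMap.ker x ⊓ (LinearMap.ker A ⊓ LinearMap.ker B))ᗮ :=
    Submodule.orthogonal_le inf_le_right (Submodule.sub_starProjection_mem_orthogonal u)
  have := Submodule.sub_mem _ hu h1
  rwa [sub_sub_cancel] at this

/-- Testing against the kernel component itself bounds its image under `x` by the norm of the noise
minus the fit of the other component; `q` converts this into a bound on the component. -/
theorem norm_proj_le (h : SplitBounds x A B ν lamH lamD LamD LamX q) {e : Y} {u : V}
    (hu : ∀ v, splitForm x B ν u v = ⟪e, x v⟫)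
    (huL : u ∈ (LinearMap.ker x ⊓ (LinearMap.ker A ⊓ LinearMap.ker B))ᗮ) :
    ‖(LinearMap.ker A ⊓ LinearMap.ker B).starProjection u‖
      ≤ q * ((1 + LamX ^ 2 / (lamH * lamD ^ 2)) * ‖e‖) := by
  have hmem : (LinearMap.ker A ⊓ LinearMap.ker B).starProjection u
    ∈ LinearMap.ker A ⊓ LinearMap.ker B := Submodule.starProjection_apply_mem _ u
  have h1 := h.lower_ker _ (proj_mem u huL) hmem
  have h2 := inner_proj_eq hu (Submodule.mem_map_of_mem (f := x) hmem)
  have h3 := h.norm_sub_proj_le hu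
  set u0 := (LinearMap.ker A ⊓ LinearMap.ker B).starProjection u
  have hl := h.lamH_pos
  have hd := h.lamD_pos
  have hX := h.LamX_pos
  refine h1.trans (mul_le_mul_of_nonneg_left ?_ h.q_nonneg)
  rw [real_inner_self_eq_norm_sq] at h2
  have h4 : ‖x u0‖ ^ 2 ≤ ‖x u0‖ * ‖e - x (u - u0)‖ := by
    rw [h2]; exact real_inner_le_norm _ _
  have h5 : ‖x u0‖ ≤ ‖e - x (u - u0)‖ := by
    rcases (norm_nonneg (x u0)).eq_or_lt with h0 | hpos
    · rw [← h0]; positivity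
    · rw [pow_two] at h4; exact le_of_mul_le_mul_left h4 hpos
  calc ‖x u0‖ ≤ ‖e - x (u - u0)‖ := h5
    _ ≤ ‖e‖ + ‖x (u - u0)‖ := norm_sub_le _ _
    _ ≤ ‖e‖ + LamX * (LamX / (lamH * lamD ^ 2) * ‖e‖) := by
        gcongr
        exact (h.bound_x _).trans (by gcongr)
    _ = _ := by ring

/-- The coordinates of the fitted kernel component in an orthonormal basis of `x (ker D)` are
explicit linear functionals of the noise, so scalar tail bounds lose only the root of the dimension.
-/
theorem norm_proj_le_of_coord (h : SplitBounds x A B ν lamH lamD LamD LamX q) {e : Y} {u : V}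
    (hu : ∀ v, splitForm x B ν u v = ⟪e, x v⟫)
    (huL : u ∈ (LinearMap.ker x ⊓ (LinearMap.ker A ⊓ LinearMap.ker B))ᗮ)
    {ι : Type*} [Fintype ι]
    (b : OrthonormalBasis ι ℝ ((LinearMap.ker A ⊓ LinearMap.ker B).map x)) {t : ℝ} (ht : 0 ≤ t)
    (hb : ∀ i, |⟪(b i : Y),
      e - x (u - (LinearMap.ker A ⊓ LinearMap.ker B).starProjection u)⟫| ≤ t) :
    ‖(LinearMap.ker A ⊓ LinearMap.ker B).starProjection u‖
      ≤ q * (Real.sqrt (Fintype.card ι) * t) := by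
  have hmem : (LinearMap.ker A ⊓ LinearMap.ker B).starProjection u
    ∈ LinearMap.ker A ⊓ LinearMap.ker B := Submodule.starProjection_apply_mem _ u
  have h1 := h.lower_ker _ (proj_mem u huL) hmem
  have hxm := Submodule.mem_map_of_mem (f := x) hmem
  have h2 := fun i => inner_proj_eq hu (b i).2
  set u0 := (LinearMap.ker A ⊓ LinearMap.ker B).starProjection u
  refine h1.trans (mul_le_mul_of_nonneg_left ?_ h.q_nonneg)
  have h3 := b.sum_sq_norm_inner_right ⟨x u0, hxm⟩
  have h4 : ‖x u0‖ ^ 2 ≤ (Real.sqrt (Fintype.card ι) * t) ^ 2 := by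
    have e1 : ‖x u0‖ ^ 2 = ‖(⟨x u0, hxm⟩ : (LinearMap.ker A ⊓ LinearMap.ker B).map x)‖ ^ 2 := rfl
    rw [e1, ← h3, mul_pow, Real.sq_sqrt (by positivity)]
    calc _ ≤ ∑ _i : ι, t ^ 2 := by
          refine Finset.sum_le_sum fun i _ => ?_
          have e2 : inner ℝ (b i) ⟨x u0, hxm⟩ = ⟪(b i : Y), x u0⟫ := rfl
          rw [e2, h2 i, Real.norm_eq_abs]
          exact pow_le_pow_left₀ (abs_nonneg _) (hb i) 2
      _ = _ := by simp
  exact le_of_sq_le_sq h4 (by positivity)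

/-- Test with the part of `u` orthogonal to `ker B`. The residual `e - x u` is no longer than `e`,
so neither `λ_H` nor `ν` enters the bound. -/
theorem norm_compl_le (h : SplitBounds x A B ν lamH lamD LamD LamX q) {e : Y} {u : V}
    (hu : ∀ v, splitForm x B ν u v = ⟪e, x v⟫) :
    ν⁻¹ * ‖B u‖ ≤ LamX / lamD * ‖e‖ := by
  have hν : 0 < ν⁻¹ := inv_pos.2 h.ν_pos
  have hd := h.lamD_pos
  have hX := h.LamX_pos
  have hpm : (LinearMap.ker B).starProjection u ∈ LinearMap.ker B :=
    Submodule.starProjection_apply_mem _ u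
  set φ := u - (LinearMap.ker B).starProjection u with hφ
  have hBφ : B φ = B u := by rw [hφ, map_sub, LinearMap.mem_ker.1 hpm, sub_zero]
  have h1 := h.lower_compl φ (Submodule.sub_starProjection_mem_orthogonal u)
  rw [hBφ] at h1
  have h2 := hu φ
  rw [splitForm, hBφ, real_inner_self_eq_norm_sq] at h2
  have h3 : ν⁻¹ * ‖B u‖ ^ 2 ≤ ‖e - x u‖ * (LamX * ‖φ‖) := by
    calc ν⁻¹ * ‖B u‖ ^ 2 = ⟪e - x u, x φ⟫ := by rw [inner_sub_left]; linarith
      _ ≤ ‖e - x u‖ * ‖x φ‖ := real_inner_le_norm _ _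
      _ ≤ _ := by gcongr; exact h.bound_x _
  have h4 : ‖e - x u‖ ≤ ‖e‖ := by
    have h5 := hu u
    rw [splitForm, real_inner_self_eq_norm_sq, real_inner_self_eq_norm_sq] at h5
    have h6 : ‖e - x u‖ ^ 2 ≤ ‖e‖ ^ 2 := by
      rw [norm_sub_sq_real]
      have : 0 ≤ ν⁻¹ * ‖B u‖ ^ 2 := by positivity
      nlinarith [sq_nonneg ‖x u‖]
    exact le_of_sq_le_sq h6 (norm_nonneg _)
  rcases (norm_nonneg (B u)).eq_or_lt with h0 | hpos
  · rw [← h0, mul_zero]; positivity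
  · have h7 : ‖B u‖ * (ν⁻¹ * ‖B u‖) ≤ ‖B u‖ * (LamX / lamD * ‖e‖) := by
      calc ‖B u‖ * (ν⁻¹ * ‖B u‖) = ν⁻¹ * ‖B u‖ ^ 2 := by ring
        _ ≤ ‖e - x u‖ * (LamX * ‖φ‖) := h3
        _ ≤ ‖e‖ * (LamX * (‖B u‖ / lamD)) := by
            gcongr
            rw [le_div_iff₀ hd]; linarith
        _ = _ := by ring
    exact le_of_mul_le_mul_left h7 hpos

/-- The component in `ker D` is fixed by the projection onto `ker B` and killed by `A`, so only the
remainder counts. -/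
theorem norm_map_proj_le (h : SplitBounds x A B ν lamH lamD LamD LamX q) (w : V) :
    ‖A ((LinearMap.ker B).starProjection w)‖ ≤
      LamD * ‖w - (LinearMap.ker A ⊓ LinearMap.ker B).starProjection w‖ := by
  have hmem : (LinearMap.ker A ⊓ LinearMap.ker B).starProjection w
    ∈ LinearMap.ker A ⊓ LinearMap.ker B := Submodule.starProjection_apply_mem _ w
  set w0 := (LinearMap.ker A ⊓ LinearMap.ker B).starProjection w
  have h1 : (LinearMap.ker B).starProjection w0 = w0 :=
    Submodule.starProjection_eq_self_iff.2 hmem.2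
  have h2 : A ((LinearMap.ker B).starProjection w)
      = A ((LinearMap.ker B).starProjection (w - w0)) := by
    rw [map_sub, map_sub, h1, LinearMap.mem_ker.1 hmem.1, sub_zero]
  rw [h2]
  have hD := h.LamD_pos
  have h3 := h.upper ((LinearMap.ker B).starProjection (w - w0))
  have h4 : ‖A ((LinearMap.ker B).starProjection (w - w0))‖ ^ 2
      ≤ (LamD * ‖(LinearMap.ker B).starProjection (w - w0)‖) ^ 2 := by
    rw [mul_pow]
    have := sq_nonneg ‖B ((LinearMap.ker B).starProjection (w - w0))‖
    linarith
  refine (le_of_sq_le_sq h4 (by positivity)).trans ?_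
  gcongr
  exact Submodule.norm_starProjection_apply_le _ _

/-- Here `N` will be the kernel belonging to the random support. The right side depends only on `S`,
so the noise need not be controlled for every possible support. Off `ker D` the projection factors
through `ker B`, and there the lower bound for `D` is a bound by `A` alone. -/
theorem norm_nested_proj_le (h : SplitBounds x A B ν lamH lamD LamD LamX q) (u : V)
    {N : Submodule ℝ V} (hN : N ≤ LinearMap.ker B)
    (hDN : LinearMap.ker A ⊓ LinearMap.ker B ≤ N) :
    ‖N.starProjection u‖ ≤ ‖(LinearMap.ker A ⊓ LinearMap.ker B).starProjection u‖
      + ‖A ((LinearMap.ker B).starProjection u)‖ / lamD := by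
  have hmem : (LinearMap.ker A ⊓ LinearMap.ker B).starProjection u
    ∈ LinearMap.ker A ⊓ LinearMap.ker B := Submodule.starProjection_apply_mem _ u
  have horth := Submodule.sub_starProjection_mem_orthogonal
    (K := LinearMap.ker A ⊓ LinearMap.ker B) u
  set u0 := (LinearMap.ker A ⊓ LinearMap.ker B).starProjection u
  have h1 : N.starProjection u0 = u0 := Submodule.starProjection_eq_self_iff.2 (hDN hmem)
  have h1' : (LinearMap.ker B).starProjection u0 = u0 :=
    Submodule.starProjection_eq_self_iff.2 hmem.2
  have h2 : N.starProjection u = u0 + N.starProjection (u - u0) := by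
    rw [map_sub, h1]; abel
  have h3 : N.starProjection (u - u0)
      = N.starProjection ((LinearMap.ker B).starProjection (u - u0)) := by
    have := Submodule.starProjection_comp_starProjection_of_le hN
    exact (congrArg (fun f => f (u - u0)) this).symm
  have hd := h.lamD_pos
  set w := (LinearMap.ker B).starProjection (u - u0) with hw
  have hwB : w ∈ LinearMap.ker B := Submodule.starProjection_apply_mem _ _
  have hworth : w ∈ (LinearMap.ker A ⊓ LinearMap.ker B)ᗮ := by
    rw [Submodule.mem_orthogonal]
    intro k hk
    rw [hw, ← Submodule.inner_starProjection_left_eq_right,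
      Submodule.starProjection_eq_self_iff.2 hk.2]
    exact Submodule.inner_right_of_mem_orthogonal hk horth
  have h4 := h.lower w hworth
  rw [LinearMap.mem_ker.1 hwB, norm_zero] at h4
  have h5 : (lamD * ‖w‖) ^ 2 ≤ ‖A w‖ ^ 2 := by rw [mul_pow]; linarith
  have h6 := le_of_sq_le_sq h5 (norm_nonneg _)
  have h7 : A ((LinearMap.ker B).starProjection u) = A w := by
    rw [hw, map_sub, map_sub, h1', LinearMap.mem_ker.1 hmem.1, sub_zero]
  rw [h7, h2, h3]
  refine (norm_add_le _ _).trans ?_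
  gcongr
  refine (Submodule.norm_starProjection_apply_le _ _).trans ?_
  rw [le_div_iff₀ hd]; linarith

end SplitBounds

end Form

end SplitLBI

namespace SplitLBI

/-! ### Consequences of the irrepresentable condition for the inactive rows. -/

section Irrepresentable

set_option linter.unusedSectionVars false

open RealInnerProductSpace

variable {V Y ι ι' : Type*} [Fintype ι] [Fintype ι']
  [NormedAddCommGroup V] [InnerProductSpace ℝ V] [FiniteDimensional ℝ V]
  [NormedAddCommGroup Y] [InnerProductSpace ℝ Y] [FiniteDimensional ℝ Y]
  {x : V →ₗ[ℝ] Y} {A : V →ₗ[ℝ] EuclideanSpace ℝ ι} {B : V →ₗ[ℝ] EuclideanSpace ℝ ι'}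
  {ν lamH lamD LamD LamX q η : ℝ}

/-- The irrepresentable condition in terms of weak solutions. -/
def WeakIRR (x : V →ₗ[ℝ] Y) (A : V →ₗ[ℝ] EuclideanSpace ℝ ι) (B : V →ₗ[ℝ] EuclideanSpace ℝ ι')
    (ν η : ℝ) : Prop :=
  ∀ (ρ : EuclideanSpace ℝ ι) (b : V), (∀ j, |ρ j| ≤ 1) →
    (∀ v, splitForm x B ν b v = ⟪ρ, A v⟫) → ∀ j, |ν⁻¹ * (B b) j| ≤ 1 - η

namespace SplitBounds

theorem irr_scaled (h : SplitBounds x A B ν lamH lamD LamD LamX q) (hirr : WeakIRR x A B ν η)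
    {r : ℝ} (hr : 0 ≤ r) (ρ : EuclideanSpace ℝ ι) (b : V) (hρ : ∀ j, |ρ j| ≤ r)
    (hb : ∀ v, splitForm x B ν b v = ⟪ρ, A v⟫) (j : ι') :
    |ν⁻¹ * (B b) j| ≤ (1 - η) * r := by
  rcases hr.eq_or_lt with h0 | hpos
  · have hρ0 : ρ = 0 := by
      ext j
      exact abs_eq_zero.1 (le_antisymm ((hρ j).trans_eq h0.symm) (abs_nonneg _))
    have := (h.maps_eq_zero_of_forall (b := b) (by rw [hb, hρ0, inner_zero_left])).2
    rw [this, ← h0]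
    simp
  · have h1 := hirr (r⁻¹ • ρ) (r⁻¹ • b) (by
      intro j
      rw [PiLp.smul_apply, smul_eq_mul, abs_mul, abs_of_pos (inv_pos.2 hpos), inv_mul_le_iff₀ hpos,
        mul_one]
      exact hρ j) (by
      intro v
      rw [splitForm_smul_left, hb, real_inner_smul_left]) j
    rw [map_smul, PiLp.smul_apply, smul_eq_mul, mul_left_comm, abs_mul,
      abs_of_pos (inv_pos.2 hpos), inv_mul_le_iff₀ hpos] at h1
    linarith

/-- A general source `f` need not be of the form `A* ρ + B* ρ'`: it may act on `ker D`. The vector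
`w` reproduces exactly that action through `x`, and since `B w = 0` it leaves the inactive dual
variable unchanged. -/
theorem exists_ker_part (h : SplitBounds x A B ν lamH lamD LamD LamX q) {f : V}
    (hf : f ∈ (LinearMap.ker x ⊓ (LinearMap.ker A ⊓ LinearMap.ker B))ᗮ) :
    ∃ w : V, B w = 0 ∧ (∀ k ∈ LinearMap.ker A ⊓ LinearMap.ker B, ⟪x w, x k⟫ = ⟪f, k⟫) ∧
      ‖x w‖ ≤ q * ‖f‖ := by
  obtain ⟨a, -, ha⟩ := exists_inner_map_eq
    (x ∘ₗ (LinearMap.ker A ⊓ LinearMap.ker B).subtype)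
    ((innerₛₗ ℝ f) ∘ₗ (LinearMap.ker A ⊓ LinearMap.ker B).subtype) (by
      intro k hk
      exact Submodule.inner_left_of_mem_orthogonal (K := LinearMap.ker x ⊓
        (LinearMap.ker A ⊓ LinearMap.ker B)) ⟨hk, k.2⟩ hf)
  obtain ⟨w, hw, -, h1, h2, h3⟩ := sub_proj_mem_and_maps x A B (a : V)
  have hwA : A w = 0 := h2.trans a.2.1
  have hwB : B w = 0 := h3.trans a.2.2
  have hk : ∀ k ∈ LinearMap.ker A ⊓ LinearMap.ker B, ⟪x w, x k⟫ = ⟪f, k⟫ := by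
    intro k hk
    rw [h1]
    exact ha ⟨k, hk⟩
  refine ⟨w, hwB, hk, ?_⟩
  have h4 := h.lower_ker w hw ⟨hwA, hwB⟩
  have h5 := hk w ⟨hwA, hwB⟩
  rw [real_inner_self_eq_norm_sq] at h5
  have h6 : ‖x w‖ ^ 2 ≤ ‖f‖ * (q * ‖x w‖) := by
    rw [h5]
    exact (real_inner_le_norm _ _).trans (by gcongr)
  rcases (norm_nonneg (x w)).eq_or_lt with h0 | hpos
  · rw [← h0]; exact mul_nonneg h.q_nonneg (norm_nonneg _)
  · have : ‖x w‖ * ‖x w‖ ≤ ‖x w‖ * (q * ‖f‖) := by nlinarith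
    exact le_of_mul_le_mul_left this hpos

/-- After removal of the kernel part the source equals `A* A φ + B* B φ`. The first summand is
handled by the irrepresentable condition, the second by its own energy estimate. Each contributes at
most `(1 + LamX * q) / lamD * ‖f‖`, hence the factor two and the absence of `ν` and `λ_H`. -/
theorem abs_compl_le (h : SplitBounds x A B ν lamH lamD LamD LamX q) (hirr : WeakIRR x A B ν η)
    (hη : 0 ≤ η) {f b : V} (hf : f ∈ (LinearMap.ker x ⊓ (LinearMap.ker A ⊓ LinearMap.ker B))ᗮ)
    (hb : ∀ v, splitForm x B ν b v = ⟪f, v⟫) (j : ι') :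
    |ν⁻¹ * (B b) j| ≤ 2 * ((1 + LamX * q) / lamD * ‖f‖) := by
  have hν : 0 < ν⁻¹ := inv_pos.2 h.ν_pos
  have hd := h.lamD_pos
  have hX := h.LamX_pos
  have hq := h.q_nonneg
  obtain ⟨w, hwB, hwk, hwn⟩ := h.exists_ker_part hf
  let T : V →ₗ[ℝ] WithLp 2 (EuclideanSpace ℝ ι × EuclideanSpace ℝ ι') :=
    (WithLp.linearEquiv 2 ℝ (EuclideanSpace ℝ ι × EuclideanSpace ℝ ι')).symm.toLinearMap ∘ₗ
      (A.prod B)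
  have hT : ∀ u v, ⟪T u, T v⟫ = ⟪A u, A v⟫ + ⟪B u, B v⟫ := by
    intro u v
    rw [WithLp.prod_inner_apply]
    rfl
  have hker : LinearMap.ker T = LinearMap.ker A ⊓ LinearMap.ker B := by
    ext v
    constructor
    · intro hv
      have h1 : ⟪T v, T v⟫ = 0 := by rw [LinearMap.mem_ker.1 hv, inner_zero_left]
      rw [hT, real_inner_self_eq_norm_sq, real_inner_self_eq_norm_sq] at h1
      have h2 : ‖A v‖ ^ 2 = 0 := by nlinarith [sq_nonneg ‖A v‖, sq_nonneg ‖B v‖]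
      have h3 : ‖B v‖ ^ 2 = 0 := by nlinarith [sq_nonneg ‖A v‖, sq_nonneg ‖B v‖]
      exact ⟨by simpa using h2, by simpa using h3⟩
    · intro hv
      have h1 : ⟪T v, T v⟫ = 0 := by
        rw [hT, LinearMap.mem_ker.1 hv.1, LinearMap.mem_ker.1 hv.2]; simp
      exact inner_self_eq_zero.1 h1
  obtain ⟨φ, hφm, hφ⟩ := exists_inner_map_eq T (innerₛₗ ℝ f - (innerₛₗ ℝ (x w)) ∘ₗ x) (by
    intro v hv
    have hv' : v ∈ LinearMap.ker A ⊓ LinearMap.ker B := by rw [← hker]; exact hv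
    have := hwk v hv'
    simp only [LinearMap.sub_apply, LinearMap.comp_apply, innerₛₗ_apply_apply]
    linarith)
  rw [hker] at hφm
  have hφ' : ∀ v, ⟪A φ, A v⟫ + ⟪B φ, B v⟫ = ⟪f, v⟫ - ⟪x w, x v⟫ := by
    intro v
    rw [← hT, hφ]
    simp [innerₛₗ_apply_apply]
  set M := (1 + LamX * q) * ‖f‖ with hM
  have hM0 : 0 ≤ M := by positivity
  have hℓ : ⟪f, φ⟫ - ⟪x w, x φ⟫ ≤ M * ‖φ‖ := by
    have h1 := real_inner_le_norm f φ
    have h2 : -⟪x w, x φ⟫ ≤ (q * ‖f‖) * (LamX * ‖φ‖) := by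
      refine (neg_le_abs _).trans ((abs_real_inner_le_norm _ _).trans ?_)
      gcongr
      exact h.bound_x φ
    rw [hM]
    nlinarith
  have hφφ := hφ' φ
  rw [real_inner_self_eq_norm_sq, real_inner_self_eq_norm_sq] at hφφ
  have hlow := h.lower φ hφm
  set d2 := ‖A φ‖ ^ 2 + ‖B φ‖ ^ 2 with hd2
  have hd2M : d2 ≤ (M / lamD) ^ 2 := by
    have h1 : (lamD * ‖φ‖) ≤ Real.sqrt d2 := Real.le_sqrt_of_sq_le (by rw [mul_pow]; exact hlow)
    have h2 : d2 ≤ M / lamD * Real.sqrt d2 := by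
      calc d2 ≤ M * ‖φ‖ := by linarith
        _ = M / lamD * (lamD * ‖φ‖) := by field_simp
        _ ≤ _ := by gcongr
    have h3 : Real.sqrt d2 ^ 2 = d2 := Real.sq_sqrt (by positivity)
    have h4 : Real.sqrt d2 ≤ M / lamD := by
      rcases (Real.sqrt_nonneg d2).eq_or_lt with h0 | hpos
      · rw [← h0]; positivity
      · have : Real.sqrt d2 * Real.sqrt d2 ≤ M / lamD * Real.sqrt d2 := by nlinarith
        exact le_of_mul_le_mul_right this hpos
    rw [← h3]
    exact pow_le_pow_left₀ (Real.sqrt_nonneg _) h4 2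
  have hA : ‖A φ‖ ≤ M / lamD :=
    le_of_sq_le_sq (by nlinarith [sq_nonneg ‖B φ‖]) (by positivity)
  have hBn : ‖B φ‖ ≤ M / lamD :=
    le_of_sq_le_sq (by nlinarith [sq_nonneg ‖A φ‖]) (by positivity)
  obtain ⟨b₁, -, hb₁⟩ := h.exists_solution ((innerₛₗ ℝ (A φ)) ∘ₗ A) (by
    intro v hv
    simp [LinearMap.mem_ker.1 hv.2.1])
  obtain ⟨b₂, -, hb₂⟩ := h.exists_solution ((innerₛₗ ℝ (B φ)) ∘ₗ B) (by
    intro v hv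
    simp [LinearMap.mem_ker.1 hv.2.2])
  have hb₁' : ∀ v, splitForm x B ν b₁ v = ⟪A φ, A v⟫ := fun v => hb₁ v
  have hb₂' : ∀ v, splitForm x B ν b₂ v = ⟪B φ, B v⟫ := fun v => hb₂ v
  have hBb : B b = B b₁ + B b₂ := by
    have h0 : ∀ v, splitForm x B ν (b - w - b₁ - b₂) v = 0 := by
      intro v
      have hw : splitForm x B ν w v = ⟪x w, x v⟫ := by
        rw [splitForm, hwB, inner_zero_left, mul_zero, add_zero]
      rw [splitForm_sub_left, splitForm_sub_left, splitForm_sub_left, hb, hb₁', hb₂', hw]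
      linarith [hφ' v]
    have h1 := (h.maps_eq_zero_of_forall (h0 _)).2
    rw [map_sub, map_sub, map_sub, hwB, sub_zero, sub_sub, sub_eq_zero] at h1
    exact h1
  have h1 : |ν⁻¹ * (B b₁) j| ≤ M / lamD := by
    have := h.irr_scaled hirr (norm_nonneg (A φ)) (A φ) b₁
      (fun j => by simpa using PiLp.norm_apply_le (A φ) j) hb₁' j
    have h3 : (1 - η) * ‖A φ‖ ≤ 1 * ‖A φ‖ := by gcongr; linarith
    linarith
  have h2 : |ν⁻¹ * (B b₂) j| ≤ M / lamD := by
    have h3 := hb₂' b₂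
    rw [splitForm, real_inner_self_eq_norm_sq, real_inner_self_eq_norm_sq] at h3
    have h4 : ν⁻¹ * ‖B b₂‖ ^ 2 ≤ ‖B φ‖ * ‖B b₂‖ := by
      have := real_inner_le_norm (B φ) (B b₂)
      nlinarith [sq_nonneg ‖x b₂‖]
    have h5 : ν⁻¹ * ‖B b₂‖ ≤ ‖B φ‖ := by
      rcases (norm_nonneg (B b₂)).eq_or_lt with h0 | hpos
      · rw [← h0, mul_zero]; positivity
      · have : ν⁻¹ * ‖B b₂‖ * ‖B b₂‖ ≤ ‖B φ‖ * ‖B b₂‖ := by nlinarith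
        exact le_of_mul_le_mul_right this hpos
    rw [abs_mul, abs_of_pos hν]
    calc ν⁻¹ * |(B b₂) j| ≤ ν⁻¹ * ‖B b₂‖ := by
          gcongr
          simpa using PiLp.norm_apply_le (B b₂) j
      _ ≤ ‖B φ‖ := h5
      _ ≤ _ := hBn
  rw [hBb, PiLp.add_apply, mul_add]
  have e : (1 + LamX * q) / lamD * ‖f‖ = M / lamD := by rw [hM]; ring
  rw [e]
  exact (abs_add_le _ _).trans (by linarith)

/-- The dual variable of an inactive row, split into its noise, initialization and subgradient
contributions. -/
theorem abs_dual_le (h : SplitBounds x A B ν lamH lamD LamD LamX q) (hirr : WeakIRR x A B ν η)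
    (hη : 0 ≤ η) {t r : ℝ} (ht : 0 ≤ t) (hr : 0 ≤ r) {βs u b f : V} {e : Y}
    {z : EuclideanSpace ℝ ι} (hβs : B βs = 0) (hu : ∀ v, splitForm x B ν u v = ⟪e, x v⟫)
    (hf : f ∈ (LinearMap.ker x ⊓ (LinearMap.ker A ⊓ LinearMap.ker B))ᗮ) (hz : ∀ j, |z j| ≤ r)
    (hb : ∀ v, splitForm x B ν b v = t * ⟪x βs + e, x v⟫ - ⟪f, v⟫ - ⟪z, A v⟫) (j : ι') :
    |ν⁻¹ * (B b) j| ≤ t * |ν⁻¹ * (B u) j| + 2 * ((1 + LamX * q) / lamD * ‖f‖) + (1 - η) * r := by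
  obtain ⟨b₁, -, hb₁⟩ := h.exists_solution (innerₛₗ ℝ f) (by
    intro v hv
    exact Submodule.inner_left_of_mem_orthogonal hv hf)
  obtain ⟨b₂, -, hb₂⟩ := h.exists_solution ((innerₛₗ ℝ z) ∘ₗ A) (by
    intro v hv
    simp [LinearMap.mem_ker.1 hv.2.1])
  have hb₁' : ∀ v, splitForm x B ν b₁ v = ⟪f, v⟫ := fun v => hb₁ v
  have hb₂' : ∀ v, splitForm x B ν b₂ v = ⟪z, A v⟫ := fun v => hb₂ v
  have hBb : B b = t • B u - B b₁ - B b₂ := by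
    -- The target `βs` solves the problem with source `x βs` because `B βs = 0`; so by linearity
    -- only the noise, the source `f` and `z` reach `B b`.
    have h0 : ∀ v, splitForm x B ν (b - t • βs - t • u + b₁ + b₂) v = 0 := by
      intro v
      have hw : splitForm x B ν βs v = ⟪x βs, x v⟫ := by
        rw [splitForm, hβs, inner_zero_left, mul_zero, add_zero]
      rw [splitForm_add_left, splitForm_add_left, splitForm_sub_left, splitForm_sub_left,
        splitForm_smul_left, splitForm_smul_left, hb, hb₁', hb₂', hw, hu, inner_add_left]
      ring
    have h1 := (h.maps_eq_zero_of_forall (h0 _)).2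
    simp only [map_add, map_sub, map_smul, hβs, smul_zero, sub_zero] at h1
    rw [eq_sub_iff_add_eq, eq_sub_iff_add_eq, ← sub_eq_zero, ← h1]
    abel
  have h1 := h.abs_compl_le hirr hη hf hb₁' j
  have h2 := h.irr_scaled hirr hr z b₂ hz hb₂' j
  rw [hBb]
  simp only [PiLp.sub_apply, PiLp.smul_apply, smul_eq_mul]
  have e1 : ν⁻¹ * (t * (B u) j - (B b₁) j - (B b₂) j)
      = t * (ν⁻¹ * (B u) j) - ν⁻¹ * (B b₁) j - ν⁻¹ * (B b₂) j := by ring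
  rw [e1]
  have h3 := abs_sub (t * (ν⁻¹ * (B u) j) - ν⁻¹ * (B b₁) j) (ν⁻¹ * (B b₂) j)
  have h4 := abs_sub (t * (ν⁻¹ * (B u) j)) (ν⁻¹ * (B b₁) j)
  have h5 : |t * (ν⁻¹ * (B u) j)| = t * |ν⁻¹ * (B u) j| := by rw [abs_mul, abs_of_nonneg ht]
  linarith

end SplitBounds

end Irrepresentable

end SplitLBI

namespace SplitLBI

/-! ### Sub-Gaussian tail bounds -/

section Tails

open scoped ENNReal NNReal

variable {Ω : Type*} [MeasurableSpace Ω] {μ : Measure Ω}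

theorem HasSubgaussianMGF.mono {X : Ω → ℝ} {c d : ℝ≥0} (h : HasSubgaussianMGF X c μ) (hcd : c ≤ d) :
    HasSubgaussianMGF X d μ :=
  ⟨h.integrable_exp_mul, fun t => (h.mgf_le t).trans (by gcongr)⟩

/-- Evaluating the functional at its own representing vector bounds the norm of that vector by `c`,
so the weighted sum is sub-Gaussian with parameter `(σ c)²`. -/
theorem tail_linear [IsProbabilityMeasure μ] {n : ℕ} {σ : ℝ} (hσ : 0 < σ) {ε : Fin n → Ω → ℝ}
    (hindep : iIndepFun ε μ) (hsub : ∀ i, HasSubgaussianMGF (ε i) (Real.toNNReal (σ ^ 2)) μ)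
    (ℓ : EuclideanSpace ℝ (Fin n) →ₗ[ℝ] ℝ) {c : ℝ} (hc : 0 < c) (hℓ : ∀ e, |ℓ e| ≤ c * ‖e‖)
    {u : ℝ} (hu : 0 ≤ u) :
    μ.real {ω | ¬ |ℓ (WithLp.toLp 2 fun i => ε i ω)| ≤ σ * c * u} ≤ 2 * Real.exp (-(u ^ 2 / 2)) := by
  classical
  set a : EuclideanSpace ℝ (Fin n) := WithLp.toLp 2 fun i => ℓ (EuclideanSpace.single i 1) with ha
  have hrep : ∀ e : EuclideanSpace ℝ (Fin n), ℓ e = ∑ i, a i * e i := by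
    intro e
    have h1 : e = ∑ i, e i • EuclideanSpace.single i (1 : ℝ) := by
      ext j
      simp [Pi.single_apply]
    conv_lhs => rw [h1]
    rw [map_sum]
    refine Finset.sum_congr rfl fun i _ => ?_
    rw [map_smul, smul_eq_mul, mul_comm]
  have hnorm : ∑ i, a i ^ 2 ≤ c ^ 2 := by
    have h1 := hℓ a
    have h2 : ‖a‖ ^ 2 = ∑ i, a i ^ 2 := by
      rw [EuclideanSpace.norm_sq_eq]; simp
    have h3 : ℓ a = ‖a‖ ^ 2 := by rw [hrep, h2]; simp [pow_two]
    rw [h3, abs_of_nonneg (by positivity)] at h1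
    rw [← h2]
    have h4 : ‖a‖ ≤ c := by
      rcases (norm_nonneg a).eq_or_lt with h0 | hpos
      · rw [← h0]; exact hc.le
      · rw [pow_two] at h1; exact le_of_mul_le_mul_right h1 hpos
    exact pow_le_pow_left₀ (norm_nonneg _) h4 2
  have hX : HasSubgaussianMGF (fun ω => ∑ i, a i * ε i ω) (Real.toNNReal ((σ * c) ^ 2)) μ := by
    have hind : iIndepFun (fun i ω => a i * ε i ω) μ :=
      hindep.comp (fun i y => a i * y) fun i => measurable_const_mul _
    have h1 := HasSubgaussianMGF.sum_of_iIndepFun hind (s := Finset.univ)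
      (fun i _ => (hsub i).const_mul (a i))
    refine HasSubgaussianMGF.mono h1 ?_
    rw [← NNReal.coe_le_coe, NNReal.coe_sum, Real.coe_toNNReal _ (by positivity)]
    calc _ = ∑ i, a i ^ 2 * σ ^ 2 := by
          refine Finset.sum_congr rfl fun i _ => ?_
          change a i ^ 2 * (Real.toNNReal (σ ^ 2) : ℝ) = _
          rw [Real.coe_toNNReal _ (by positivity)]
      _ = (∑ i, a i ^ 2) * σ ^ 2 := by rw [Finset.sum_mul]
      _ ≤ c ^ 2 * σ ^ 2 := by gcongr
      _ = _ := by ring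
  have hexp : Real.exp (-(σ * c * u) ^ 2 / (2 * (Real.toNNReal ((σ * c) ^ 2) : ℝ)))
      = Real.exp (-(u ^ 2 / 2)) := by
    rw [Real.coe_toNNReal _ (by positivity)]
    congr 1
    field_simp
  have h0 : 0 ≤ σ * c * u := by positivity
  have hp := hX.measure_ge_le h0
  have hn := hX.neg.measure_ge_le h0
  rw [hexp] at hp hn
  have hsubset : {ω | ¬ |ℓ (WithLp.toLp 2 fun i => ε i ω)| ≤ σ * c * u}
      ⊆ {ω | σ * c * u ≤ ∑ i, a i * ε i ω} ∪
        {ω | σ * c * u ≤ (-fun ω => ∑ i, a i * ε i ω) ω} := by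
    intro ω hω
    simp only [Set.mem_ofPred_eq, not_le, hrep] at hω
    simp only [Set.mem_union, Set.mem_ofPred_eq, Pi.neg_apply]
    rcases lt_abs.1 hω with h | h
    · exact Or.inl h.le
    · exact Or.inr h.le
  calc _ ≤ _ := measureReal_mono hsubset (measure_ne_top _ _)
    _ ≤ _ := measureReal_union_le _ _
    _ ≤ Real.exp (-(u ^ 2 / 2)) + Real.exp (-(u ^ 2 / 2)) := add_le_add hp hn
    _ = _ := by ring

/-- The factor `exp (3 g² / 8)` turns the standard normal density into twice the density of variance
`4`. -/
theorem lintegral_exp_sq_gaussian :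
    ∫⁻ g, ENNReal.ofReal (Real.exp (3 * g ^ 2 / 8)) ∂(gaussianReal 0 1) = 2 := by
  rw [gaussianReal_of_var_ne_zero _ one_ne_zero,
    lintegral_withDensity_eq_lintegral_mul _ (measurable_gaussianPDF 0 1) (by fun_prop)]
  have h4 : (4 : ℝ≥0) ≠ 0 := by norm_num
  have : ∀ g : ℝ, (gaussianPDF 0 1 * fun g => ENNReal.ofReal (Real.exp (3 * g ^ 2 / 8))) g
      = 2 * gaussianPDF 0 4 g := by
    intro g
    rw [Pi.mul_apply, gaussianPDF, gaussianPDF, ← ENNReal.ofReal_mul (gaussianPDFReal_nonneg _ _ _)]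
    have h2 : (2 : ℝ≥0∞) = ENNReal.ofReal 2 := by simp
    rw [h2, ← ENNReal.ofReal_mul (by norm_num)]
    congr 1
    rw [gaussianPDFReal, gaussianPDFReal]
    have hs : Real.sqrt (2 * Real.pi * ((4 : ℝ≥0) : ℝ)) = 2 * Real.sqrt (2 * Real.pi) := by
      rw [show (2 * Real.pi * ((4 : ℝ≥0) : ℝ)) = 2 ^ 2 * (2 * Real.pi) by push_cast; ring,
        Real.sqrt_mul (by norm_num), Real.sqrt_sq (by norm_num)]
    rw [hs, mul_assoc, ← Real.exp_add]
    have hexp : -(g - 0) ^ 2 / (2 * ((1 : ℝ≥0) : ℝ)) + 3 * g ^ 2 / 8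
        = -(g - 0) ^ 2 / (2 * ((4 : ℝ≥0) : ℝ)) := by push_cast; ring
    rw [hexp]
    simp only [NNReal.coe_one, mul_one]
    field_simp
  simp_rw [this]
  rw [lintegral_const_mul _ (measurable_gaussianPDF 0 4), lintegral_gaussianPDF_eq_one _ h4, mul_one]

/-- Linearize the square with an auxiliary standard Gaussian `g`: `exp (a² X² / 2)` is the mean of
`exp (a X g)`. Exchanging the integrals leaves the moment generating function of `X`, and `a² = 3 /
(4 σ²)` makes the remaining Gaussian integral equal to `2`. -/
theorem lintegral_exp_sq_le [IsProbabilityMeasure μ] {σ : ℝ} (hσ : 0 < σ) {X : Ω → ℝ}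
    (hsub : HasSubgaussianMGF X (Real.toNNReal (σ ^ 2)) μ) :
    ∫⁻ ω, ENNReal.ofReal (Real.exp (3 / (8 * σ ^ 2) * X ω ^ 2)) ∂μ ≤ 2 := by
  set a : ℝ := Real.sqrt 3 / (2 * σ) with ha
  have ha2 : a ^ 2 = 3 / (4 * σ ^ 2) := by
    rw [ha, div_pow, Real.sq_sqrt (by norm_num)]; ring
  have h1 : ∀ ω, ENNReal.ofReal (Real.exp (3 / (8 * σ ^ 2) * X ω ^ 2))
      = ∫⁻ g, ENNReal.ofReal (Real.exp (a * X ω * g)) ∂(gaussianReal 0 1) := by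
    intro ω
    rw [← ofReal_integral_eq_lintegral_ofReal (integrable_exp_mul_gaussianReal _)
      (ae_of_all _ fun _ => (Real.exp_pos _).le)]
    have := congrFun (mgf_id_gaussianReal (μ := 0) (v := 1)) (a * X ω)
    rw [mgf] at this
    simp only [id] at this
    rw [this]
    congr 2
    rw [mul_pow, ha2]
    push_cast
    field_simp
    ring
  simp_rw [h1]
  rw [lintegral_lintegral_swap]
  · rw [← lintegral_exp_sq_gaussian]
    refine lintegral_mono fun g => ?_
    have h2 : ∀ ω, Real.exp (a * X ω * g) = Real.exp ((a * g) * X ω) := fun ω => by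
      congr 1; ring
    simp_rw [h2]
    rw [← ofReal_integral_eq_lintegral_ofReal (hsub.integrable_exp_mul _)
      (ae_of_all _ fun _ => (Real.exp_pos _).le)]
    apply ENNReal.ofReal_le_ofReal
    refine (hsub.mgf_le (a * g)).trans (le_of_eq ?_)
    rw [Real.coe_toNNReal _ (by positivity), mul_pow, ha2]
    congr 1
    field_simp
    ring
  · have hX := hsub.aemeasurable
    have : AEMeasurable (fun p : Ω × ℝ => X p.1) (μ.prod (gaussianReal 0 1)) := hX.comp_fst
    exact ((Real.measurable_exp.comp_aemeasurable
      ((this.const_mul a).mul measurable_snd.aemeasurable))).ennreal_ofReal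

/-- Chernoff's bound with `s = 3 / (8 σ²)` gives `exp (-3 n / 2) * 2 ^ n`, and `log 2 ≤ 7/10` leaves
the exponent `4 n / 5`. -/
theorem tail_norm [IsProbabilityMeasure μ] {n : ℕ} {σ : ℝ} (hσ : 0 < σ) {ε : Fin n → Ω → ℝ}
    (hindep : iIndepFun ε μ) (hsub : ∀ i, HasSubgaussianMGF (ε i) (Real.toNNReal (σ ^ 2)) μ) :
    μ.real {ω | ¬ ‖(WithLp.toLp 2 fun i => ε i ω : EuclideanSpace ℝ (Fin n))‖ ^ 2 ≤ 4 * σ ^ 2 * n}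
      ≤ Real.exp (-(4 * n / 5)) := by
  set s : ℝ := 3 / (8 * σ ^ 2) with hs
  have hs0 : 0 ≤ s := by positivity
  have hint : ∀ i, Integrable (fun ω => Real.exp (s * ε i ω ^ 2)) μ := by
    intro i
    refine ⟨?_, ?_⟩
    · exact (Real.measurable_exp.comp_aemeasurable
        (((hsub i).aemeasurable.pow_const 2).const_mul s)).aestronglyMeasurable
    · rw [hasFiniteIntegral_iff_ofReal (ae_of_all _ fun _ => (Real.exp_pos _).le)]
      exact (lintegral_exp_sq_le hσ (hsub i)).trans_lt (by simp)
  have hmgf : ∀ i, mgf (fun ω => ε i ω ^ 2) μ s ≤ 2 := by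
    intro i
    rw [mgf, integral_eq_lintegral_of_nonneg_ae (ae_of_all _ fun _ => (Real.exp_pos _).le)
      (hint i).1]
    exact ENNReal.toReal_le_of_le_ofReal (by norm_num)
      ((lintegral_exp_sq_le hσ (hsub i)).trans (by simp))
  have hind : iIndepFun (fun i ω => ε i ω ^ 2) μ :=
    hindep.comp (fun _ y => y ^ 2) fun _ => measurable_id.pow_const 2
  have hae : ∀ i, AEMeasurable (fun ω => ε i ω ^ 2) μ := fun i => (hsub i).aemeasurable.pow_const 2
  have hprod : mgf (∑ i, fun ω => ε i ω ^ 2) μ s = ∏ i, mgf (fun ω => ε i ω ^ 2) μ s :=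
    hind.mgf_sum₀ hae Finset.univ
  have hle : mgf (∑ i, fun ω => ε i ω ^ 2) μ s ≤ 2 ^ n := by
    rw [hprod]
    calc _ ≤ ∏ _i : Fin n, (2 : ℝ) :=
          Finset.prod_le_prod (fun i _ => mgf_nonneg) fun i _ => hmgf i
      _ = 2 ^ n := by simp
  have hintsum : Integrable (fun ω => Real.exp (s * (∑ i, fun ω => ε i ω ^ 2) ω)) μ := by
    have hfun : (fun ω => Real.exp (s * (∑ i, fun ω => ε i ω ^ 2) ω))
        = fun ω => ∏ i, Real.exp (s * ε i ω ^ 2) := by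
      funext ω
      rw [← Real.exp_sum, Finset.sum_apply, Finset.mul_sum]
    rw [hfun]
    -- The Bochner integral of a nonintegrable function is `0`, whereas the product formula makes
    -- this one a product of positive factors; integrability follows.
    by_contra hni
    have : mgf (∑ i, fun ω => ε i ω ^ 2) μ s = 0 := by
      rw [mgf, hfun]
      exact integral_undef hni
    rw [hprod] at this
    obtain ⟨i, -, hi⟩ := Finset.prod_eq_zero_iff.1 this
    exact (mgf_pos (hint i)).ne' hi
  have hch := measure_ge_le_exp_mul_mgf (4 * σ ^ 2 * n) hs0 hintsum
  have hset : {ω | ¬ ‖(WithLp.toLp 2 fun i => ε i ω : EuclideanSpace ℝ (Fin n))‖ ^ 2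
      ≤ 4 * σ ^ 2 * n} ⊆ {ω | 4 * σ ^ 2 * n ≤ (∑ i, fun ω => ε i ω ^ 2) ω} := by
    intro ω hω
    simp only [Set.mem_ofPred_eq, not_le, EuclideanSpace.norm_sq_eq, Real.norm_eq_abs, sq_abs] at hω
    simp only [Set.mem_ofPred_eq, Finset.sum_apply]
    exact hω.le
  refine (measureReal_mono hset (measure_ne_top _ _)).trans (hch.trans ?_)
  have h1 : -s * (4 * σ ^ 2 * n) = -(3 / 2 * n) := by rw [hs]; field_simp; ring
  rw [h1]
  have h2 : (2 : ℝ) ^ n ≤ Real.exp (7 / 10 * n) := by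
    have : (2 : ℝ) ≤ Real.exp (7 / 10) := by
      rw [← Real.log_le_iff_le_exp (by norm_num)]
      have := Real.log_two_lt_d9
      linarith
    calc (2 : ℝ) ^ n ≤ Real.exp (7 / 10) ^ n := by gcongr
      _ = _ := by rw [← Real.exp_nat_mul]; congr 1; ring
  calc Real.exp (-(3 / 2 * n)) * mgf (∑ i, fun ω => ε i ω ^ 2) μ s
      ≤ Real.exp (-(3 / 2 * n)) * Real.exp (7 / 10 * n) := by
        gcongr
        exact hle.trans h2
    _ = _ := by rw [← Real.exp_add]; congr 1; ring

/-- A finite family of linear functionals of the noise is simultaneously small. -/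
theorem tail_linear_family [IsProbabilityMeasure μ] {n : ℕ} {σ : ℝ} (hσ : 0 < σ)
    {ε : Fin n → Ω → ℝ} (hindep : iIndepFun ε μ)
    (hsub : ∀ i, HasSubgaussianMGF (ε i) (Real.toNNReal (σ ^ 2)) μ) {ι : Type*} [Fintype ι]
    (ℓ : ι → EuclideanSpace ℝ (Fin n) →ₗ[ℝ] ℝ) {c : ℝ} (hc : 0 < c)
    (hℓ : ∀ j e, |ℓ j e| ≤ c * ‖e‖) {m : ℝ} (hm : 1 ≤ m) :
    μ.real {ω | ¬ ∀ j, |ℓ j (WithLp.toLp 2 fun i => ε i ω)| ≤ 2 * σ * c * Real.sqrt (Real.log m)}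
      ≤ 2 * Fintype.card ι / m ^ 2 := by
  have hlog : 0 ≤ Real.log m := Real.log_nonneg hm
  have hset : {ω | ¬ ∀ j, |ℓ j (WithLp.toLp 2 fun i => ε i ω)|
        ≤ 2 * σ * c * Real.sqrt (Real.log m)}
      = ⋃ j, {ω | ¬ |ℓ j (WithLp.toLp 2 fun i => ε i ω)|
        ≤ σ * c * (2 * Real.sqrt (Real.log m))} := by
    ext ω
    simp only [Set.mem_ofPred_eq, Set.mem_iUnion, not_forall]
    refine exists_congr fun j => ?_
    rw [show 2 * σ * c * Real.sqrt (Real.log m) = σ * c * (2 * Real.sqrt (Real.log m)) by ring]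
  rw [hset]
  refine (measureReal_iUnion_fintype_le _).trans ?_
  calc _ ≤ ∑ _j : ι, 2 / m ^ 2 := by
        refine Finset.sum_le_sum fun j _ => ?_
        refine (tail_linear hσ hindep hsub (ℓ j) hc (hℓ j) (by positivity)).trans (le_of_eq ?_)
        rw [mul_pow, Real.sq_sqrt hlog, show -(2 ^ 2 * Real.log m / 2) = -(2 * Real.log m) by ring,
          Real.exp_neg, ← Real.log_rpow (by linarith), Real.exp_log (by positivity)]
        norm_num
        rfl
    _ = _ := by rw [Finset.sum_const, Finset.card_univ, nsmul_eq_mul]; ring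

end Tails

end SplitLBI

namespace SplitLBI

open RealInnerProductSpace

/-! ### Singular values -/

section Singular

variable {E F : Type*} [NormedAddCommGroup E] [InnerProductSpace ℝ E] [FiniteDimensional ℝ E]
  [NormedAddCommGroup F] [InnerProductSpace ℝ F] [FiniteDimensional ℝ F]

theorem norm_map_sq_eq_sum_singularValues (T : E →ₗ[ℝ] F) (v : E) :
    ‖T v‖ ^ 2 = ∑ i : Fin (Module.finrank ℝ E), T.singularValues i ^ 2 *
      ⟪T.isSymmetric_adjoint_comp_self.eigenvectorBasis rfl i, v⟫ ^ 2 := by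
  set b := T.isSymmetric_adjoint_comp_self.eigenvectorBasis rfl with hb
  have h1 : ‖T v‖ ^ 2 = ⟪v, (T.adjoint ∘ₗ T) v⟫ := by
    rw [LinearMap.comp_apply, LinearMap.adjoint_inner_right, real_inner_self_eq_norm_sq]
  rw [h1, ← b.sum_inner_mul_inner]
  refine Finset.sum_congr rfl fun i _ => ?_
  have h2 : ⟪b i, (T.adjoint ∘ₗ T) v⟫ = T.singularValues i ^ 2 * ⟪b i, v⟫ := by
    rw [← T.isSymmetric_adjoint_comp_self (b i) v, hb,
      LinearMap.IsSymmetric.apply_eigenvectorBasis, T.sq_singularValues_fin rfl,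
      inner_smul_left]
    simp
  rw [h2, real_inner_comm v]
  ring

/-- Right singular vectors with singular value zero lie in the kernel, so `v` has no coordinate
along them. -/
theorem le_norm_map_of_singularValues (T : E →ₗ[ℝ] F) {c : ℝ} (hc : 0 ≤ c)
    (h : ∀ i, T.singularValues i ≠ 0 → c ≤ T.singularValues i) {v : E}
    (hv : v ∈ (LinearMap.ker T)ᗮ) : c * ‖v‖ ≤ ‖T v‖ := by
  refine le_of_sq_le_sq ?_ (norm_nonneg _)
  set b := T.isSymmetric_adjoint_comp_self.eigenvectorBasis rfl with hb
  rw [mul_pow, norm_map_sq_eq_sum_singularValues, ← b.sum_sq_norm_inner_right v, Finset.mul_sum]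
  refine Finset.sum_le_sum fun i _ => ?_
  rw [Real.norm_eq_abs, sq_abs]
  by_cases h0 : T.singularValues i = 0
  · have hker : b i ∈ LinearMap.ker T := by
      rw [LinearMap.mem_ker, ← norm_eq_zero, ← sq_eq_zero_iff]
      have h1 : ‖T (b i)‖ ^ 2 = ⟪(T.adjoint ∘ₗ T) (b i), b i⟫ := by
        rw [LinearMap.comp_apply, LinearMap.adjoint_inner_left, real_inner_self_eq_norm_sq]
      rw [h1, hb, LinearMap.IsSymmetric.apply_eigenvectorBasis, ← T.sq_singularValues_fin rfl, h0,
        inner_smul_left]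
      simp
    rw [Submodule.inner_right_of_mem_orthogonal hker hv]
    simp
  · gcongr
    exact h i h0

theorem norm_map_le_singularValues_zero (T : E →ₗ[ℝ] F) (v : E) :
    ‖T v‖ ≤ T.singularValues 0 * ‖v‖ := by
  have h0 := T.singularValues_nonneg 0
  refine le_of_sq_le_sq ?_ (by positivity)
  set b := T.isSymmetric_adjoint_comp_self.eigenvectorBasis rfl with hb
  rw [mul_pow, norm_map_sq_eq_sum_singularValues, ← b.sum_sq_norm_inner_right v, Finset.mul_sum]
  refine Finset.sum_le_sum fun i _ => ?_
  rw [Real.norm_eq_abs, sq_abs]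
  have := T.singularValues_nonneg i
  gcongr
  exact T.singularValues_antitone (Nat.zero_le _)

end Singular

/-! ### Vectors and matrices -/

section Coordinates

theorem l2norm_sq {ι : Type*} [Fintype ι] (v : ι → ℝ) : l2norm v ^ 2 = v ⬝ᵥ v := by
  rw [l2norm, EuclideanSpace.norm_sq_eq]
  simp [dotProduct, pow_two]

theorem l2norm_nonneg {ι : Type*} [Fintype ι] (v : ι → ℝ) : 0 ≤ l2norm v := norm_nonneg _

theorem inner_toLp {ι : Type*} [Fintype ι] (v w : ι → ℝ) :
    ⟪WithLp.toLp 2 v, WithLp.toLp 2 w⟫ = v ⬝ᵥ w := by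
  rw [EuclideanSpace.inner_toLp_toLp, dotProduct_comm]; rfl

theorem elim_dotProduct_elim {ι ι' : Type*} [Fintype ι] [Fintype ι'] (a c : ι → ℝ) (b d : ι' → ℝ) :
    Sum.elim a b ⬝ᵥ Sum.elim c d = a ⬝ᵥ c + b ⬝ᵥ d := by
  simp [dotProduct, Fintype.sum_sum_type]

theorem extend_dotProduct {ι ι' : Type*} [Fintype ι] [Fintype ι'] {f : ι' → ι}
    (hf : Function.Injective f) (d : ι' → ℝ) (u : ι → ℝ) :
    Function.extend f d 0 ⬝ᵥ u = d ⬝ᵥ (u ∘ f) := by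
  symm
  refine Fintype.sum_of_injective f hf _ _ ?_ ?_
  · intro i hi
    rw [Function.extend_apply' _ _ _ (by simpa using hi)]
    simp
  · intro i
    rw [hf.extend_apply]; rfl

theorem submatrix_mulVec_extend {ι ι' ι'' : Type*} [Fintype ι] [Fintype ι'] {f : ι' → ι}
    (hf : Function.Injective f) (Q : Matrix ι ι ℝ) (g : ι'' → ι) (d : ι' → ℝ) :
    Q.submatrix g f *ᵥ d = (Q *ᵥ Function.extend f d 0) ∘ g := by
  ext j
  simp only [mulVec, Function.comp_apply]
  rw [dotProduct_comm (fun i => Q (g j) i), extend_dotProduct hf, dotProduct_comm]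
  rfl

/-- Bounds for a positive semidefinite matrix pass to its principal submatrices. -/
theorem energy_submatrix_bounds {ι ι' : Type*} [Fintype ι] [Fintype ι'] [DecidableEq ι]
    {f : ι' → ι} (hf : Function.Injective f) {Q : Matrix ι ι ℝ} (hsymm : Qᵀ = Q)
    (hpsd : ∀ v : ι → ℝ, 0 ≤ v ⬝ᵥ (Q *ᵥ v)) (d : ι' → ℝ) :
    energy (Q.submatrix f f) d ≤ specNorm Q * (d ⬝ᵥ d) ∧
      (Q.submatrix f f *ᵥ d) ⬝ᵥ (Q.submatrix f f *ᵥ d) ≤ specNorm Q * energy (Q.submatrix f f) d := by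
  have hH0 : 0 ≤ specNorm Q := norm_nonneg _
  have hop : ∀ v : ι → ℝ, l2norm (Q *ᵥ v) ≤ specNorm Q * l2norm v := by
    intro v
    have := (Matrix.toEuclideanCLM (n := ι) (𝕜 := ℝ) Q).le_opNorm (WithLp.toLp 2 v)
    rwa [Matrix.toEuclideanCLM_toLp] at this
  have hup : ∀ v : ι → ℝ, v ⬝ᵥ (Q *ᵥ v) ≤ specNorm Q * (v ⬝ᵥ v) := by
    intro v
    rw [← inner_toLp, ← l2norm_sq]
    refine (real_inner_le_norm _ _).trans ?_
    have h1 : l2norm v * l2norm (Q *ᵥ v) ≤ l2norm v * (specNorm Q * l2norm v) :=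
      mul_le_mul_of_nonneg_left (hop v) (l2norm_nonneg v)
    calc _ ≤ l2norm v * (specNorm Q * l2norm v) := h1
      _ = _ := by ring
  have hcs : ∀ v : ι → ℝ, (Q *ᵥ v) ⬝ᵥ (Q *ᵥ v) ≤ specNorm Q * (v ⬝ᵥ (Q *ᵥ v)) := by
    intro v
    set u := Q *ᵥ v with hu
    have hs : v ⬝ᵥ (Q *ᵥ u) = u ⬝ᵥ u := by
      rw [dotProduct_mulVec, ← mulVec_transpose, hsymm]
    have huu := hup u
    -- Positivity at `v - t Q v` with `t = 1 / ‖Q‖` gives `Q² ≤ ‖Q‖ Q` without a square root of `Q`.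
    have hquad : ∀ t : ℝ, 0 ≤ v ⬝ᵥ u - 2 * t * (u ⬝ᵥ u) + t ^ 2 * (u ⬝ᵥ (Q *ᵥ u)) := by
      intro t
      have := hpsd (v - t • u)
      rw [mulVec_sub, mulVec_smul, sub_dotProduct, dotProduct_sub, dotProduct_sub,
        smul_dotProduct, smul_dotProduct, dotProduct_smul, dotProduct_smul, hs, ← hu] at this
      simp only [smul_eq_mul] at this
      linarith
    have huu0 : 0 ≤ u ⬝ᵥ u := by rw [← l2norm_sq]; positivity
    rcases hH0.eq_or_lt with h0 | hpos
    · have h1 := hop v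
      rw [← h0, zero_mul, ← hu] at h1
      have h2 : l2norm u = 0 := le_antisymm h1 (l2norm_nonneg _)
      rw [← l2norm_sq, h2, ← h0]; simp
    · have h1 := hquad (1 / specNorm Q)
      have h2 : (1 / specNorm Q) ^ 2 * (u ⬝ᵥ (Q *ᵥ u)) ≤ 1 / specNorm Q * (u ⬝ᵥ u) := by
        calc _ ≤ (1 / specNorm Q) ^ 2 * (specNorm Q * (u ⬝ᵥ u)) := by gcongr
          _ = _ := by field_simp
      have h3 : 1 / specNorm Q * (u ⬝ᵥ u) ≤ v ⬝ᵥ u := by linarith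
      rwa [one_div, inv_mul_le_iff₀ hpos] at h3
  have e1 : energy (Q.submatrix f f) d
      = Function.extend f d 0 ⬝ᵥ (Q *ᵥ Function.extend f d 0) := by
    rw [energy, submatrix_mulVec_extend hf, extend_dotProduct hf]
  have e2 : d ⬝ᵥ d = Function.extend f d 0 ⬝ᵥ Function.extend f d 0 := by
    rw [extend_dotProduct hf]
    congr 1
    exact funext fun j => (hf.extend_apply d 0 j).symm
  constructor
  · rw [e1, e2]; exact hup _
  · rw [e1]
    refine le_trans ?_ (hcs _)
    rw [submatrix_mulVec_extend hf]
    simp only [dotProduct, Function.comp_apply]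
    rw [← Finset.sum_image (s := Finset.univ) (g := f)
      (f := fun i => (Q *ᵥ Function.extend f d 0) i * (Q *ᵥ Function.extend f d 0) i)
      (fun a _ b _ hab => hf hab)]
    exact Finset.sum_le_sum_of_subset_of_nonneg (Finset.subset_univ _)
      fun i _ _ => mul_self_nonneg _

end Coordinates

/-! ### The Hessian -/

section Hessian

variable {n m p : ℕ} (X : Matrix (Fin n) (Fin p) ℝ) (D : Matrix (Fin m) (Fin p) ℝ)
  (S : Finset (Fin m)) (ν : ℝ)

/-- `X / √n` as a map of Euclidean spaces. -/
noncomputable def scaledLin : EuclideanSpace ℝ (Fin p) →ₗ[ℝ] EuclideanSpace ℝ (Fin n) :=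
  (Real.sqrt n)⁻¹ • Matrix.toEuclideanLin X

/-- `D_J` as a map of Euclidean spaces. -/
noncomputable def rowsLin (J : Finset (Fin m)) :
    EuclideanSpace ℝ (Fin p) →ₗ[ℝ] EuclideanSpace ℝ {j // j ∈ J} :=
  Matrix.toEuclideanLin (rows D J)

/-- Extension by zero of a vector indexed by `S`. -/
noncomputable def extendZero (γ : {j // j ∈ S} → ℝ) : Fin m → ℝ := Function.extend Subtype.val γ 0

theorem extendZero_apply (γ : {j // j ∈ S} → ℝ) (j : {j // j ∈ S}) :
    extendZero S γ j = γ j :=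
  Subtype.val_injective.extend_apply _ _ _

theorem extendZero_of_notMem (γ : {j // j ∈ S} → ℝ) {j : Fin m} (hj : j ∉ S) :
    extendZero S γ j = 0 :=
  Function.extend_apply' _ _ _ (by rintro ⟨a, rfl⟩; exact hj a.2)

theorem rowsLin_apply (J : Finset (Fin m)) (v : EuclideanSpace ℝ (Fin p)) (j : {j // j ∈ J}) :
    rowsLin D J v j = (D *ᵥ v.ofLp) j := rfl

theorem sum_split (f : Fin m → ℝ) :
    ∑ j, f j = ∑ j : {j // j ∈ S}, f j + ∑ j : {j // j ∈ Sᶜ}, f j := by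
  rw [Finset.sum_coe_sort S f, Finset.sum_coe_sort Sᶜ f, Finset.sum_add_sum_compl]

/-- The gradients are linear when the data vanish, so the Hessian acts by them; this replaces block
computations below. -/
theorem hess_mulVec (β : Fin p → ℝ) (g : Fin m → ℝ) :
    hess X D ν *ᵥ Sum.elim β g = Sum.elim (gradBeta X D 0 ν β g) (gradGamma D ν β g) := by
  rw [hess, fromBlocks_mulVec]
  congr 1
  · simp only [Sum.elim_comp_inl, Sum.elim_comp_inr, gradBeta, sub_zero, add_mulVec, neg_mulVec,
      smul_mulVec, mulVec_sub, smul_sub, mulVec_mulVec]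
    abel
  · simp only [Sum.elim_comp_inl, Sum.elim_comp_inr, gradGamma, neg_mulVec, smul_mulVec,
      one_mulVec, smul_sub]
    abel

theorem gradBeta_eq_sub (y : Fin n → ℝ) (β : Fin p → ℝ) (g : Fin m → ℝ) :
    gradBeta X D y ν β g = gradBeta X D 0 ν β g - nstar X *ᵥ y := by
  simp only [gradBeta, sub_zero, mulVec_sub]
  abel

theorem nstar_mulVec_dotProduct (u : Fin n → ℝ) (v : Fin p → ℝ) :
    (nstar X *ᵥ u) ⬝ᵥ v = (n : ℝ)⁻¹ * (u ⬝ᵥ (X *ᵥ v)) := by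
  rw [nstar, smul_mulVec, smul_dotProduct, mulVec_transpose, ← dotProduct_mulVec, smul_eq_mul]

theorem gradBeta_zero_dotProduct (β v : Fin p → ℝ) (g : Fin m → ℝ) :
    gradBeta X D 0 ν β g ⬝ᵥ v = (n : ℝ)⁻¹ * ((X *ᵥ β) ⬝ᵥ (X *ᵥ v))
      + ν⁻¹ * ((D *ᵥ β - g) ⬝ᵥ (D *ᵥ v)) := by
  rw [gradBeta, sub_zero, add_dotProduct, nstar_mulVec_dotProduct, smul_dotProduct,
    mulVec_transpose, ← dotProduct_mulVec, smul_eq_mul]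

theorem inner_scaledLin (u v : EuclideanSpace ℝ (Fin p)) :
    ⟪scaledLin X u, scaledLin X v⟫ = (n : ℝ)⁻¹ * ((X *ᵥ u.ofLp) ⬝ᵥ (X *ᵥ v.ofLp)) := by
  simp only [scaledLin, LinearMap.smul_apply, real_inner_smul_left, real_inner_smul_right]
  rw [← mul_assoc, ← mul_inv, Real.mul_self_sqrt (Nat.cast_nonneg n)]
  congr 1
  exact inner_toLp _ _

theorem inner_rowsLin (J : Finset (Fin m)) (u v : EuclideanSpace ℝ (Fin p)) :
    ⟪rowsLin D J u, rowsLin D J v⟫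
      = ∑ j : {j // j ∈ J}, (D *ᵥ u.ofLp) j * (D *ᵥ v.ofLp) j :=
  inner_toLp _ _

/-- The `β`-gradient tested against a direction. -/
theorem gradBeta_weak (β v : EuclideanSpace ℝ (Fin p)) (g : Fin m → ℝ) (hg : ∀ j ∉ S, g j = 0) :
    gradBeta X D 0 ν β.ofLp g ⬝ᵥ v.ofLp = splitForm (scaledLin X) (rowsLin D Sᶜ) ν β v
      + ν⁻¹ * ∑ j : {j // j ∈ S}, ((D *ᵥ β.ofLp) j - g j) * (D *ᵥ v.ofLp) j := by
  rw [gradBeta_zero_dotProduct, splitForm, inner_scaledLin, inner_rowsLin, add_assoc, ← mul_add]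
  congr 2
  rw [dotProduct, sum_split S, add_comm]
  congr 1
  refine Finset.sum_congr rfl fun j _ => ?_
  rw [Pi.sub_apply, hg j (Finset.mem_compl.1 j.2), sub_zero]

theorem hess_energy (β : Fin p → ℝ) (g : Fin m → ℝ) :
    Sum.elim β g ⬝ᵥ (hess X D ν *ᵥ Sum.elim β g) = (n : ℝ)⁻¹ * ((X *ᵥ β) ⬝ᵥ (X *ᵥ β))
      + ν⁻¹ * ((D *ᵥ β - g) ⬝ᵥ (D *ᵥ β - g)) := by
  rw [hess_mulVec, elim_dotProduct_elim, dotProduct_comm β, gradBeta_zero_dotProduct, gradGamma,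
    dotProduct_smul, smul_eq_mul]
  have : g ⬝ᵥ (g - D *ᵥ β) = -((D *ᵥ β - g) ⬝ᵥ g) := by
    rw [dotProduct_comm, ← neg_dotProduct, neg_sub]
  rw [this, dotProduct_sub (D *ᵥ β - g)]
  ring

theorem hess_psd (hν : 0 < ν) (w : Fin p ⊕ Fin m → ℝ) : 0 ≤ w ⬝ᵥ (hess X D ν *ᵥ w) := by
  have hw : w = Sum.elim (w ∘ Sum.inl) (w ∘ Sum.inr) := by simp
  rw [hw, hess_energy, ← l2norm_sq, ← l2norm_sq]
  positivity

theorem hess_symm : (hess X D ν)ᵀ = hess X D ν := by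
  rw [hess, fromBlocks_transpose]
  congr 1 <;> simp [nstar, transpose_mul]

theorem hessSS_index_injective :
    Function.Injective (Sum.map id Subtype.val : Fin p ⊕ {j // j ∈ S} → Fin p ⊕ Fin m) :=
  Function.injective_id.sumMap Subtype.val_injective

theorem extend_elim (β : Fin p → ℝ) (γ : {j // j ∈ S} → ℝ) :
    Function.extend (Sum.map id Subtype.val : Fin p ⊕ {j // j ∈ S} → Fin p ⊕ Fin m)
      (Sum.elim β γ) 0 = Sum.elim β (extendZero S γ) := by
  have hinj := hessSS_index_injective (p := p) S
  ext i
  rcases i with i | j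
  · exact hinj.extend_apply (Sum.elim β γ) 0 (Sum.inl i)
  · by_cases hj : j ∈ S
    · have := hinj.extend_apply (Sum.elim β γ) 0 (Sum.inr ⟨j, hj⟩)
      refine this.trans ?_
      exact (extendZero_apply S γ ⟨j, hj⟩).symm
    · rw [Function.extend_apply']
      · exact (extendZero_of_notMem S γ hj).symm
      · rintro ⟨a | a, ha⟩
        · simp at ha
        · simp only [Sum.map_inr, Sum.inr.injEq] at ha
          exact hj (ha ▸ a.2)

theorem hessSS_mulVec (β : Fin p → ℝ) (γ : {j // j ∈ S} → ℝ) :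
    hessSS X D ν S *ᵥ Sum.elim β γ = Sum.elim (gradBeta X D 0 ν β (extendZero S γ))
      (fun j : {j // j ∈ S} => gradGamma D ν β (extendZero S γ) j) := by
  rw [hessSS, submatrix_mulVec_extend (hessSS_index_injective S), extend_elim, hess_mulVec]
  ext i
  rcases i with i | j <;> rfl

theorem hessScS_mulVec (β : Fin p → ℝ) (γ : {j // j ∈ S} → ℝ) (j : {j // j ∈ Sᶜ}) :
    (hessScS X D ν S *ᵥ Sum.elim β γ) j = -(ν⁻¹ * (D *ᵥ β) j) := by
  rw [hessScS, submatrix_mulVec_extend (hessSS_index_injective S), extend_elim, hess_mulVec]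
  simp only [Function.comp_apply, Sum.elim_inr, gradGamma, Pi.smul_apply, Pi.sub_apply,
    smul_eq_mul]
  rw [extendZero_of_notMem S γ (Finset.mem_compl.1 j.2)]
  ring

theorem hessSS_energy (β : EuclideanSpace ℝ (Fin p)) (γ : EuclideanSpace ℝ {j // j ∈ S}) :
    energy (hessSS X D ν S) (Sum.elim β.ofLp γ.ofLp) = ‖scaledLin X β‖ ^ 2
      + ν⁻¹ * ‖rowsLin D Sᶜ β‖ ^ 2 + ν⁻¹ * ‖rowsLin D S β - γ‖ ^ 2 := by
  rw [energy, hessSS, submatrix_mulVec_extend (hessSS_index_injective S),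
    ← extend_dotProduct (hessSS_index_injective S), extend_elim, hess_energy, dotProduct,
    dotProduct, sum_split S (fun j => (D *ᵥ β.ofLp - extendZero S γ.ofLp) j *
      (D *ᵥ β.ofLp - extendZero S γ.ofLp) j), ← real_inner_self_eq_norm_sq, inner_scaledLin,
    EuclideanSpace.norm_sq_eq, EuclideanSpace.norm_sq_eq]
  have h1 : ∀ j : {j // j ∈ S}, (D *ᵥ β.ofLp - extendZero S γ.ofLp) j *
      (D *ᵥ β.ofLp - extendZero S γ.ofLp) j = ‖(rowsLin D S β - γ).ofLp j‖ ^ 2 := by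
    intro j
    rw [Real.norm_eq_abs, sq_abs, Pi.sub_apply, extendZero_apply, pow_two]
    rfl
  have h2 : ∀ j : {j // j ∈ Sᶜ}, (D *ᵥ β.ofLp - extendZero S γ.ofLp) j *
      (D *ᵥ β.ofLp - extendZero S γ.ofLp) j = ‖(rowsLin D Sᶜ β).ofLp j‖ ^ 2 := by
    intro j
    rw [Real.norm_eq_abs, sq_abs, Pi.sub_apply, extendZero_of_notMem S _ (Finset.mem_compl.1 j.2),
      sub_zero, pow_two]
    rfl
  simp_rw [h1, h2]
  rw [dotProduct]
  ring

theorem norm_sq_split (v : EuclideanSpace ℝ (Fin p)) :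
    ‖Matrix.toEuclideanLin D v‖ ^ 2 = ‖rowsLin D S v‖ ^ 2 + ‖rowsLin D Sᶜ v‖ ^ 2 := by
  rw [EuclideanSpace.norm_sq_eq, EuclideanSpace.norm_sq_eq, EuclideanSpace.norm_sq_eq, sum_split S]
  rfl

theorem ker_split : LinearMap.ker (Matrix.toEuclideanLin D)
    = LinearMap.ker (rowsLin D S) ⊓ LinearMap.ker (rowsLin D Sᶜ) := by
  ext v
  have h := norm_sq_split D S v
  simp only [Submodule.mem_inf, LinearMap.mem_ker]
  constructor
  · intro h0
    rw [h0] at h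
    simp only [norm_zero] at h
    have h1 := sq_nonneg ‖rowsLin D S v‖
    have h2 := sq_nonneg ‖rowsLin D Sᶜ v‖
    have h3 : ‖rowsLin D S v‖ ^ 2 = 0 := by linarith
    have h4 : ‖rowsLin D Sᶜ v‖ ^ 2 = 0 := by linarith
    exact ⟨by simpa using h3, by simpa using h4⟩
  · rintro ⟨h1, h2⟩
    rw [h1, h2] at h
    simpa using h

end Hessian

end SplitLBI

namespace SplitLBI

open RealInnerProductSpace

/-! ### The hypotheses in terms of Euclidean maps -/

section Translate

variable {n m p : ℕ} {X : Matrix (Fin n) (Fin p) ℝ} {D : Matrix (Fin m) (Fin p) ℝ}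
  {S : Finset (Fin m)} {ν : ℝ}

/-- The orthogonal complement of `ker X ∩ ker D` in Euclidean space. -/
noncomputable abbrev identSub (X : Matrix (Fin n) (Fin p) ℝ) (D : Matrix (Fin m) (Fin p) ℝ)
    (S : Finset (Fin m)) : Submodule ℝ (EuclideanSpace ℝ (Fin p)) :=
  (LinearMap.ker (scaledLin X) ⊓ (LinearMap.ker (rowsLin D S) ⊓ LinearMap.ker (rowsLin D Sᶜ)))ᗮ

theorem ker_scaledLin (hn : 0 < n) :
    LinearMap.ker (scaledLin X) = LinearMap.ker (Matrix.toEuclideanLin X) := by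
  ext v
  have : (Real.sqrt n)⁻¹ ≠ 0 := by positivity
  simp [scaledLin, this]

theorem mem_range_transpose {k : ℕ} (Q : Matrix (Fin k) (Fin p) ℝ)
    (v : EuclideanSpace ℝ (Fin p)) :
    v ∈ LinearMap.range (Matrix.toEuclideanLin Q).adjoint ↔
      v.ofLp ∈ LinearMap.range Qᵀ.mulVecLin := by
  rw [← Matrix.toEuclideanLin_conjTranspose_eq_adjoint,
    Matrix.conjTranspose_eq_transpose_of_trivial]
  constructor
  · rintro ⟨w, rfl⟩
    exact ⟨w.ofLp, rfl⟩
  · rintro ⟨w, hw⟩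
    exact ⟨WithLp.toLp 2 w, by ext i; exact congrFun hw i⟩

/-- The orthogonal complement of a kernel is the range of the adjoint, and taking orthogonal
complements twice turns the complement of an intersection into a sum. -/
theorem mem_identSub_iff (hn : 0 < n) (v : EuclideanSpace ℝ (Fin p)) :
    v ∈ identSub X D S ↔ v.ofLp ∈ identSpace X D := by
  have h1 : identSub X D S = LinearMap.range (Matrix.toEuclideanLin X).adjoint ⊔
      LinearMap.range (Matrix.toEuclideanLin D).adjoint := by
    rw [identSub, ← ker_split, ker_scaledLin hn, ← LinearMap.orthogonal_ker,
      ← LinearMap.orthogonal_ker,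
      ← Submodule.orthogonal_orthogonal ((LinearMap.ker (Matrix.toEuclideanLin X))ᗮ ⊔
        (LinearMap.ker (Matrix.toEuclideanLin D))ᗮ), ← Submodule.inf_orthogonal,
      Submodule.orthogonal_orthogonal, Submodule.orthogonal_orthogonal]
  rw [h1, identSpace, Submodule.mem_sup, Submodule.mem_sup]
  constructor
  · rintro ⟨a, ha, b, hb, rfl⟩
    exact ⟨a.ofLp, (mem_range_transpose _ _).1 ha, b.ofLp, (mem_range_transpose _ _).1 hb, rfl⟩
  · rintro ⟨a, ha, b, hb, hab⟩
    exact ⟨WithLp.toLp 2 a, (mem_range_transpose _ _).2 ha, WithLp.toLp 2 b,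
      (mem_range_transpose _ _).2 hb, by ext i; exact congrFun hab i⟩

theorem elim_l2norm_sq (β : EuclideanSpace ℝ (Fin p)) (γ : EuclideanSpace ℝ {j // j ∈ S}) :
    l2norm (Sum.elim β.ofLp γ.ofLp) ^ 2 = ‖β‖ ^ 2 + ‖γ‖ ^ 2 := by
  rw [l2norm_sq, elim_dotProduct_elim, ← l2norm_sq, ← l2norm_sq]
  rfl

theorem rscSplit_iff (hn : 0 < n) (C : ℝ) :
    RSCSplit X D S C ν ↔ ∀ v ∈ identSub X D S, ∀ γ : EuclideanSpace ℝ {j // j ∈ S},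
      C / (1 + ν) * (‖v‖ ^ 2 + ‖γ‖ ^ 2) ≤ ‖scaledLin X v‖ ^ 2 + ν⁻¹ * ‖rowsLin D Sᶜ v‖ ^ 2
        + ν⁻¹ * ‖rowsLin D S v - γ‖ ^ 2 := by
  constructor
  · intro h v hv γ
    rw [← elim_l2norm_sq, ← hessSS_energy]
    exact h _ ((mem_identSub_iff hn v).1 hv) _
  · intro h β hβ γ
    have := h (WithLp.toLp 2 β) ((mem_identSub_iff hn _).2 hβ) (WithLp.toLp 2 γ)
    rwa [← elim_l2norm_sq, ← hessSS_energy] at this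

/-- Test with `β = 0` and a unit vector in the `γ`-block, which exists because `S` is nonempty. -/
theorem mul_le_one_of_rscSplit (hn : 0 < n) (hν : 0 < ν) (hS : S.Nonempty) {C : ℝ}
    (h : RSCSplit X D S C ν) : ν * (C / (1 + ν)) ≤ 1 := by
  classical
  obtain ⟨j, hj⟩ := hS
  have := (rscSplit_iff hn C).1 h 0 (Submodule.zero_mem _)
    (EuclideanSpace.single (⟨j, hj⟩ : {j // j ∈ S}) 1)
  simp only [map_zero, norm_zero, zero_sub, norm_neg, PiLp.norm_single, norm_one] at this
  have h1 : C / (1 + ν) ≤ ν⁻¹ := by simpa using this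
  calc ν * (C / (1 + ν)) ≤ ν * ν⁻¹ := by gcongr
    _ = 1 := mul_inv_cancel₀ hν.ne'

/-- The map `(v, γ) ↦ (x v, B v, A v - γ)` on `L × ℝ^S` does not depend on `ν` and is injective by
restricted convexity, hence bounded below in finite dimension. The weights `1` and `1/ν` are both at
least `1 / (1 + ν)`. The sup norm on products accounts for the factor `2`. -/
theorem exists_rscSplit (hn : 0 < n) (hRSC : RSC X D S) :
    ∃ C : ℝ, 0 < C ∧ ∀ ν : ℝ, 0 < ν → RSCSplit X D S C ν := by
  obtain ⟨lam, hlam, hR⟩ := hRSC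
  let G := EuclideanSpace ℝ {j // j ∈ S}
  let F := EuclideanSpace ℝ {j // j ∈ Sᶜ}
  let T : (identSub X D S × G) →ₗ[ℝ] (EuclideanSpace ℝ (Fin n) × F × G) :=
    ((scaledLin X ∘ₗ (identSub X D S).subtype) ∘ₗ LinearMap.fst ℝ _ _).prod
      (((rowsLin D Sᶜ ∘ₗ (identSub X D S).subtype) ∘ₗ LinearMap.fst ℝ _ _).prod
        ((rowsLin D S ∘ₗ (identSub X D S).subtype) ∘ₗ LinearMap.fst ℝ _ _ - LinearMap.snd ℝ _ _))
  have hT : ∀ w : identSub X D S × G, T w = (scaledLin X w.1, rowsLin D Sᶜ w.1,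
    rowsLin D S w.1 - w.2) := fun w => rfl
  have hker : LinearMap.ker T = ⊥ := by
    rw [LinearMap.ker_eq_bot']
    rintro ⟨⟨v, hv⟩, γ⟩ hw
    rw [hT] at hw
    simp only [Prod.mk_eq_zero] at hw
    obtain ⟨h1, h2, h3⟩ := hw
    have h4 := hR v.ofLp ((mem_identSub_iff hn v).1 hv) (by
      ext j; exact congrArg (fun f : F => f j) h2)
    have h5 : v.ofLp ⬝ᵥ ((nstar X * X) *ᵥ v.ofLp) = ‖scaledLin X v‖ ^ 2 := by
      rw [← mulVec_mulVec, dotProduct_comm, nstar_mulVec_dotProduct, ← inner_scaledLin,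
        real_inner_self_eq_norm_sq]
    rw [h5, h1, norm_zero] at h4
    have h6 : l2norm v.ofLp = ‖v‖ := rfl
    rw [h6] at h4
    have hv0 : v = 0 := by
      by_contra hne
      have : 0 < lam * ‖v‖ ^ 2 := by positivity
      norm_num at h4
      linarith
    subst hv0
    rw [map_zero, zero_sub, neg_eq_zero] at h3
    simp [h3]
  obtain ⟨K, hK, hanti⟩ := T.exists_antilipschitzWith hker
  have hK' : (0 : ℝ) < K := by exact_mod_cast hK
  refine ⟨1 / (2 * (K : ℝ) ^ 2), by positivity, fun ν hν => ?_⟩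
  rw [rscSplit_iff hn]
  intro v hv γ
  have h1 := hanti.le_mul_dist (⟨v, hv⟩, γ) 0
  rw [dist_zero_right, map_zero, dist_zero_right, hT] at h1
  simp only [Prod.norm_def] at h1
  set a := ‖scaledLin X v‖ with ha
  set b := ‖rowsLin D Sᶜ v‖ with hb
  set c := ‖rowsLin D S v - γ‖ with hc
  have ha0 : 0 ≤ a := norm_nonneg _
  have hb0 : 0 ≤ b := norm_nonneg _
  have hc0 : 0 ≤ c := norm_nonneg _
  have hmax : (max a (max b c)) ^ 2 ≤ a ^ 2 + b ^ 2 + c ^ 2 := by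
    rcases max_choice a (max b c) with h | h <;> rw [h]
    · nlinarith
    · rcases max_choice b c with h' | h' <;> rw [h'] <;> nlinarith
  have hv1 : ‖v‖ ≤ K * max a (max b c) := (le_max_left _ _).trans h1
  have hγ1 : ‖γ‖ ≤ K * max a (max b c) := (le_max_right _ _).trans h1
  have hv2 := pow_le_pow_left₀ (norm_nonneg v) hv1 2
  have hγ2 := pow_le_pow_left₀ (norm_nonneg γ) hγ1 2
  have h2 : 1 / (2 * (K : ℝ) ^ 2) * (‖v‖ ^ 2 + ‖γ‖ ^ 2) ≤ a ^ 2 + b ^ 2 + c ^ 2 := by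
    rw [one_div, inv_mul_le_iff₀ (by positivity)]
    calc ‖v‖ ^ 2 + ‖γ‖ ^ 2 ≤ 2 * (K : ℝ) ^ 2 * (max a (max b c)) ^ 2 := by
          rw [mul_pow] at hv2 hγ2; linarith
      _ ≤ _ := by gcongr
  have h3 : 1 / (2 * (K : ℝ) ^ 2) / (1 + ν) * (‖v‖ ^ 2 + ‖γ‖ ^ 2)
      ≤ (1 / (1 + ν)) * (a ^ 2 + b ^ 2 + c ^ 2) := by
    calc _ = (1 / (1 + ν)) * (1 / (2 * (K : ℝ) ^ 2) * (‖v‖ ^ 2 + ‖γ‖ ^ 2)) := by ring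
      _ ≤ _ := by gcongr
  have h4 : 1 / (1 + ν) ≤ 1 := by rw [div_le_one (by positivity)]; linarith
  have h5 : 1 / (1 + ν) ≤ ν⁻¹ := by rw [← one_div]; gcongr; linarith
  have h6 : 1 / (1 + ν) * a ^ 2 ≤ 1 * a ^ 2 := by gcongr
  have h7 : 1 / (1 + ν) * b ^ 2 ≤ ν⁻¹ * b ^ 2 := by gcongr
  have h8 : 1 / (1 + ν) * c ^ 2 ≤ ν⁻¹ * c ^ 2 := by gcongr
  linarith

theorem finrank_range_restrKer (hn : 0 < n) :
    Module.finrank ℝ (LinearMap.range (restrKer X D)) = rPrime X D := by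
  have hs : (Real.sqrt n)⁻¹ ≠ 0 := by positivity
  have h1 : LinearMap.range (restrKer X D)
      = (LinearMap.ker (Matrix.toEuclideanLin D)).map (Matrix.toEuclideanLin X) := by
    rw [restrKer, LinearMap.range_smul _ _ hs, LinearMap.range_comp, Submodule.range_subtype]
  rw [h1, rPrime]
  have h2 : (LinearMap.ker D.mulVecLin).map X.mulVecLin
      = ((LinearMap.ker (Matrix.toEuclideanLin D)).map (Matrix.toEuclideanLin X)).map
        (WithLp.linearEquiv 2 ℝ (Fin n → ℝ)).toLinearMap := by
    ext w
    simp only [Submodule.mem_map, LinearMap.mem_ker]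
    constructor
    · rintro ⟨v, hv, rfl⟩
      exact ⟨WithLp.toLp 2 (X *ᵥ v), ⟨WithLp.toLp 2 v, by
        ext j; exact congrFun hv j, rfl⟩, rfl⟩
    · rintro ⟨-, ⟨v, hv, rfl⟩, rfl⟩
      exact ⟨v.ofLp, congrArg WithLp.ofLp hv, rfl⟩
  rw [h2]
  exact (LinearEquiv.finrank_map_eq _ _).symm

theorem invLamOne_nonneg : 0 ≤ invLamOne X D := by
  rw [invLamOne]
  split_ifs
  · exact le_rfl
  · exact one_div_nonneg.2 (LinearMap.singularValues_nonneg _ _)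

/-- Inside `ker D`, a vector of `L` is orthogonal to the kernel of the restricted map, and the last
nonzero singular value has index `r' - 1`. If `r' = 0` the restricted map is zero and the vector
vanishes. -/
theorem norm_le_invLamOne (hn : 0 < n) {v : EuclideanSpace ℝ (Fin p)} (hv : v ∈ identSub X D S)
    (hvD : v ∈ LinearMap.ker (rowsLin D S) ⊓ LinearMap.ker (rowsLin D Sᶜ)) :
    ‖v‖ ≤ invLamOne X D * ‖scaledLin X v‖ := by
  have hvD' : v ∈ LinearMap.ker (Matrix.toEuclideanLin D) := by rwa [ker_split D S]
  set T := restrKer X D with hT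
  have hTv : ∀ w : LinearMap.ker (Matrix.toEuclideanLin D), T w = scaledLin X w := fun w => rfl
  have hmem : (⟨v, hvD'⟩ : LinearMap.ker (Matrix.toEuclideanLin D)) ∈ (LinearMap.ker T)ᗮ := by
    rw [Submodule.mem_orthogonal]
    intro k hk
    refine Submodule.inner_right_of_mem_orthogonal (K := LinearMap.ker (scaledLin X) ⊓
      (LinearMap.ker (rowsLin D S) ⊓ LinearMap.ker (rowsLin D Sᶜ))) ⟨hk, ?_⟩ hv
    rw [← ker_split]
    exact k.2
  have hrank : Module.finrank ℝ (LinearMap.range T) = rPrime X D := finrank_range_restrKer hn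
  by_cases h0 : rPrime X D = 0
  · have hz : T = 0 := by
      rw [h0, Submodule.finrank_eq_zero, LinearMap.range_eq_bot] at hrank
      exact hrank
    rw [hz, LinearMap.ker_zero, Submodule.top_orthogonal_eq_bot, Submodule.mem_bot] at hmem
    have : v = 0 := congrArg Subtype.val hmem
    rw [this]
    simp
  · have hlt : rPrime X D - 1 < Module.finrank ℝ (LinearMap.range T) := by omega
    have hpos := LinearMap.singularValues_pos_iff_lt_finrank_range (T := T) |>.2 hlt
    have := le_norm_map_of_singularValues T hpos.le (by
      intro i hi
      have h1 := (LinearMap.singularValues_pos_iff_lt_finrank_range (T := T)).1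
        ((T.singularValues_pos_iff_ne_zero i).2 hi)
      exact T.singularValues_antitone (by omega)) hmem
    rw [invLamOne, if_neg h0, one_div, ← hT, le_inv_mul_iff₀ hpos]
    exact this

theorem splitBounds_of (hn : 0 < n) (hν : 0 < ν) (hS : S.Nonempty) {C lamD LamD LamX : ℝ}
    (hC : 0 < C) (hR : RSCSplit X D S C ν) (hc : ConstBounds X D S lamD LamD LamX) :
    SplitBounds (scaledLin X) (rowsLin D S) (rowsLin D Sᶜ) ν (C / (1 + ν)) lamD LamD LamX
      (invLamOne X D) where
  ν_pos := hν
  lamH_pos := by positivity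
  mul_le_one := mul_le_one_of_rscSplit hn hν hS hR
  lamD_pos := hc.lamD_pos
  LamD_pos := hc.LamD_pos
  LamX_pos := hc.LamX_pos
  q_nonneg := invLamOne_nonneg
  coercive := (rscSplit_iff hn C).1 hR
  lower := by
    intro v hv
    rw [← ker_split] at hv
    rw [← norm_sq_split, ← mul_pow]
    exact pow_le_pow_left₀ (mul_nonneg hc.lamD_pos.le (norm_nonneg _))
      (le_norm_map_of_singularValues _ hc.lamD_pos.le hc.lamD_le hv) 2
  upper := by
    intro v
    rw [← norm_sq_split, ← mul_pow]
    exact pow_le_pow_left₀ (norm_nonneg _) ((norm_map_le_singularValues_zero _ v).trans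
      (mul_le_mul_of_nonneg_right hc.le_LamD (norm_nonneg _))) 2
  lower_compl := fun v hv =>
    le_norm_map_of_singularValues _ hc.lamD_pos.le hc.lamD_le_compl hv
  bound_x := by
    intro v
    refine le_of_sq_le_sq ?_ (mul_nonneg hc.LamX_pos.le (norm_nonneg _))
    have h1 : ‖scaledLin X v‖ ^ 2 = ⟪Matrix.toEuclideanLin (nstar X * X) v, v⟫ := by
      rw [← real_inner_self_eq_norm_sq, inner_scaledLin, ← nstar_mulVec_dotProduct,
        mulVec_mulVec, ← inner_toLp]
      rfl
    have h2 : ‖Matrix.toEuclideanLin (nstar X * X) v‖ ≤ LamX ^ 2 * ‖v‖ :=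
      (norm_map_le_singularValues_zero _ v).trans
        (mul_le_mul_of_nonneg_right hc.le_LamX (norm_nonneg _))
    rw [h1]
    calc _ ≤ ‖Matrix.toEuclideanLin (nstar X * X) v‖ * ‖v‖ := real_inner_le_norm _ _
      _ ≤ (LamX ^ 2 * ‖v‖) * ‖v‖ := by gcongr
      _ = _ := by ring
  lower_ker := fun v hv hvD => norm_le_invLamOne hn hv hvD

/-- Setting `γ = D_S b + ν ρ` completes a weak solution `b` to a solution of `H_{SS} w = (0, ρ)`.
The pseudoinverse provides another one; the difference has zero energy, hence zero inactive rows, so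
both give the same inactive dual variable. -/
theorem weakIRR_of_IRR (hν : 0 < ν) {η : ℝ} (h : IRR X D S ν η) :
    WeakIRR (scaledLin X) (rowsLin D S) (rowsLin D Sᶜ) ν η := by
  intro ρ b hρ hb j
  set γ : {j // j ∈ S} → ℝ := fun j => (D *ᵥ b.ofLp) j + ν * ρ j with hγ
  have hsol : hessSS X D ν S *ᵥ Sum.elim b.ofLp γ = Sum.elim (0 : Fin p → ℝ) ρ.ofLp := by
    rw [hessSS_mulVec]
    congr 1
    · have hzero : ∀ v : EuclideanSpace ℝ (Fin p),
          gradBeta X D 0 ν b.ofLp (extendZero S γ) ⬝ᵥ v.ofLp = 0 := by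
        intro v
        rw [gradBeta_weak X D S ν b v _ (fun j hj => extendZero_of_notMem S γ hj), hb]
        have h1 : ∑ j : {j // j ∈ S}, ((D *ᵥ b.ofLp) j - extendZero S γ j) * (D *ᵥ v.ofLp) j
            = -(ν * ⟪ρ, rowsLin D S v⟫) := by
          have : ⟪ρ, rowsLin D S v⟫ = ∑ j : {j // j ∈ S}, ρ j * (D *ᵥ v.ofLp) j := inner_toLp _ _
          rw [this, Finset.mul_sum, ← Finset.sum_neg_distrib]
          refine Finset.sum_congr rfl fun j _ => ?_
          rw [extendZero_apply, hγ]
          ring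
        rw [h1]
        field_simp
        ring
      have := hzero (WithLp.toLp 2 (gradBeta X D 0 ν b.ofLp (extendZero S γ)))
      rw [← l2norm_sq] at this
      have h2 : l2norm (gradBeta X D 0 ν b.ofLp (extendZero S γ)) = 0 := by
        simpa using this
      rw [l2norm, norm_eq_zero] at h2
      exact congrArg WithLp.ofLp h2
    · ext j
      simp only [gradGamma, Pi.smul_apply, Pi.sub_apply, smul_eq_mul, extendZero_apply, hγ]
      field_simp
      ring
  have hkill : ∀ w : Fin p ⊕ {j // j ∈ S} → ℝ, hessSS X D ν S *ᵥ w = 0 →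
      hessScS X D ν S *ᵥ w = 0 := by
    intro w hw
    have hwe : w = Sum.elim (w ∘ Sum.inl) (w ∘ Sum.inr) := by simp
    have he := hessSS_energy X D S ν (WithLp.toLp 2 (w ∘ Sum.inl)) (WithLp.toLp 2 (w ∘ Sum.inr))
    simp only at he
    rw [← hwe, energy, hw, dotProduct_zero] at he
    have hν' : 0 < ν⁻¹ := inv_pos.2 hν
    have hB : rowsLin D Sᶜ (WithLp.toLp 2 (w ∘ Sum.inl)) = 0 := by
      by_contra hne
      have h1 : 0 < ν⁻¹ * ‖rowsLin D Sᶜ (WithLp.toLp 2 (w ∘ Sum.inl))‖ ^ 2 := by positivity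
      have h2 : 0 ≤ ν⁻¹ * ‖rowsLin D S (WithLp.toLp 2 (w ∘ Sum.inl))
        - WithLp.toLp 2 (w ∘ Sum.inr)‖ ^ 2 := by positivity
      have h3 := sq_nonneg ‖scaledLin X (WithLp.toLp 2 (w ∘ Sum.inl))‖
      linarith
    ext j
    rw [hwe, hessScS_mulVec]
    have : (D *ᵥ (w ∘ Sum.inl)) j = 0 :=
      congrArg (fun f : EuclideanSpace ℝ {j // j ∈ Sᶜ} => f j) hB
    rw [this]
    simp
  have hpinv : (hessScS X D ν S * pinv (hessSS X D ν S)) *ᵥ Sum.elim (0 : Fin p → ℝ) ρ.ofLp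
      = hessScS X D ν S *ᵥ Sum.elim b.ofLp γ := by
    rw [← hsol, ← mulVec_mulVec _ (hessScS X D ν S) (pinv (hessSS X D ν S)), ← sub_eq_zero,
      ← mulVec_sub]
    apply hkill
    rw [mulVec_sub, mulVec_mulVec, mulVec_mulVec,
      (pinv_isMoorePenrose (hessSS X D ν S)).mul_mul_left, sub_self]
  have h1 := h ρ.ofLp (fun j => abs_le.1 (hρ j))
  rw [hpinv] at h1
  have h2 := (norm_le_pi_norm _ j).trans h1
  rw [hessScS_mulVec, norm_neg, Real.norm_eq_abs] at h2
  exact h2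

/-! ### Projections -/

theorem toLp_proj_mulVec (J : Finset (Fin m)) (v : EuclideanSpace ℝ (Fin p)) :
    WithLp.toLp 2 (proj D J *ᵥ v.ofLp) = (LinearMap.ker (rowsLin D Jᶜ)).starProjection v := by
  symm
  have hmp := pinv_isMoorePenrose (rows D Jᶜ)
  apply Submodule.eq_starProjection_of_mem_of_inner_eq_zero
  · rw [LinearMap.mem_ker]
    have : rows D Jᶜ *ᵥ (proj D J *ᵥ v.ofLp) = 0 := by
      rw [mulVec_mulVec, proj, Matrix.mul_sub, Matrix.mul_one, ← Matrix.mul_assoc,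
        hmp.mul_mul_left, sub_self, zero_mulVec]
    exact congrArg (WithLp.toLp 2) this
  · intro w hw
    have hw' : rows D Jᶜ *ᵥ w.ofLp = 0 := congrArg WithLp.ofLp (LinearMap.mem_ker.1 hw)
    have h1 : v - WithLp.toLp 2 (proj D J *ᵥ v.ofLp)
        = WithLp.toLp 2 ((pinv (rows D Jᶜ) * rows D Jᶜ) *ᵥ v.ofLp) := by
      ext i
      simp [proj, sub_mulVec]
    have h2 : ⟪WithLp.toLp 2 ((pinv (rows D Jᶜ) * rows D Jᶜ) *ᵥ v.ofLp), w⟫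
        = ((pinv (rows D Jᶜ) * rows D Jᶜ) *ᵥ v.ofLp) ⬝ᵥ w.ofLp := inner_toLp _ _
    rw [h1, h2, ← hmp.symm_right, mulVec_transpose, ← dotProduct_mulVec, ← mulVec_mulVec, hw',
      mulVec_zero, dotProduct_zero]

/-- As `D_{Sᶜ} β = 0`, the vector extended by zero is all of `D_{Jᶜ} β`, and the mismatch is the
part of `β` lost in the projection. -/
theorem mismatch_eq (J : Finset (Fin m)) (β : EuclideanSpace ℝ (Fin p))
    (hβ : rowsLin D Sᶜ β = 0) :
    mismatch D J S β.ofLp = ‖β - (LinearMap.ker (rowsLin D Jᶜ)).starProjection β‖ := by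
  rw [← toLp_proj_mulVec, mismatch, l2norm]
  congr 1
  have h1 : (fun j : {j // j ∈ Jᶜ} => if j.val ∈ S then (D *ᵥ β.ofLp) j.val else 0)
      = rows D Jᶜ *ᵥ β.ofLp := by
    funext j
    split_ifs with hj
    · rfl
    · exact (congrArg (fun f : EuclideanSpace ℝ {j // j ∈ Sᶜ} => f ⟨j.val,
        Finset.mem_compl.2 hj⟩) hβ).symm
  rw [h1, mulVec_mulVec]
  ext i
  simp [proj, sub_mulVec]

theorem ker_rowsLin_anti {J : Finset (Fin m)} (hJ : J ⊆ S) :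
    LinearMap.ker (rowsLin D Jᶜ) ≤ LinearMap.ker (rowsLin D Sᶜ) := by
  intro v hv
  rw [LinearMap.mem_ker] at hv ⊢
  ext j
  exact congrArg (fun f : EuclideanSpace ℝ {j // j ∈ Jᶜ} => f ⟨j.val,
    Finset.compl_subset_compl.2 hJ j.2⟩) hv

theorem ker_le_ker_rowsLin (J : Finset (Fin m)) :
    LinearMap.ker (rowsLin D S) ⊓ LinearMap.ker (rowsLin D Sᶜ) ≤ LinearMap.ker (rowsLin D Jᶜ) := by
  rw [← ker_split, ker_split D J]
  exact inf_le_right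

end Translate

end SplitLBI

namespace SplitLBI

open RealInnerProductSpace

/-! ### The iteration as a Bregman path -/

section Path

variable {n m p : ℕ} {X : Matrix (Fin n) (Fin p) ℝ} {D : Matrix (Fin m) (Fin p) ℝ}
  {S : Finset (Fin m)} {y : Fin n → ℝ} {ν κ α : ℝ}

theorem shrink_cases (z : Fin m → ℝ) (j : Fin m) :
    (1 < z j ∧ shrink z j = z j - 1) ∨ (z j < -1 ∧ shrink z j = z j + 1) ∨
      (|z j| ≤ 1 ∧ shrink z j = 0) := by
  by_cases h1 : 1 < z j
  · left
    refine ⟨h1, ?_⟩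
    rw [shrink, Real.sign_of_pos (by linarith), abs_of_pos (by linarith), max_eq_left (by linarith)]
    ring
  · by_cases h2 : z j < -1
    · right; left
      refine ⟨h2, ?_⟩
      rw [shrink, Real.sign_of_neg (by linarith), abs_of_neg (by linarith),
        max_eq_left (by linarith)]
      ring
    · right; right
      have : |z j| ≤ 1 := abs_le.2 ⟨by linarith, by linarith⟩
      refine ⟨this, ?_⟩
      rw [shrink, max_eq_right (by linarith), mul_zero]

theorem abs_sub_shrink_le (z : Fin m → ℝ) (j : Fin m) : |z j - shrink z j| ≤ 1 := by
  rcases shrink_cases z j with ⟨h, e⟩ | ⟨h, e⟩ | ⟨h, e⟩ <;> rw [e]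
  · simp
  · simp
  · simpa using h

theorem sub_shrink_mul (z : Fin m → ℝ) (j : Fin m) :
    (z j - shrink z j) * shrink z j = |shrink z j| := by
  rcases shrink_cases z j with ⟨h, e⟩ | ⟨h, e⟩ | ⟨h, e⟩ <;> rw [e]
  · rw [abs_of_pos (by linarith)]; ring
  · rw [abs_of_neg (by linarith)]; ring
  · simp

theorem iter_γ_eq (k : ℕ) :
    (iter X D y ν κ α k).γ = κ • shrink (iter X D y ν κ α k).z := by
  cases k with
  | zero =>
    ext j
    simp [iter, shrink]
  | succ k => rfl

theorem iter_β_succ (k : ℕ) :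
    (iter X D y ν κ α (k + 1)).β = (iter X D y ν κ α k).β
      - (κ * α) • gradBeta X D y ν (iter X D y ν κ α k).β (iter X D y ν κ α k).γ := rfl

theorem iter_z_succ (k : ℕ) :
    (iter X D y ν κ α (k + 1)).z = (iter X D y ν κ α k).z
      - α • gradGamma D ν (iter X D y ν κ α k).β (iter X D y ν κ α k).γ := rfl

theorem iter_β_mem (k : ℕ) : (iter X D y ν κ α k).β ∈ identSpace X D := by
  induction k with
  | zero => exact Submodule.zero_mem _
  | succ k ih =>
    rw [iter_β_succ]
    refine Submodule.sub_mem _ ih (Submodule.smul_mem _ _ ?_)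
    refine Submodule.add_mem_sup ?_ ?_
    · rw [nstar, smul_mulVec]
      exact Submodule.smul_mem _ _ ⟨_, rfl⟩
    · exact Submodule.smul_mem _ _ ⟨_, rfl⟩

variable (X D S y ν κ α) in
/-- The active coordinates of the iterates. -/
noncomputable def primalPath (k : ℕ) : Fin p ⊕ {j // j ∈ S} → ℝ :=
  Sum.elim (iter X D y ν κ α k).β (fun j => (iter X D y ν κ α k).γ j)

variable (X D S y ν κ α) in
/-- The subgradients attached to the active coordinates of the iterates. -/
noncomputable def dualPath (k : ℕ) : Fin p ⊕ {j // j ∈ S} → ℝ :=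
  Sum.elim 0 (fun j => (iter X D y ν κ α k).z j - shrink (iter X D y ν κ α k).z j)

/-- The weights of the `ℓ₁`-norm of the `γ`-block. -/
def blockWeight (p : ℕ) {m : ℕ} (S : Finset (Fin m)) : Fin p ⊕ {j // j ∈ S} → ℝ :=
  Sum.elim 0 1

theorem extendZero_restrict {g : Fin m → ℝ} (hg : ∀ j ∉ S, g j = 0) :
    extendZero S (fun j => g j) = g := by
  ext j
  by_cases hj : j ∈ S
  · exact extendZero_apply S _ ⟨j, hj⟩
  · rw [extendZero_of_notMem S _ hj, hg j hj]

/-- Since `γ = κ shrink z`, the difference `z - shrink z = z - γ/κ` is a subgradient of the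
`ℓ₁`-norm at `γ`. The `β`-block carries weight and subgradient zero. Inactive coordinates must
vanish only before index `N`, as step `k` uses the gradient at `k`. -/
theorem isBregmanPath_iter (hκ : 0 < κ) {w₀ : Fin p ⊕ {j // j ∈ S} → ℝ}
    (hw₀ : hessSS X D ν S *ᵥ w₀ = Sum.elim (nstar X *ᵥ y) 0) {N : ℕ}
    (hN : ∀ k < N, ∀ j ∉ S, (iter X D y ν κ α k).γ j = 0) :
    IsBregmanPath (hessSS X D ν S) (blockWeight p S) κ α w₀ (primalPath X D S y ν κ α)
      (dualPath X D S y ν κ α) N where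
  step := by
    intro k hk i
    have hg : hessSS X D ν S *ᵥ (primalPath X D S y ν κ α k - w₀)
        = Sum.elim (gradBeta X D y ν (iter X D y ν κ α k).β (iter X D y ν κ α k).γ)
          (fun j : {j // j ∈ S} =>
            gradGamma D ν (iter X D y ν κ α k).β (iter X D y ν κ α k).γ j) := by
      rw [mulVec_sub, hw₀, primalPath, hessSS_mulVec, extendZero_restrict (hN k hk),
        gradBeta_eq_sub X D ν y]
      ext i
      rcases i with i | j <;> simp
    rw [hg]
    rcases i with i | j
    · simp only [dualPath, primalPath, Sum.elim_inl, Pi.zero_apply, iter_β_succ, Pi.sub_apply,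
        Pi.smul_apply, smul_eq_mul]
      field_simp
      ring
    · simp only [dualPath, primalPath, Sum.elim_inr, iter_γ_eq, Pi.smul_apply, smul_eq_mul]
      have := congrFun (iter_z_succ (X := X) (D := D) (y := y) (ν := ν) (κ := κ) (α := α) k) j
      simp only [Pi.sub_apply, Pi.smul_apply, smul_eq_mul, iter_γ_eq] at this
      field_simp
      linarith
  abs_le := by
    intro k i
    rcases i with i | j
    · simp [dualPath, blockWeight]
    · exact abs_sub_shrink_le _ _
  mul_eq := by
    intro k i
    rcases i with i | j
    · simp [dualPath, blockWeight]
    · simp only [dualPath, primalPath, blockWeight, Sum.elim_inr, iter_γ_eq, Pi.smul_apply,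
        smul_eq_mul, Pi.one_apply, one_mul, abs_mul, abs_of_pos hκ]
      rw [← sub_shrink_mul]
      ring

variable (X D y ν κ α) in
/-- The accumulated iterates `α (β₀ + ⋯ + β_{k-1})`. -/
noncomputable def betaSum (k : ℕ) : EuclideanSpace ℝ (Fin p) :=
  ∑ i ∈ Finset.range k, α • WithLp.toLp 2 (iter X D y ν κ α i).β

/-- Telescoping the `β`-updates: the coupling to `γ_S` in the gradient is exactly an increment of
`z_S`, so the sum involves only the final `β` and `z_S`. -/
theorem splitForm_betaSum (hκ : 0 < κ) {N : ℕ}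
    (hN : ∀ k < N, ∀ j ∉ S, (iter X D y ν κ α k).γ j = 0) (v : EuclideanSpace ℝ (Fin p)) :
    splitForm (scaledLin X) (rowsLin D Sᶜ) ν (betaSum X D y ν κ α N) v
      = α * N * ((n : ℝ)⁻¹ * (y ⬝ᵥ (X *ᵥ v.ofLp))) - κ⁻¹ * ((iter X D y ν κ α N).β ⬝ᵥ v.ofLp)
        - ∑ j : {j // j ∈ S}, (iter X D y ν κ α N).z j * (D *ᵥ v.ofLp) j := by
  induction N with
  | zero => simp [betaSum, splitForm, iter]
  | succ k ih =>
    have ih' := ih fun i hi => hN i (by omega)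
    have h1 := gradBeta_weak X D S ν (WithLp.toLp 2 (iter X D y ν κ α k).β) v
      (iter X D y ν κ α k).γ (hN k (by omega))
    have h2 : splitForm (scaledLin X) (rowsLin D Sᶜ) ν (betaSum X D y ν κ α (k + 1)) v
        = splitForm (scaledLin X) (rowsLin D Sᶜ) ν (betaSum X D y ν κ α k) v
          + α * splitForm (scaledLin X) (rowsLin D Sᶜ) ν
            (WithLp.toLp 2 (iter X D y ν κ α k).β) v := by
      rw [betaSum, Finset.sum_range_succ, ← betaSum, SplitBounds.splitForm_add_left,
        SplitBounds.splitForm_smul_left]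
    have h3 : κ⁻¹ * ((iter X D y ν κ α (k + 1)).β ⬝ᵥ v.ofLp)
        = κ⁻¹ * ((iter X D y ν κ α k).β ⬝ᵥ v.ofLp)
          - α * (gradBeta X D 0 ν (iter X D y ν κ α k).β (iter X D y ν κ α k).γ ⬝ᵥ v.ofLp
            - (n : ℝ)⁻¹ * (y ⬝ᵥ (X *ᵥ v.ofLp))) := by
      rw [iter_β_succ, sub_dotProduct, smul_dotProduct, gradBeta_eq_sub, sub_dotProduct,
        nstar_mulVec_dotProduct, smul_eq_mul]
      field_simp
    have h4 : ∑ j : {j // j ∈ S}, (iter X D y ν κ α (k + 1)).z j * (D *ᵥ v.ofLp) j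
        = ∑ j : {j // j ∈ S}, (iter X D y ν κ α k).z j * (D *ᵥ v.ofLp) j
          + α * (ν⁻¹ * ∑ j : {j // j ∈ S}, ((D *ᵥ (iter X D y ν κ α k).β) j
            - (iter X D y ν κ α k).γ j) * (D *ᵥ v.ofLp) j) := by
      rw [Finset.mul_sum, Finset.mul_sum, ← Finset.sum_add_distrib]
      refine Finset.sum_congr rfl fun j _ => ?_
      rw [iter_z_succ]
      simp only [gradGamma, Pi.sub_apply, Pi.smul_apply, smul_eq_mul]
      ring
    rw [h2, ih', h3, h4, h1]
    push_cast
    ring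

theorem iter_z_compl {N : ℕ} (hN : ∀ k < N, ∀ j ∉ S, (iter X D y ν κ α k).γ j = 0)
    (j : {j // j ∈ Sᶜ}) :
    (iter X D y ν κ α N).z j = ν⁻¹ * rowsLin D Sᶜ (betaSum X D y ν κ α N) j := by
  induction N with
  | zero => simp [betaSum, iter]
  | succ k ih =>
    rw [iter_z_succ, betaSum, Finset.sum_range_succ, ← betaSum, map_add, map_smul]
    simp only [gradGamma, Pi.sub_apply, Pi.smul_apply, smul_eq_mul, PiLp.add_apply,
      PiLp.smul_apply]
    rw [ih fun i hi => hN i (by omega), hN k (by omega) j (Finset.mem_compl.1 j.2), rowsLin_apply]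
    ring_nf
    rfl

end Path

/-! ### Runs of the iteration under small noise -/

section Run

variable {n m p : ℕ} {X : Matrix (Fin n) (Fin p) ℝ} {D : Matrix (Fin m) (Fin p) ℝ}
  {S : Finset (Fin m)} {ν κ α lamH lamD LamD LamX η σ tau lam : ℝ}
  {βs u : EuclideanSpace ℝ (Fin p)} {ε : Fin n → ℝ}

/-- The noise, divided by `√n`. -/
noncomputable def scaledNoise (ε : Fin n → ℝ) : EuclideanSpace ℝ (Fin n) :=
  (Real.sqrt n)⁻¹ • WithLp.toLp 2 ε

/-- A run of the iteration on data whose noise is small; `u` is the error of the oracle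
estimator. -/
structure GoodRun (X : Matrix (Fin n) (Fin p) ℝ) (D : Matrix (Fin m) (Fin p) ℝ)
    (S : Finset (Fin m)) (ν κ α lamH lamD LamD LamX η σ tau lam : ℝ)
    (βs u : EuclideanSpace ℝ (Fin p)) (ε : Fin n → ℝ) : Prop where
  n_pos : 0 < n
  bounds : SplitBounds (scaledLin X) (rowsLin D S) (rowsLin D Sᶜ) ν lamH lamD LamD LamX
    (invLamOne X D)
  irr : WeakIRR (scaledLin X) (rowsLin D S) (rowsLin D Sᶜ) ν η
  η_pos : 0 < η
  η_le : η ≤ 1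
  κ_pos : 0 < κ
  α_pos : 0 < α
  σ_pos : 0 < σ
  step_lt : κ * α * specNorm (hess X D ν) < 2
  lam_eq : lam = lamH * (1 - κ * α * specNorm (hess X D ν) / 2)
  target_mem : βs ∈ identSub X D S
  target_compl : rowsLin D Sᶜ βs = 0
  mem : u ∈ identSub X D S
  weak : ∀ v, splitForm (scaledLin X) (rowsLin D Sᶜ) ν u v = ⟪scaledNoise ε, scaledLin X v⟫
  noise_norm : ‖scaledNoise ε‖ ≤ 2 * σ
  noise_compl : ∀ j, tau * |ν⁻¹ * rowsLin D Sᶜ u j| ≤ η / 4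
  kappa_le : kappaBound η ν σ lamD LamD LamX (invLamOne X D) ‖βs‖ lam ≤ κ

namespace GoodRun

theorem lam_pos (h : GoodRun X D S ν κ α lamH lamD LamD LamX η σ tau lam βs u ε) : 0 < lam := by
  have := h.step_lt
  rw [h.lam_eq]
  exact mul_pos h.bounds.lamH_pos (by linarith)

theorem lam_le (h : GoodRun X D S ν κ α lamH lamD LamD LamX η σ tau lam βs u ε) : lam ≤ lamH := by
  rw [h.lam_eq]
  have h1 : 0 ≤ specNorm (hess X D ν) := norm_nonneg _
  have h2 := h.κ_pos
  have h3 := h.α_pos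
  have h4 : 0 ≤ κ * α * specNorm (hess X D ν) := by positivity
  have h5 := h.bounds.lamH_pos
  nlinarith

/-- The response vector of a run. -/
noncomputable def data (X : Matrix (Fin n) (Fin p) ℝ) (βs : EuclideanSpace ℝ (Fin p))
    (ε : Fin n → ℝ) : Fin n → ℝ := X *ᵥ βs.ofLp + ε

/-- The oracle estimator. -/
noncomputable def oracle (D : Matrix (Fin m) (Fin p) ℝ) (S : Finset (Fin m))
    (βs u : EuclideanSpace ℝ (Fin p)) : Fin p ⊕ {j // j ∈ S} → ℝ :=
  Sum.elim (βs + u).ofLp (rowsLin D S (βs + u)).ofLp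

theorem data_inner (v : EuclideanSpace ℝ (Fin p)) :
    (n : ℝ)⁻¹ * (data X βs ε ⬝ᵥ (X *ᵥ v.ofLp))
      = ⟪scaledLin X βs + scaledNoise ε, scaledLin X v⟫ := by
  rw [inner_add_left, inner_scaledLin, data, add_dotProduct, mul_add]
  congr 1
  simp only [scaledLin, scaledNoise, LinearMap.smul_apply, real_inner_smul_left,
    real_inner_smul_right]
  rw [← mul_assoc, ← mul_inv, Real.mul_self_sqrt (Nat.cast_nonneg n)]
  congr 1
  exact (inner_toLp _ _).symm

/-- With `γ_S = D_S β` the `γ`-gradient vanishes and the `β`-equation is the weak equation for `u`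
added to the noiseless one for `βs`. -/
theorem hessSS_oracle (h : GoodRun X D S ν κ α lamH lamD LamD LamX η σ tau lam βs u ε) :
    hessSS X D ν S *ᵥ oracle D S βs u = Sum.elim (nstar X *ᵥ data X βs ε) 0 := by
  rw [oracle, hessSS_mulVec]
  congr 1
  · rw [← sub_eq_zero]
    set d := gradBeta X D 0 ν (βs + u).ofLp (extendZero S (rowsLin D S (βs + u)).ofLp)
      - nstar X *ᵥ data X βs ε with hd
    have hzero : ∀ v : EuclideanSpace ℝ (Fin p), d ⬝ᵥ v.ofLp = 0 := by
      intro v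
      rw [hd, sub_dotProduct, gradBeta_weak X D S ν (βs + u) v _
        (fun j hj => extendZero_of_notMem S _ hj), nstar_mulVec_dotProduct, data_inner,
        SplitBounds.splitForm_add_left, h.weak, inner_add_left]
      have h1 : splitForm (scaledLin X) (rowsLin D Sᶜ) ν βs v = ⟪scaledLin X βs, scaledLin X v⟫ := by
        rw [splitForm, h.target_compl, inner_zero_left, mul_zero, add_zero]
      have h2 : ∀ j : {j // j ∈ S}, ((D *ᵥ (βs + u).ofLp) j
          - extendZero S (rowsLin D S (βs + u)).ofLp j) * (D *ᵥ v.ofLp) j = 0 := by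
        intro j
        rw [extendZero_apply, rowsLin_apply, sub_self, zero_mul]
      rw [h1, Finset.sum_eq_zero fun j _ => h2 j]
      ring
    have := hzero (WithLp.toLp 2 d)
    rw [← l2norm_sq] at this
    have h2 : l2norm d = 0 := by simpa using this
    rw [l2norm, norm_eq_zero] at h2
    exact congrArg WithLp.ofLp h2
  · ext j
    simp only [gradGamma, Pi.smul_apply, Pi.sub_apply, smul_eq_mul, extendZero_apply,
      rowsLin_apply, sub_self, mul_zero, Pi.zero_apply]

/-- The radius that contains all iterates. -/
noncomputable def radius (ν σ lamD LamD LamX q b lam : ℝ) : ℝ :=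
  (1 + Real.sqrt (2 * (1 + ν * LamX ^ 2 + LamD ^ 2) / (lam * ν)))
    * ((1 + LamD) * b + 2 * σ / lam * (LamX / lamD + LamX / lamD ^ 2
        + (lam * lamD ^ 2 + LamX ^ 2) * q / lamD ^ 2))

theorem map_le (h : GoodRun X D S ν κ α lamH lamD LamD LamX η σ tau lam βs u ε)
    (v : EuclideanSpace ℝ (Fin p)) : ‖rowsLin D S v‖ ≤ LamD * ‖v‖ := by
  have := h.bounds.upper v
  refine le_of_sq_le_sq ?_ (mul_nonneg h.bounds.LamD_pos.le (norm_nonneg _))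
  rw [mul_pow]
  nlinarith [sq_nonneg ‖rowsLin D Sᶜ v‖]

theorem oracle_norm_le (h : GoodRun X D S ν κ α lamH lamD LamD LamX η σ tau lam βs u ε) :
    l2norm (oracle D S βs u) ≤ (1 + LamD) * ‖βs‖ + 2 * σ / lam * (LamX / lamD + LamX / lamD ^ 2
        + (lam * lamD ^ 2 + LamX ^ 2) * invLamOne X D / lamD ^ 2) := by
  have hl := h.lam_pos
  have hll := h.lam_le
  have hH := h.bounds.lamH_pos
  have hd := h.bounds.lamD_pos
  have hX := h.bounds.LamX_pos
  have hq := h.bounds.q_nonneg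
  have hσ := h.σ_pos
  have he := h.noise_norm
  have h1 : l2norm (oracle D S βs u) ≤ ‖βs + u‖ + ‖rowsLin D S (βs + u)‖ := by
    refine le_of_sq_le_sq ?_ (by positivity)
    rw [oracle, elim_l2norm_sq]
    nlinarith [norm_nonneg (βs + u), norm_nonneg (rowsLin D S (βs + u))]
  have h2 : ‖rowsLin D S (βs + u)‖ ≤ LamD * ‖βs‖ + ‖rowsLin D S u‖ := by
    rw [map_add]
    exact (norm_add_le _ _).trans (add_le_add_left (h.map_le βs) _)
  have h3 := h.bounds.norm_maps_le h.weak
  have h4 := h.bounds.norm_sub_proj_le h.weak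
  have h5 := h.bounds.norm_proj_le h.weak h.mem
  set u0 := (LinearMap.ker (rowsLin D S) ⊓ LinearMap.ker (rowsLin D Sᶜ)).starProjection u
  have h6 : ‖u‖ ≤ ‖u - u0‖ + ‖u0‖ := by
    have := norm_add_le (u - u0) u0
    rwa [sub_add_cancel] at this
  have b1 : LamX / (lamH * lamD) * ‖scaledNoise ε‖ ≤ 2 * σ / lam * (LamX / lamD) := by
    calc _ ≤ LamX / (lam * lamD) * (2 * σ) := by gcongr
      _ = _ := by field_simp
  have b2 : LamX / (lamH * lamD ^ 2) * ‖scaledNoise ε‖ ≤ 2 * σ / lam * (LamX / lamD ^ 2) := by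
    calc _ ≤ LamX / (lam * lamD ^ 2) * (2 * σ) := by gcongr
      _ = _ := by field_simp
  have b3 : invLamOne X D * ((1 + LamX ^ 2 / (lamH * lamD ^ 2)) * ‖scaledNoise ε‖)
      ≤ 2 * σ / lam * ((lam * lamD ^ 2 + LamX ^ 2) * invLamOne X D / lamD ^ 2) := by
    calc _ ≤ invLamOne X D * ((1 + LamX ^ 2 / (lam * lamD ^ 2)) * (2 * σ)) := by gcongr
      _ = _ := by field_simp
  have h7 := norm_add_le βs u
  have e : 2 * σ / lam * (LamX / lamD + LamX / lamD ^ 2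
        + (lam * lamD ^ 2 + LamX ^ 2) * invLamOne X D / lamD ^ 2)
      = 2 * σ / lam * (LamX / lamD) + 2 * σ / lam * (LamX / lamD ^ 2)
        + 2 * σ / lam * ((lam * lamD ^ 2 + LamX ^ 2) * invLamOne X D / lamD ^ 2) := by ring
  rw [e]
  linarith

theorem oracle_energy_le (h : GoodRun X D S ν κ α lamH lamD LamD LamX η σ tau lam βs u ε) :
    energy (hessSS X D ν S) (oracle D S βs u)
      ≤ 2 * (1 + ν * LamX ^ 2 + LamD ^ 2) / ν * l2norm (oracle D S βs u) ^ 2 := by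
  have hν := h.bounds.ν_pos
  have hν' : 0 < ν⁻¹ := inv_pos.2 hν
  rw [oracle, hessSS_energy, elim_l2norm_sq, sub_self, norm_zero]
  have h1 := pow_le_pow_left₀ (norm_nonneg _) (h.bounds.bound_x (βs + u)) 2
  have h2 := h.bounds.upper (βs + u)
  have h3 : ν⁻¹ * ‖rowsLin D Sᶜ (βs + u)‖ ^ 2 ≤ ν⁻¹ * (LamD ^ 2 * ‖βs + u‖ ^ 2) := by
    gcongr
    linarith [sq_nonneg ‖rowsLin D S (βs + u)‖]
  have e : 2 * (1 + ν * LamX ^ 2 + LamD ^ 2) / ν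
      = 2 * ν⁻¹ + 2 * LamX ^ 2 + 2 * (ν⁻¹ * LamD ^ 2) := by field_simp
  rw [e]
  set N := ‖βs + u‖ ^ 2
  set G := ‖rowsLin D S (βs + u)‖ ^ 2 with hG
  have hN : 0 ≤ N := by positivity
  have hG0 : 0 ≤ G := by positivity
  have k1 : 0 ≤ ν⁻¹ * N := by positivity
  have k2 : 0 ≤ LamX ^ 2 * N := by positivity
  have k3 : 0 ≤ ν⁻¹ * LamD ^ 2 * N := by positivity
  have k4 : 0 ≤ (2 * ν⁻¹ + 2 * LamX ^ 2 + 2 * (ν⁻¹ * LamD ^ 2)) * G := by positivity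
  nlinarith

variable (X D S ν κ α βs ε) in
/-- The primal path of a run. -/
noncomputable abbrev primal (k : ℕ) : Fin p ⊕ {j // j ∈ S} → ℝ :=
  primalPath X D S (data X βs ε) ν κ α k

variable (X D S ν κ α βs u ε) in
/-- The root of the normalized excess energy. -/
noncomputable def gap (lamH : ℝ) (k : ℕ) : ℝ :=
  Real.sqrt (energy (hessSS X D ν S) (primal X D S ν κ α βs ε k - oracle D S βs u) / lamH)

theorem path (h : GoodRun X D S ν κ α lamH lamD LamD LamX η σ tau lam βs u ε) {N : ℕ}
    (hN : ∀ k < N, ∀ j ∉ S, (iter X D (data X βs ε) ν κ α k).γ j = 0) :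
    IsBregmanPath (hessSS X D ν S) (blockWeight p S) κ α (oracle D S βs u)
      (primal X D S ν κ α βs ε) (dualPath X D S (data X βs ε) ν κ α) N :=
  isBregmanPath_iter h.κ_pos h.hessSS_oracle hN

theorem error_eq (k : ℕ) : primal X D S ν κ α βs ε k - oracle D S βs u
    = Sum.elim (WithLp.toLp 2 (iter X D (data X βs ε) ν κ α k).β - (βs + u)).ofLp
      (WithLp.toLp 2 (fun j : {j // j ∈ S} => (iter X D (data X βs ε) ν κ α k).γ j)
        - rowsLin D S (βs + u)).ofLp := by
  ext i
  rcases i with i | j <;> rfl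

theorem error_mem (h : GoodRun X D S ν κ α lamH lamD LamD LamX η σ tau lam βs u ε) (k : ℕ) :
    WithLp.toLp 2 (iter X D (data X βs ε) ν κ α k).β - (βs + u) ∈ identSub X D S :=
  Submodule.sub_mem _ ((mem_identSub_iff h.n_pos _).2 (iter_β_mem k))
    (Submodule.add_mem _ h.target_mem h.mem)

theorem energy_nonneg (h : GoodRun X D S ν κ α lamH lamD LamD LamX η σ tau lam βs u ε) (k : ℕ) :
    0 ≤ energy (hessSS X D ν S) (primal X D S ν κ α βs ε k - oracle D S βs u) := by
  have hν' : 0 < ν⁻¹ := inv_pos.2 h.bounds.ν_pos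
  rw [error_eq, hessSS_energy]
  positivity

theorem gap_sq (h : GoodRun X D S ν κ α lamH lamD LamD LamX η σ tau lam βs u ε) (k : ℕ) :
    lamH * gap X D S ν κ α βs u ε lamH k ^ 2
      = energy (hessSS X D ν S) (primal X D S ν κ α βs ε k - oracle D S βs u) := by
  have := h.bounds.lamH_pos
  rw [gap, Real.sq_sqrt (div_nonneg (h.energy_nonneg k) this.le)]
  field_simp

/-- Coercivity applies because all iterates stay in `L`, the gradients lying in `Im Xᵀ + Im Dᵀ`. -/
theorem error_norm_le_gap (h : GoodRun X D S ν κ α lamH lamD LamD LamX η σ tau lam βs u ε)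
    (k : ℕ) :
    l2norm (primal X D S ν κ α βs ε k - oracle D S βs u) ≤ gap X D S ν κ α βs u ε lamH k := by
  refine le_of_sq_le_sq ?_ (Real.sqrt_nonneg _)
  have h1 := h.bounds.coercive _ (h.error_mem k)
    (WithLp.toLp 2 (fun j : {j // j ∈ S} => (iter X D (data X βs ε) ν κ α k).γ j)
        - rowsLin D S (βs + u))
  rw [← hessSS_energy, ← elim_l2norm_sq, ← error_eq, ← h.gap_sq] at h1
  exact le_of_mul_le_mul_left h1 h.bounds.lamH_pos

theorem gap_succ_le (h : GoodRun X D S ν κ α lamH lamD LamD LamX η σ tau lam βs u ε) {N : ℕ}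
    (hN : ∀ k < N, ∀ j ∉ S, (iter X D (data X βs ε) ν κ α k).γ j = 0) {k : ℕ} (hk : k < N) :
    gap X D S ν κ α βs u ε lamH (k + 1) ≤ gap X D S ν κ α βs u ε lamH k := by
  have hH := h.bounds.lamH_pos
  apply Real.sqrt_le_sqrt
  refine div_le_div_of_nonneg_right ?_ hH.le
  have hsymm : (hessSS X D ν S)ᵀ = hessSS X D ν S := by
    rw [hessSS, transpose_submatrix, hess_symm]
  exact energy_step h.κ_pos h.α_pos hsymm (h.path hN)
    (fun d => (energy_submatrix_bounds (hessSS_index_injective S) (hess_symm X D ν)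
      (hess_psd X D ν h.bounds.ν_pos) d).1) h.step_lt.le hk

/-- By monotonicity the gap is largest at the zero initialization, where it is the energy of the
oracle itself. Replacing `λ_H` by the smaller `λ_H'` matches the form of the lower bound on `κ`. -/
theorem gap_le (h : GoodRun X D S ν κ α lamH lamD LamD LamX η σ tau lam βs u ε) {N : ℕ}
    (hN : ∀ k < N, ∀ j ∉ S, (iter X D (data X βs ε) ν κ α k).γ j = 0) {k : ℕ} (hk : k ≤ N) :
    gap X D S ν κ α βs u ε lamH k ≤
      Real.sqrt (2 * (1 + ν * LamX ^ 2 + LamD ^ 2) / (lam * ν)) * l2norm (oracle D S βs u) := by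
  have hanti : ∀ k ≤ N, gap X D S ν κ α βs u ε lamH k ≤ gap X D S ν κ α βs u ε lamH 0 := by
    intro k
    induction k with
    | zero => intro _; exact le_rfl
    | succ k ih => intro hk; exact (h.gap_succ_le hN (by omega)).trans (ih (by omega))
  refine (hanti k hk).trans ?_
  have hν := h.bounds.ν_pos
  have hl := h.lam_pos
  have hH := h.bounds.lamH_pos
  have h0 : primal X D S ν κ α βs ε 0 = 0 := by
    ext i
    rcases i with i | j <;> rfl
  rw [gap, h0]
  apply Real.sqrt_le_iff.2
  refine ⟨mul_nonneg (Real.sqrt_nonneg _) (l2norm_nonneg _), ?_⟩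
  rw [mul_pow, Real.sq_sqrt (by positivity), div_le_iff₀ hH]
  have h1 : energy (hessSS X D ν S) (0 - oracle D S βs u)
      = energy (hessSS X D ν S) (oracle D S βs u) := by
    rw [energy, energy, zero_sub, mulVec_neg, neg_dotProduct_neg]
  rw [h1]
  refine h.oracle_energy_le.trans ?_
  have h2 : 2 * (1 + ν * LamX ^ 2 + LamD ^ 2) / ν
      ≤ 2 * (1 + ν * LamX ^ 2 + LamD ^ 2) / (lam * ν) * lamH := by
    rw [div_mul_eq_mul_div, div_le_div_iff₀ hν (by positivity)]
    have := h.lam_le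
    have h3 : 0 ≤ 2 * (1 + ν * LamX ^ 2 + LamD ^ 2) * ν := by positivity
    nlinarith
  calc _ ≤ 2 * (1 + ν * LamX ^ 2 + LamD ^ 2) / (lam * ν) * lamH * l2norm (oracle D S βs u) ^ 2 := by
        gcongr
    _ = _ := by ring

theorem radius_le (h : GoodRun X D S ν κ α lamH lamD LamD LamX η σ tau lam βs u ε) :
    (1 + 1 / lamD + LamX * invLamOne X D / lamD)
      * radius ν σ lamD LamD LamX (invLamOne X D) ‖βs‖ lam ≤ κ * η / 4 := by
  have h1 := h.kappa_le
  have hη := h.η_pos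
  have e : kappaBound η ν σ lamD LamD LamX (invLamOne X D) ‖βs‖ lam
      = 4 / η * ((1 + 1 / lamD + LamX * invLamOne X D / lamD)
        * radius ν σ lamD LamD LamX (invLamOne X D) ‖βs‖ lam) := by
    rw [kappaBound, radius]; ring
  rw [e, div_mul_eq_mul_div, div_le_iff₀ hη] at h1
  linarith

theorem radius_nonneg (h : GoodRun X D S ν κ α lamH lamD LamD LamX η σ tau lam βs u ε) :
    0 ≤ radius ν σ lamD LamD LamX (invLamOne X D) ‖βs‖ lam := by
  have hl := h.lam_pos
  have hd := h.bounds.lamD_pos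
  have hD := h.bounds.LamD_pos
  have hX := h.bounds.LamX_pos
  have hq := h.bounds.q_nonneg
  have hσ := h.σ_pos
  rw [radius]
  positivity

theorem gap_le_radius (h : GoodRun X D S ν κ α lamH lamD LamD LamX η σ tau lam βs u ε) {N : ℕ}
    (hN : ∀ k < N, ∀ j ∉ S, (iter X D (data X βs ε) ν κ α k).γ j = 0) {k : ℕ} (hk : k ≤ N) :
    gap X D S ν κ α βs u ε lamH k + l2norm (oracle D S βs u)
      ≤ radius ν σ lamD LamD LamX (invLamOne X D) ‖βs‖ lam := by
  have h1 := h.gap_le hN hk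
  have h2 := h.oracle_norm_le
  rw [radius]
  set R := Real.sqrt (2 * (1 + ν * LamX ^ 2 + LamD ^ 2) / (lam * ν))
  have hR : 0 ≤ R := Real.sqrt_nonneg _
  calc _ ≤ (1 + R) * l2norm (oracle D S βs u) := by linarith
    _ ≤ _ := by gcongr

theorem primal_le_radius (h : GoodRun X D S ν κ α lamH lamD LamD LamX η σ tau lam βs u ε) {N : ℕ}
    (hN : ∀ k < N, ∀ j ∉ S, (iter X D (data X βs ε) ν κ α k).γ j = 0) {k : ℕ} (hk : k ≤ N) :
    l2norm (primal X D S ν κ α βs ε k)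
      ≤ radius ν σ lamD LamD LamX (invLamOne X D) ‖βs‖ lam := by
  refine le_trans ?_ (h.gap_le_radius hN hk)
  have h1 := h.error_norm_le_gap k
  have h2 : l2norm (primal X D S ν κ α βs ε k)
      ≤ l2norm (primal X D S ν κ α βs ε k - oracle D S βs u) + l2norm (oracle D S βs u) := by
    have := norm_add_le (WithLp.toLp 2 (primal X D S ν κ α βs ε k - oracle D S βs u))
      (WithLp.toLp 2 (oracle D S βs u))
    rwa [← WithLp.toLp_add, sub_add_cancel] at this
  linarith

/-- Up to the stopping time no inactive row enters the support. -/
theorem no_false_positive (h : GoodRun X D S ν κ α lamH lamD LamD LamX η σ tau lam βs u ε)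
    {N : ℕ} (hN : α * N ≤ tau) :
    ∀ j ∉ S, (iter X D (data X βs ε) ν κ α N).γ j = 0 := by
  -- Inactivity before `N` already yields the radius bound at `N`, since each step uses only the
  -- previous gradient; the induction closes without a bootstrap.
  induction N using Nat.strong_induction_on with
  | _ N ih =>
    intro j hj
    have hα := h.α_pos
    have hκ := h.κ_pos
    have hprev : ∀ k < N, ∀ j ∉ S, (iter X D (data X βs ε) ν κ α k).γ j = 0 := by
      intro k hk
      refine ih k hk (le_trans ?_ hN)
      have : (k : ℝ) ≤ N := by exact_mod_cast hk.le
      gcongr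
    set Rw := radius ν σ lamD LamD LamX (invLamOne X D) ‖βs‖ lam with hRw
    have hRw0 : 0 ≤ Rw := h.radius_nonneg
    have hprim := h.primal_le_radius hprev le_rfl
    set it := iter X D (data X βs ε) ν κ α N with hit
    have hsq := elim_l2norm_sq (WithLp.toLp 2 it.β)
      (WithLp.toLp 2 (fun j : {j // j ∈ S} => it.γ j))
    have hsq' : l2norm (primal X D S ν κ α βs ε N) ^ 2
      = ‖WithLp.toLp 2 it.β‖ ^ 2 + ‖WithLp.toLp 2 (fun j : {j // j ∈ S} => it.γ j)‖ ^ 2 := hsq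
    have hβn : ‖WithLp.toLp 2 it.β‖ ≤ Rw :=
      (le_of_sq_le_sq (by rw [hsq']; exact le_add_of_nonneg_right (sq_nonneg _))
        (l2norm_nonneg _)).trans hprim
    have hγn : ‖WithLp.toLp 2 (fun j : {j // j ∈ S} => it.γ j)‖ ≤ Rw :=
      (le_of_sq_le_sq (by rw [hsq']; exact le_add_of_nonneg_left (sq_nonneg _))
        (l2norm_nonneg _)).trans hprim
    -- An active dual variable exceeds its subgradient by `γ_j / κ`, so it is at most `1` up to a
    -- small excess.
    have hz : ∀ j : {j // j ∈ S},
        |(WithLp.toLp 2 (fun j : {j // j ∈ S} => it.z j) : EuclideanSpace ℝ {j // j ∈ S}) j|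
          ≤ 1 + Rw / κ := by
      intro j
      have h1 := abs_sub_shrink_le it.z j
      have h2 : it.γ j = κ * shrink it.z j := by
        rw [hit, iter_γ_eq]; rfl
      have h3 : |it.γ j| ≤ Rw := by
        refine le_trans ?_ hγn
        simpa using PiLp.norm_apply_le (WithLp.toLp 2 (fun j : {j // j ∈ S} => it.γ j)) j
      have h4 : |shrink it.z j| ≤ Rw / κ := by
        rw [le_div_iff₀ hκ]
        rw [h2, abs_mul, abs_of_pos hκ] at h3
        linarith
      have h5 : |it.z j| ≤ |it.z j - shrink it.z j| + |shrink it.z j| := by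
        have := abs_add_le (it.z j - shrink it.z j) (shrink it.z j)
        rwa [sub_add_cancel] at this
      exact h5.trans (add_le_add h1 h4)
    have hdual := h.bounds.abs_dual_le h.irr h.η_pos.le (t := α * N) (r := 1 + Rw / κ)
      (by positivity) (by positivity) (βs := βs) (u := u) (b := betaSum X D (data X βs ε) ν κ α N)
      (f := κ⁻¹ • WithLp.toLp 2 it.β) (e := scaledNoise ε)
      (z := WithLp.toLp 2 (fun j : {j // j ∈ S} => it.z j)) h.target_compl h.weak
      (Submodule.smul_mem _ _ ((mem_identSub_iff h.n_pos _).2 (iter_β_mem N))) hz (by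
        intro v
        rw [splitForm_betaSum hκ hprev, data_inner, real_inner_smul_left]
        have e1 : ⟪WithLp.toLp 2 it.β, v⟫ = it.β ⬝ᵥ v.ofLp := inner_toLp _ _
        have e2 : ⟪WithLp.toLp 2 (fun j : {j // j ∈ S} => it.z j), rowsLin D S v⟫
          = ∑ j : {j // j ∈ S}, it.z j * (D *ᵥ v.ofLp) j := inner_toLp _ _
        rw [e1, e2]) ⟨j, Finset.mem_compl.2 hj⟩
    rw [← iter_z_compl hprev] at hdual
    have hnoise := h.noise_compl ⟨j, Finset.mem_compl.2 hj⟩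
    have hnoise' : α * N * |ν⁻¹ * rowsLin D Sᶜ u ⟨j, Finset.mem_compl.2 hj⟩| ≤ η / 4 :=
      le_trans (by gcongr) hnoise
    have hrad := h.radius_le
    rw [← hRw] at hrad
    have hq := h.bounds.q_nonneg
    have hd := h.bounds.lamD_pos
    have hX := h.bounds.LamX_pos
    have hfn : ‖κ⁻¹ • WithLp.toLp 2 it.β‖ ≤ Rw / κ := by
      rw [norm_smul, Real.norm_eq_abs, abs_of_pos (inv_pos.2 hκ), inv_mul_eq_div]
      gcongr
    have h6 : (1 + LamX * invLamOne X D) / lamD * ‖κ⁻¹ • WithLp.toLp 2 it.β‖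
        ≤ (1 + LamX * invLamOne X D) / lamD * (Rw / κ) := by gcongr
    have h7 : (1 + (1 + LamX * invLamOne X D) / lamD) * (Rw / κ) ≤ η / 4 := by
      have e : (1 + (1 + LamX * invLamOne X D) / lamD) * (Rw / κ)
          = (1 + 1 / lamD + LamX * invLamOne X D / lamD) * Rw / κ := by ring
      rw [e, div_le_iff₀ hκ]
      linarith
    have hRκ : 0 ≤ Rw / κ := by positivity
    have hη := h.η_pos
    -- Budget: noise at most `η/4`; the source `β_N / κ` and the excess of `z_S` together at most
    -- `η/2`; the irrepresentable part at most `1 - η`.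
    have h8 : |it.z j| ≤ 1 := by
      have h9 : (1 - η) * (1 + Rw / κ) ≤ 1 - η + Rw / κ := by nlinarith
      have h10 : |it.z j| ≤ α * N * |ν⁻¹ * rowsLin D Sᶜ u ⟨j, Finset.mem_compl.2 hj⟩|
        + 2 * ((1 + LamX * invLamOne X D) / lamD * ‖κ⁻¹ • WithLp.toLp 2 it.β‖)
        + (1 - η) * (1 + Rw / κ) := hdual
      nlinarith
    have h11 : it.γ j = κ * shrink it.z j := by rw [hit, iter_γ_eq]; rfl
    rw [h11]
    rcases shrink_cases it.z j with ⟨h12, -⟩ | ⟨h12, -⟩ | ⟨-, h12⟩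
    · have := (abs_le.1 h8).2; linarith
    · have := (abs_le.1 h8).1; linarith
    · rw [h12, mul_zero]

end GoodRun

end Run

end SplitLBI

namespace SplitLBI

open RealInnerProductSpace

/-! ### Conclusions for a run under small noise -/

section Conclusions

variable {n m p : ℕ} {X : Matrix (Fin n) (Fin p) ℝ} {D : Matrix (Fin m) (Fin p) ℝ}
  {S : Finset (Fin m)} {ν κ α lamH lamD LamD LamX η σ tau lam t : ℝ}
  {βs u : EuclideanSpace ℝ (Fin p)} {ε : Fin n → ℝ} {N : ℕ}

theorem sum_blockWeight_sq : ∑ i, blockWeight p S i ^ 2 = S.card := by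
  simp [blockWeight]

namespace GoodRun

variable (X D S ν κ α βs u ε) in
/-- The Bregman potential along a run. -/
noncomputable def runPotential (k : ℕ) : ℝ :=
  potential (blockWeight p S) κ (oracle D S βs u) (primal X D S ν κ α βs ε k)
    (dualPath X D S (data X βs ε) ν κ α k)

theorem inactive (h : GoodRun X D S ν κ α lamH lamD LamD LamX η σ tau lam βs u ε)
    (hN : α * N ≤ tau) {k : ℕ} (hk : k ≤ N) :
    ∀ j ∉ S, (iter X D (data X βs ε) ν κ α k).γ j = 0 := by
  have hα := h.α_pos
  refine h.no_false_positive (le_trans ?_ hN)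
  gcongr

theorem runPotential_step (h : GoodRun X D S ν κ α lamH lamD LamD LamX η σ tau lam βs u ε)
    (hN : α * N ≤ tau) {k : ℕ} (hk : k < N) :
    runPotential X D S ν κ α βs u ε (k + 1) ≤ runPotential X D S ν κ α βs u ε k
      - α * lam * gap X D S ν κ α βs u ε lamH k ^ 2 := by
  have h1 := potential_step h.κ_pos (h.path (N := N) fun k hk => h.inactive hN hk.le)
    (fun d => (energy_submatrix_bounds (hessSS_index_injective S) (hess_symm X D ν)
      (hess_psd X D ν h.bounds.ν_pos) d).2) hk
  rw [← h.gap_sq] at h1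
  refine h1.trans (le_of_eq ?_)
  rw [h.lam_eq, runPotential]
  ring

theorem radius_le_quarter (h : GoodRun X D S ν κ α lamH lamD LamD LamX η σ tau lam βs u ε) :
    radius ν σ lamD LamD LamX (invLamOne X D) ‖βs‖ lam ≤ κ / 4 := by
  have h1 := h.radius_le
  have h2 := h.radius_nonneg
  have hd := h.bounds.lamD_pos
  have hX := h.bounds.LamX_pos
  have hq := h.bounds.q_nonneg
  have hκ := h.κ_pos
  have hη := h.η_le
  have h3 : 0 ≤ 1 / lamD + LamX * invLamOne X D / lamD := by positivity
  nlinarith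

theorem gap_nonneg (k : ℕ) : 0 ≤ gap X D S ν κ α βs u ε lamH k := Real.sqrt_nonneg _

theorem error_le_quarter (h : GoodRun X D S ν κ α lamH lamD LamD LamX η σ tau lam βs u ε)
    (hN : α * N ≤ tau) {k : ℕ} (hk : k ≤ N) :
    l2norm (primal X D S ν κ α βs ε k - oracle D S βs u) ≤ κ / 4 := by
  have h1 := h.gap_le_radius (N := N) (fun k hk => h.inactive hN hk.le) hk
  have h2 := h.radius_le_quarter
  have h3 := h.error_norm_le_gap k
  have h4 := l2norm_nonneg (oracle D S βs u)
  linarith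

/-- The error stays below `κ/4`, so the quadratic part of the potential is at most one eighth of the
error; with the factor `2` of the `ℓ₁` part this gives `17/8`. -/
theorem runPotential_le_sqrt (h : GoodRun X D S ν κ α lamH lamD LamD LamX η σ tau lam βs u ε)
    (hS : S.Nonempty) (hN : α * N ≤ tau) {k : ℕ} (hk : k ≤ N) :
    runPotential X D S ν κ α βs u ε k
      ≤ 17 / 8 * Real.sqrt S.card * gap X D S ν κ α βs u ε lamH k := by
  have h1 := potential_le_sqrt (h.path (N := N) fun k hk => h.inactive hN hk.le) k
  have h2 := h.error_le_quarter hN hk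
  have h3 := h.error_norm_le_gap k
  have hκ := h.κ_pos
  rw [sum_blockWeight_sq, ← l2norm_sq, Real.sqrt_sq (l2norm_nonneg _)] at h1
  have h0 := l2norm_nonneg (primal X D S ν κ α βs ε k - oracle D S βs u)
  set d := l2norm (primal X D S ν κ α βs ε k - oracle D S βs u)
  have hs : 1 ≤ Real.sqrt S.card := by
    rw [Real.one_le_sqrt]
    exact_mod_cast hS.card_pos
  have h4 : d ^ 2 / (2 * κ) ≤ d / 8 := by
    rw [div_le_iff₀ (by positivity)]
    nlinarith
  refine h1.trans ?_
  have h5 : d / 8 ≤ 1 / 8 * (Real.sqrt S.card * d) := by nlinarith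
  calc _ ≤ 17 / 8 * Real.sqrt S.card * d := by linarith
    _ ≤ _ := by gcongr

theorem runPotential_le_of_gap (h : GoodRun X D S ν κ α lamH lamD LamD LamX η σ tau lam βs u ε)
    {g : ℝ} (hg : 0 < g) (hgκ : g ≤ κ / 4)
    (hgap : ∀ j : {j // j ∈ S}, g ≤ |rowsLin D S (βs + u) j|) (k : ℕ) :
    runPotential X D S ν κ α βs u ε k ≤ 17 / 8 / g * gap X D S ν κ α βs u ε lamH k ^ 2 := by
  have hκ := h.κ_pos
  -- The comparison uses only the subgradient relations, which hold for all `k`; a path of length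
  -- zero suffices.
  have h1 := potential_le_of_gap (h.path (N := 0) fun k hk => absurd hk (by omega)) hg
    (by rintro (i | j) <;> simp [blockWeight])
    (by
      rintro (i | j)
      · exact Or.inl rfl
      · exact Or.inr (hgap j)) k
  rw [← l2norm_sq] at h1
  refine h1.trans ?_
  have h3 := h.error_norm_le_gap k
  have h0 := l2norm_nonneg (primal X D S ν κ α βs ε k - oracle D S βs u)
  have h4 : 2 / g + 1 / (2 * κ) ≤ 17 / 8 / g := by
    have : 1 / (2 * κ) ≤ 1 / 8 / g := by
      rw [div_div, div_le_div_iff_of_pos_left one_pos (by positivity) (by positivity)]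
      linarith
    calc 2 / g + 1 / (2 * κ) ≤ 2 / g + 1 / 8 / g := by gcongr
      _ = _ := by ring
  gcongr

theorem gap_terminal (h : GoodRun X D S ν κ α lamH lamD LamD LamX η σ tau lam βs u ε)
    (hS : S.Nonempty) (hN : α * N ≤ tau) (hN2 : 2 ≤ N) :
    gap X D S ν κ α βs u ε lamH N * (α * lam * N) ≤ 85 / 16 * Real.sqrt S.card := by
  have hα := h.α_pos
  have hl := h.lam_pos
  have hs : 0 < Real.sqrt S.card := Real.sqrt_pos.2 (by exact_mod_cast hS.card_pos)
  have := terminal_le (P := runPotential X D S ν κ α βs u ε)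
    (e := gap X D S ν κ α βs u ε lamH) (a := α * lam) (b := 17 / 8 * Real.sqrt S.card) (N := N)
    (by positivity) (by positivity) hN2
    (fun k _ => potential_nonneg h.κ_pos (h.path (N := N) fun k hk => h.inactive hN hk.le) k)
    (fun k hk => h.runPotential_step hN hk)
    (fun k hk => h.gap_succ_le (fun k hk => h.inactive hN hk.le) hk)
    (fun k _ => gap_nonneg k) (fun k hk => h.runPotential_le_sqrt hS hN hk)
  linarith

theorem gap_terminal_of_signal
    (h : GoodRun X D S ν κ α lamH lamD LamD LamX η σ tau lam βs u ε)
    (hS : S.Nonempty) (hN : α * N ≤ tau) {g R : ℝ} (hg : 0 < g) (hR : 0 < R) (hgκ : g ≤ κ / 4)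
    (hgap : ∀ j : {j // j ∈ S}, g ≤ |rowsLin D S (βs + u) j|)
    (htime : 17 / 8 * (2 * R + Real.log S.card) / g + 2 * (α * lam) ≤ α * lam * N) :
    R * gap X D S ν κ α βs u ε lamH N ≤ g := by
  have hα := h.α_pos
  have hl := h.lam_pos
  exact terminal_le_of_gap (P := runPotential X D S ν κ α βs u ε) (s := S.card)
    (by positivity) (by norm_num) (by exact_mod_cast hS.card_pos) hg hR
    (fun k _ => potential_nonneg h.κ_pos (h.path (N := N) fun k hk => h.inactive hN hk.le) k)
    (fun k hk => h.runPotential_step hN hk)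
    (fun k hk => h.gap_succ_le (fun k hk => h.inactive hN hk.le) hk)
    (fun k _ => gap_nonneg k) (fun k hk => h.runPotential_le_sqrt hS hN hk)
    (fun k _ => h.runPotential_le_of_gap hg hgκ hgap k) htime

theorem suppIter_subset (h : GoodRun X D S ν κ α lamH lamD LamD LamX η σ tau lam βs u ε)
    (hN : α * N ≤ tau) : suppIter X D (data X βs ε) ν κ α N ⊆ S := by
  intro j hj
  by_contra hjS
  exact (Finset.mem_filter.1 hj).2 (h.inactive hN le_rfl j hjS)

variable (X D ν κ α βs u ε) in
/-- The error of `β_k` with respect to the oracle estimator. -/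
noncomputable def betaError (k : ℕ) : EuclideanSpace ℝ (Fin p) :=
  WithLp.toLp 2 (iter X D (data X βs ε) ν κ α k).β - (βs + u)

theorem l2norm_error_sq (k : ℕ) :
    l2norm (primal X D S ν κ α βs ε k - oracle D S βs u) ^ 2
      = ‖betaError X D ν κ α βs u ε k‖ ^ 2
        + ‖WithLp.toLp 2 (fun j : {j // j ∈ S} => (iter X D (data X βs ε) ν κ α k).γ j)
          - rowsLin D S (βs + u)‖ ^ 2 := by
  rw [error_eq, elim_l2norm_sq]
  rfl

theorem betaError_norm_le (h : GoodRun X D S ν κ α lamH lamD LamD LamX η σ tau lam βs u ε)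
    (k : ℕ) : ‖betaError X D ν κ α βs u ε k‖ ≤ gap X D S ν κ α βs u ε lamH k := by
  refine le_trans (le_of_sq_le_sq ?_ (l2norm_nonneg _)) (h.error_norm_le_gap k)
  rw [l2norm_error_sq]
  exact le_add_of_nonneg_right (sq_nonneg _)

theorem γ_error_le (h : GoodRun X D S ν κ α lamH lamD LamD LamX η σ tau lam βs u ε)
    (k : ℕ) (j : {j // j ∈ S}) :
    |(iter X D (data X βs ε) ν κ α k).γ j - rowsLin D S (βs + u) j|
      ≤ gap X D S ν κ α βs u ε lamH k := by
  have h1 := PiLp.norm_apply_le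
    (WithLp.toLp 2 (fun j : {j // j ∈ S} => (iter X D (data X βs ε) ν κ α k).γ j)
          - rowsLin D S (βs + u)) j
  refine le_trans h1 (le_trans (le_of_sq_le_sq ?_ (l2norm_nonneg _)) (h.error_norm_le_gap k))
  rw [l2norm_error_sq]
  exact le_add_of_nonneg_left (sq_nonneg _)

/-- By `coercive_sparse`, the excess energy controls `A w` and `B w` with constant `λ_H`, which the
normalization of the gap cancels; only the ratio `Λ_D / λ_D` survives. -/
theorem map_proj_betaError_le
    (h : GoodRun X D S ν κ α lamH lamD LamD LamX η σ tau lam βs u ε) (k : ℕ) :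
    ‖rowsLin D S ((LinearMap.ker (rowsLin D Sᶜ)).starProjection (betaError X D ν κ α βs u ε k))‖
      ≤ LamD / lamD * gap X D S ν κ α βs u ε lamH k := by
  set w := betaError X D ν κ α βs u ε k with hw
  have hd := h.bounds.lamD_pos
  have hD := h.bounds.LamD_pos
  have hH := h.bounds.lamH_pos
  have hν' : 0 < ν⁻¹ := inv_pos.2 h.bounds.ν_pos
  have h1 := h.bounds.norm_map_proj_le w
  have h2 := h.bounds.lower_sub_proj w
  have h3 := h.bounds.coercive_sparse w
  have h4 : ‖scaledLin X w‖ ^ 2 + ν⁻¹ * ‖rowsLin D Sᶜ w‖ ^ 2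
      ≤ lamH * gap X D S ν κ α βs u ε lamH k ^ 2 := by
    rw [h.gap_sq, error_eq, hessSS_energy, hw, betaError]
    exact le_add_of_nonneg_right (by positivity)
  have h5 := le_of_mul_le_mul_left (h3.trans h4) hH
  have h6 : lamD * ‖w - (LinearMap.ker (rowsLin D S)
      ⊓ LinearMap.ker (rowsLin D Sᶜ)).starProjection w‖ ≤ gap X D S ν κ α βs u ε lamH k := by
    refine le_of_sq_le_sq ?_ (gap_nonneg k)
    rw [mul_pow]
    exact h2.trans h5
  calc _ ≤ _ := h1
    _ = LamD / lamD * (lamD * ‖w - (LinearMap.ker (rowsLin D S)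
      ⊓ LinearMap.ker (rowsLin D Sᶜ)).starProjection w‖) := by field_simp
    _ ≤ _ := by gcongr

theorem toLp_betaTilde (k : ℕ) :
    WithLp.toLp 2 (betaTilde X D (data X βs ε) ν κ α k)
      = (LinearMap.ker (rowsLin D (suppIter X D (data X βs ε) ν κ α k)ᶜ)).starProjection βs
        + (LinearMap.ker (rowsLin D (suppIter X D (data X βs ε) ν κ α k)ᶜ)).starProjection u
        + (LinearMap.ker (rowsLin D (suppIter X D (data X βs ε) ν κ α k)ᶜ)).starProjection
          (betaError X D ν κ α βs u ε k) := by
  rw [betaTilde]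
  have := toLp_proj_mulVec (D := D) (suppIter X D (data X βs ε) ν κ α k)
    (WithLp.toLp 2 (iter X D (data X βs ε) ν κ α k).β)
  rw [this, ← map_add, ← map_add, betaError]
  congr 1
  abel

theorem lamD_le_LamD (h : GoodRun X D S ν κ α lamH lamD LamD LamX η σ tau lam βs u ε)
    (hne : rowsLin D S βs ≠ 0) : lamD ≤ LamD := by
  set K := LinearMap.ker (rowsLin D S) ⊓ LinearMap.ker (rowsLin D Sᶜ) with hK
  have hmem : K.starProjection βs ∈ K := Submodule.starProjection_apply_mem _ _
  have h1 := h.bounds.lower_sub_proj βs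
  have h2 := h.bounds.upper (βs - K.starProjection βs)
  rw [map_sub, map_sub, LinearMap.mem_ker.1 hmem.1, LinearMap.mem_ker.1 hmem.2, sub_zero,
    sub_zero] at h2
  have h3 : 0 < ‖βs - K.starProjection βs‖ := by
    refine norm_pos_iff.2 fun h0 => hne ?_
    rw [sub_eq_zero.1 h0]
    exact LinearMap.mem_ker.1 hmem.1
  have h4 := le_of_mul_le_mul_right (h1.trans h2) (by positivity)
  exact le_of_sq_le_sq h4 h.bounds.LamD_pos.le

/-- `ℓ₂` error of the projected iterate. -/
theorem betaTilde_error_le (h : GoodRun X D S ν κ α lamH lamD LamD LamX η σ tau lam βs u ε)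
    (hN : α * N ≤ tau) {r c : ℝ}
    (hu : ‖(LinearMap.ker (rowsLin D S) ⊓ LinearMap.ker (rowsLin D Sᶜ)).starProjection u‖ ≤ r)
    (hc0 : 0 ≤ c)
    (hc : ∀ j, |rowsLin D S ((LinearMap.ker (rowsLin D Sᶜ)).starProjection u) j| ≤ c) :
    l2norm (betaTilde X D (data X βs ε) ν κ α N - βs.ofLp)
      ≤ gap X D S ν κ α βs u ε lamH N + (r + Real.sqrt S.card * c / lamD)
        + mismatch D (suppIter X D (data X βs ε) ν κ α N) S βs.ofLp := by
  have hd := h.bounds.lamD_pos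
  rw [mismatch_eq _ _ h.target_compl]
  have hT := toLp_betaTilde (X := X) (D := D) (ν := ν) (κ := κ) (α := α) (βs := βs) (u := u)
    (ε := ε) N
  have h1 := h.bounds.norm_nested_proj_le u (ker_rowsLin_anti (h.suppIter_subset hN))
    (ker_le_ker_rowsLin (suppIter X D (data X βs ε) ν κ α N))
  set J := LinearMap.ker (rowsLin D (suppIter X D (data X βs ε) ν κ α N)ᶜ)
  have h2 : ‖rowsLin D S ((LinearMap.ker (rowsLin D Sᶜ)).starProjection u)‖
      ≤ Real.sqrt S.card * c := by
    refine le_of_sq_le_sq ?_ (by positivity)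
    rw [EuclideanSpace.norm_sq_eq, mul_pow, Real.sq_sqrt (by positivity)]
    calc _ ≤ ∑ _j : {j // j ∈ S}, c ^ 2 :=
          Finset.sum_le_sum fun j _ => pow_le_pow_left₀ (norm_nonneg _) (hc j) 2
      _ = _ := by simp
  have h3 : ‖J.starProjection (betaError X D ν κ α βs u ε N)‖
      ≤ gap X D S ν κ α βs u ε lamH N :=
    (Submodule.norm_starProjection_apply_le _ _).trans (h.betaError_norm_le N)
  have e : l2norm (betaTilde X D (data X βs ε) ν κ α N - βs.ofLp)
      = ‖J.starProjection (betaError X D ν κ α βs u ε N) + J.starProjection u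
        - (βs - J.starProjection βs)‖ := by
    rw [l2norm]
    congr 1
    rw [WithLp.toLp_sub, hT]
    show _ - βs = _
    abel
  rw [e]
  refine (norm_sub_le _ _).trans (add_le_add_left ((norm_add_le _ _).trans
    (add_le_add h3 (h1.trans ?_))) _)
  gcongr

theorem mismatch_eq_zero (h : GoodRun X D S ν κ α lamH lamD LamD LamX η σ tau lam βs u ε)
    {J : Finset (Fin m)} (hJ : S ⊆ J) : mismatch D J S βs.ofLp = 0 := by
  rw [mismatch_eq _ _ h.target_compl, Submodule.starProjection_eq_self_iff.2, sub_self, norm_zero]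
  exact ker_rowsLin_anti hJ h.target_compl

/-- The error bound, on the event that the noise seen by the relevant functionals is small. -/
theorem betaTilde_error_le_errorBound
    (h : GoodRun X D S ν κ α lamH lamD LamD LamX η σ tau lam βs u ε) (hS : S.Nonempty)
    (hN : α * N ≤ tau) (hN' : tau < α * (N + 1)) (h5 : 5 * α < tau)
    (htau : tau * Real.sqrt (Real.log m / n) * (8 * σ * LamX) = η * lamD) {r : ℕ}
    (hu : ‖(LinearMap.ker (rowsLin D S) ⊓ LinearMap.ker (rowsLin D Sᶜ)).starProjection u‖
      ≤ invLamOne X D * (Real.sqrt r * (2 * σ * (1 + LamX ^ 2 / (lamH * lamD ^ 2))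
        * Real.sqrt (Real.log m / n))))
    (hc : ∀ j, |rowsLin D S ((LinearMap.ker (rowsLin D Sᶜ)).starProjection u) j|
      ≤ 2 * σ * (LamD * (LamX / (lamH * lamD ^ 2))) * Real.sqrt (Real.log m / n)) :
    l2norm (betaTilde X D (data X βs ε) ν κ α N - βs.ofLp)
      ≤ errorBound n m S.card r σ η lamD LamD LamX (invLamOne X D) α lam tau
        + mismatch D (suppIter X D (data X βs ε) ν κ α N) S βs.ofLp := by
  have hα := h.α_pos
  have hl := h.lam_pos
  have hll := h.lam_le
  have hH := h.bounds.lamH_pos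
  have hd := h.bounds.lamD_pos
  have hD := h.bounds.LamD_pos
  have hX := h.bounds.LamX_pos
  have hq := h.bounds.q_nonneg
  have hσ := h.σ_pos
  have hη := h.η_pos
  have hη1 := h.η_le
  have h1 := h.betaTilde_error_le hN hu (by positivity) hc
  refine h1.trans (add_le_add_left ?_ _)
  have hsplit : ∀ a : ℕ, Real.sqrt (a * Real.log m / n)
      = Real.sqrt a * Real.sqrt (Real.log m / n) := fun a => by
    rw [mul_div_assoc, Real.sqrt_mul (Nat.cast_nonneg a)]
  rw [errorBound, hsplit, hsplit]
  set t := Real.sqrt (Real.log m / n)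
  set q := invLamOne X D
  have ht : 0 ≤ t := Real.sqrt_nonneg _
  have htau0 : 0 < tau := by linarith
  -- The definition of `τ̄` trades the noise level for `1 / τ̄`, after which every term is a
  -- multiple of `√s / (λ_H' (τ̄ - α))`.
  have hσt : σ * LamX * t = η * lamD / (8 * tau) := by
    field_simp
    linarith
  -- The bound `5 α < τ̄` gives more than four steps.
  have hN4 : (2 : ℝ) ≤ N := by nlinarith
  have h2 := h.gap_terminal hS hN (by exact_mod_cast hN4)
  have hta : 0 < tau - α := by linarith
  have hta' : tau - α ≤ α * N := by linarith
  have hgap : gap X D S ν κ α βs u ε lamH N ≤ 85 / 16 * (Real.sqrt S.card / (lam * (tau - α))) := by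
    rw [← mul_div_assoc, le_div_iff₀ (by positivity)]
    refine le_trans ?_ h2
    have := gap_nonneg (X := X) (D := D) (S := S) (ν := ν) (κ := κ) (α := α) (βs := βs) (u := u)
      (ε := ε) (lamH := lamH) N
    refine mul_le_mul_of_nonneg_left ?_ this
    nlinarith
  have hr : q * (Real.sqrt r * (2 * σ * (1 + LamX ^ 2 / (lamH * lamD ^ 2)) * t))
      ≤ 2 * σ / lam * (LamX / lamD ^ 2 + (lam * lamD ^ 2 + LamX ^ 2) * q / lamD ^ 2)
        * (Real.sqrt r * t) := by
    calc _ ≤ q * (Real.sqrt r * (2 * σ * (1 + LamX ^ 2 / (lam * lamD ^ 2)) * t)) := by gcongr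
      _ = 2 * σ / lam * (0 + (lam * lamD ^ 2 + LamX ^ 2) * q / lamD ^ 2) * (Real.sqrt r * t) := by
        field_simp
        ring
      _ ≤ _ := by
        gcongr
        positivity
  -- The leading term is ten times `(Λ_D / λ_D² + 1) Z` with `Z = √s / (λ_H' (τ̄ - α))`. The gap
  -- needs `85/16` of `Z`, and the projected noise needs one `(Λ_D / λ_D²) Z`.
  have hmain : 80 * σ / (η * lam * (1 - α / tau)) * (LamX * (LamD + lamD ^ 2) / lamD ^ 3)
      * (Real.sqrt S.card * t)
      = 10 * ((LamD / lamD ^ 2 + 1) * (Real.sqrt S.card / (lam * (tau - α)))) := by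
    have e : 80 * σ / (η * lam * (1 - α / tau)) * (LamX * (LamD + lamD ^ 2) / lamD ^ 3)
      * (Real.sqrt S.card * t) = 80 * (σ * LamX * t) / (η * lam * (1 - α / tau))
        * ((LamD + lamD ^ 2) / lamD ^ 3) * Real.sqrt S.card := by ring
    have e2 : 1 - α / tau = (tau - α) / tau := by field_simp
    rw [e, hσt, e2]
    field_simp
    norm_num
  have hcoord : Real.sqrt S.card * (2 * σ * (LamD * (LamX / (lamH * lamD ^ 2))) * t) / lamD
      ≤ LamD / lamD ^ 2 * (Real.sqrt S.card / (lam * (tau - α))) := by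
    have e : Real.sqrt S.card * (2 * σ * (LamD * (LamX / (lamH * lamD ^ 2))) * t) / lamD
        = Real.sqrt S.card * (2 * (σ * LamX * t) * (LamD / (lamH * lamD ^ 2))) / lamD := by ring
    rw [e, hσt]
    calc _ = η / 4 * (LamD / lamD ^ 2 * (Real.sqrt S.card / (lamH * tau))) := by
          field_simp
          norm_num
      _ ≤ 1 * (LamD / lamD ^ 2 * (Real.sqrt S.card / (lam * (tau - α)))) := by
          gcongr
          · linarith
          · linarith
      _ = _ := one_mul _
  rw [hmain]
  set Z := Real.sqrt S.card / (lam * (tau - α))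
  have hZ : 0 ≤ Z := by positivity
  have hW : 0 ≤ LamD / lamD ^ 2 * Z := by positivity
  linarith

theorem sign_eq_of_abs_sub_lt {a b : ℝ} (h : |a - b| < |b|) :
    SignType.sign a = SignType.sign b := by
  rcases lt_trichotomy b 0 with hb | hb | hb
  · rw [abs_of_neg hb] at h
    rw [sign_neg hb, sign_neg (by linarith [(abs_lt.1 h).2])]
  · rw [hb, abs_zero] at h
    exact absurd h (not_lt.2 (abs_nonneg _))
  · rw [abs_of_pos hb] at h
    rw [sign_pos hb, sign_pos (by linarith [(abs_lt.1 h).1])]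

/-- Sign consistency with an explicit signal level. -/
theorem sign_betaTilde_eq (h : GoodRun X D S ν κ α lamH lamD LamD LamX η σ tau lam βs u ε)
    (hS : S.Nonempty) (hN : α * N ≤ tau) (hN' : tau < α * (N + 1)) (h5 : 5 * α < tau)
    {G : ℝ} (hG : G * (lam * (tau - 5 * α)) = 2 * (LamD / lamD) * (2 * Real.log S.card + 5))
    (hsig : ∀ j : {j // j ∈ S}, G ≤ |rowsLin D S βs j|)
    (hu : ∀ j, |rowsLin D S u j| ≤ 1 / (4 * tau * lam))
    (hPu : ∀ j, |rowsLin D S ((LinearMap.ker (rowsLin D Sᶜ)).starProjection u) j|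
      ≤ LamD / lamD / (4 * tau * lam)) (j : Fin m) :
    SignType.sign ((D *ᵥ betaTilde X D (data X βs ε) ν κ α N) j)
      = SignType.sign ((D *ᵥ βs.ofLp) j) := by
  have hα := h.α_pos
  have hl := h.lam_pos
  have hd := h.bounds.lamD_pos
  have hD := h.bounds.LamD_pos
  have hlog : 0 ≤ Real.log S.card := Real.log_nonneg (by exact_mod_cast hS.card_pos)
  have htau0 : 0 < tau := by linarith
  have h5' : 0 < tau - 5 * α := by linarith
  have hG0 : 0 < G := by
    have : 0 < G * (lam * (tau - 5 * α)) := by rw [hG]; positivity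
    exact pos_of_mul_pos_left this (by positivity)
  obtain ⟨j₀, hj₀⟩ := hS
  have hne : rowsLin D S βs ≠ 0 := by
    intro h0
    have := hsig ⟨j₀, hj₀⟩
    rw [h0] at this
    simp only [PiLp.zero_apply, abs_zero] at this
    linarith
  set R := LamD / lamD with hRdef
  have hR1 : 1 ≤ R := (one_le_div hd).2 (h.lamD_le_LamD hne)
  have hR : 0 < R := by linarith
  -- The term `5` in the signal level contributes `10 R` to `G λ_H' (τ̄ - 5 α)`; divided by the `4`
  -- of the noise bound this is the fraction `1/40`.
  have hnoise : R / (4 * tau * lam) ≤ G / 40 := by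
    rw [div_le_div_iff₀ (by positivity) (by norm_num)]
    have h1 : G * (lam * (tau - 5 * α)) ≤ G * (lam * tau) := by gcongr; linarith
    have h2 : 0 ≤ R * Real.log S.card := by positivity
    nlinarith
  have hnoise1 : 1 / (4 * tau * lam) ≤ G / 40 := le_trans (by gcongr) hnoise
  -- The signal level cannot exceed `Λ_D ‖β⋆‖`, which the radius contains.
  have hgκ : 9 / 10 * G ≤ κ / 4 := by
    have h1 := h.radius_le_quarter
    have h2 : LamD * ‖βs‖ ≤ radius ν σ lamD LamD LamX (invLamOne X D) ‖βs‖ lam := by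
      have hX := h.bounds.LamX_pos
      have hq := h.bounds.q_nonneg
      have hσ := h.σ_pos
      have hν := h.bounds.ν_pos
      rw [radius]
      have a1 : 0 ≤ Real.sqrt (2 * (1 + ν * LamX ^ 2 + LamD ^ 2) / (lam * ν)) := Real.sqrt_nonneg _
      have a2 : 0 ≤ 2 * σ / lam * (LamX / lamD + LamX / lamD ^ 2
        + (lam * lamD ^ 2 + LamX ^ 2) * invLamOne X D / lamD ^ 2) := by positivity
      have a3 : 0 ≤ ‖βs‖ := norm_nonneg _
      have a4 : 0 ≤ LamD * ‖βs‖ := by positivity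
      nlinarith [mul_nonneg a1 a2, mul_nonneg a1 a3, mul_nonneg a1 a4]
    have h3 := (hsig ⟨j₀, hj₀⟩).trans ((PiLp.norm_apply_le (rowsLin D S βs) ⟨j₀, hj₀⟩).trans
      (h.map_le βs))
    linarith
  have horacle : ∀ j : {j // j ∈ S}, 39 / 40 * G ≤ |rowsLin D S (βs + u) j| := by
    intro j
    have h1 := hsig j
    have h2 := (hu j).trans hnoise1
    have h3 := abs_sub_abs_le_abs_sub (rowsLin D S βs j) (-(rowsLin D S u j))
    rw [abs_neg, sub_neg_eq_add] at h3
    have h4 : rowsLin D S (βs + u) j = rowsLin D S βs j + rowsLin D S u j := by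
      rw [map_add]; rfl
    rw [h4]
    linarith
  -- The descent phases fit in the time `τ̄ - 5 α`. Rounding down the stopping index costs one more
  -- `α`, and two are needed for rounding inside the phases.
  have htime : 17 / 8 * (2 * R + Real.log S.card) / (9 / 10 * G) + 2 * (α * lam)
      ≤ α * lam * N := by
    have h1 : 17 / 8 * (2 * R + Real.log S.card) / (9 / 10 * G) ≤ lam * (tau - 5 * α) := by
      rw [div_le_iff₀ (by positivity)]
      have : Real.log S.card ≤ R * Real.log S.card := le_mul_of_one_le_left hlog hR1
      nlinarith
    nlinarith
  have hterm := h.gap_terminal_of_signal ⟨j₀, hj₀⟩ hN (g := 9 / 10 * G) (by positivity) hR hgκ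
    (fun j => le_trans (by linarith) (horacle j)) htime
  have hgap0 := gap_nonneg (X := X) (D := D) (S := S) (ν := ν) (κ := κ) (α := α) (βs := βs)
    (u := u) (ε := ε) (lamH := lamH) N
  have hgapG : gap X D S ν κ α βs u ε lamH N ≤ 9 / 10 * G :=
    (le_mul_of_one_le_left hgap0 hR1).trans hterm
  -- Oracle signals are at least `39/40 G` while the error is at most `9/10 G`, so no active
  -- coordinate of `γ` is zero.
  have hsupp : suppIter X D (data X βs ε) ν κ α N = S := by
    refine (h.suppIter_subset hN).antisymm fun j hj => ?_
    refine Finset.mem_filter.2 ⟨Finset.mem_univ _, fun h0 => ?_⟩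
    have h1 := h.γ_error_le N ⟨j, hj⟩
    have h2 := horacle ⟨j, hj⟩
    rw [h0, zero_sub, abs_neg] at h1
    linarith
  have hT := toLp_betaTilde (X := X) (D := D) (ν := ν) (κ := κ) (α := α) (βs := βs) (u := u)
    (ε := ε) N
  rw [hsupp] at hT
  have hβs : (LinearMap.ker (rowsLin D Sᶜ)).starProjection βs = βs :=
    Submodule.starProjection_eq_self_iff.2 h.target_compl
  by_cases hj : j ∈ S
  · apply sign_eq_of_abs_sub_lt
    have h1 : (D *ᵥ betaTilde X D (data X βs ε) ν κ α N) j
        = rowsLin D S (WithLp.toLp 2 (betaTilde X D (data X βs ε) ν κ α N)) ⟨j, hj⟩ := by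
      rw [rowsLin_apply]
    have h2 : (D *ᵥ βs.ofLp) j = rowsLin D S βs ⟨j, hj⟩ := by rw [rowsLin_apply]
    have h3 := hsig ⟨j, hj⟩
    have h4 := (hPu ⟨j, hj⟩).trans hnoise
    have h5 := (PiLp.norm_apply_le (rowsLin D S ((LinearMap.ker (rowsLin D Sᶜ)).starProjection
      (betaError X D ν κ α βs u ε N))) ⟨j, hj⟩).trans ((h.map_proj_betaError_le N).trans hterm)
    rw [Real.norm_eq_abs] at h5
    rw [h1, h2, hT, hβs, map_add, map_add, PiLp.add_apply, PiLp.add_apply]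
    have e : ∀ a b c : ℝ, a + b + c - a = b + c := by intros; ring
    rw [e]
    -- Noise at most `G/40` plus path error at most `9/10 G` stays strictly below the signal.
    refine (abs_add_le _ _).trans_lt ?_
    linarith
  · have hjc := Finset.mem_compl.2 hj
    have h1 : (D *ᵥ βs.ofLp) j = 0 := by
      have := rowsLin_apply D Sᶜ βs ⟨j, hjc⟩
      rw [h.target_compl] at this
      exact this.symm
    have h2 : (D *ᵥ betaTilde X D (data X βs ε) ν κ α N) j = 0 := by
      have h3 := rowsLin_apply D Sᶜ (WithLp.toLp 2 (betaTilde X D (data X βs ε) ν κ α N)) ⟨j, hjc⟩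
      have h4 : WithLp.toLp 2 (betaTilde X D (data X βs ε) ν κ α N)
          ∈ LinearMap.ker (rowsLin D Sᶜ) := by
        rw [hT, ← map_add, ← map_add]
        exact Submodule.starProjection_apply_mem _ _
      rw [LinearMap.mem_ker.1 h4] at h3
      exact h3.symm
    rw [h1, h2]

end GoodRun

end Conclusions

end SplitLBI

namespace SplitLBI

open RealInnerProductSpace

/-! ### Probability of small noise -/

section Probability

variable {Ω : Type*} [MeasurableSpace Ω] {μ : Measure Ω} {n : ℕ} {σ : ℝ} {ε : Fin n → Ω → ℝ}

theorem tail_scaledNoise_norm [IsProbabilityMeasure μ] (hn : 0 < n) (hσ : 0 < σ)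
    (hindep : iIndepFun ε μ) (hsub : ∀ i, HasSubgaussianMGF (ε i) (Real.toNNReal (σ ^ 2)) μ) :
    μ.real {ω | ¬ ‖scaledNoise fun i => ε i ω‖ ≤ 2 * σ} ≤ Real.exp (-(4 * n / 5)) := by
  refine le_trans (measureReal_mono ?_) (tail_norm hσ hindep hsub)
  intro ω hω h
  refine hω (le_of_sq_le_sq ?_ (by positivity))
  have hn' : (0 : ℝ) < n := by exact_mod_cast hn
  rw [scaledNoise, norm_smul, mul_pow, Real.norm_eq_abs, sq_abs, inv_pow, Real.sq_sqrt hn'.le,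
    inv_mul_le_iff₀ hn']
  linarith

theorem tail_scaledNoise_family [IsProbabilityMeasure μ] (hσ : 0 < σ)
    (hindep : iIndepFun ε μ) (hsub : ∀ i, HasSubgaussianMGF (ε i) (Real.toNNReal (σ ^ 2)) μ)
    {ι : Type*} [Fintype ι] (ℓ : ι → EuclideanSpace ℝ (Fin n) →ₗ[ℝ] ℝ) {c : ℝ} (hc : 0 < c)
    (hℓ : ∀ j e, |ℓ j e| ≤ c * ‖e‖) {m : ℝ} (hm : 1 ≤ m) :
    μ.real {ω | ¬ ∀ j, |ℓ j (scaledNoise fun i => ε i ω)|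
        ≤ 2 * σ * c * Real.sqrt (Real.log m / n)} ≤ 2 * Fintype.card ι / m ^ 2 := by
  refine le_trans (measureReal_mono ?_) (tail_linear_family hσ hindep hsub ℓ hc hℓ hm)
  intro ω hω h
  refine hω fun j => ?_
  rw [scaledNoise, map_smul, smul_eq_mul, abs_mul, abs_of_nonneg (by positivity),
    Real.sqrt_div (Real.log_nonneg hm)]
  calc _ ≤ (Real.sqrt n)⁻¹ * (2 * σ * c * Real.sqrt (Real.log m)) := by gcongr; exact h j
    _ = _ := by ring

/-- A union over at most `m` rows, each failing with probability at most `2 / m²`. -/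
theorem tail_scaledNoise_coord [IsProbabilityMeasure μ] (hσ : 0 < σ)
    (hindep : iIndepFun ε μ) (hsub : ∀ i, HasSubgaussianMGF (ε i) (Real.toNNReal (σ ^ 2)) μ)
    {m : ℕ} (hm : 1 < m) {J : Finset (Fin m)}
    (T : EuclideanSpace ℝ (Fin n) →ₗ[ℝ] EuclideanSpace ℝ {j // j ∈ J}) {c : ℝ} (hc : 0 < c)
    (hT : ∀ e, ‖T e‖ ≤ c * ‖e‖) :
    μ.real {ω | ¬ ∀ j, |T (scaledNoise fun i => ε i ω) j|
        ≤ 2 * σ * c * Real.sqrt (Real.log m / n)} ≤ 2 / m := by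
  have h1 := tail_scaledNoise_family hσ hindep hsub
    (fun j : {j // j ∈ J} => (EuclideanSpace.proj j : _ →L[ℝ] ℝ).toLinearMap ∘ₗ T) hc
    (fun j e => (PiLp.norm_apply_le (T e) j).trans (hT e)) (m := m) (by exact_mod_cast hm.le)
  refine h1.trans ?_
  have hm' : (0 : ℝ) < m := by exact_mod_cast (by omega : 0 < m)
  have h2 : (Fintype.card {j // j ∈ J} : ℝ) ≤ m := by
    have := J.card_le_univ
    rw [Fintype.card_fin] at this
    rw [Fintype.card_coe]
    exact_mod_cast this
  calc _ ≤ 2 * (m : ℝ) / m ^ 2 := by gcongr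
    _ = _ := by field_simp

/-- This form of the union bound uses only subadditivity, so the events need not be measurable. -/
theorem one_le_measureReal_add [IsProbabilityMeasure μ] {A B₁ B₂ B₃ B₄ : Ω → Prop}
    (h : ∀ ω, B₁ ω → B₂ ω → B₃ ω → B₄ ω → A ω) :
    1 ≤ μ.real {ω | A ω} + (μ.real {ω | ¬ B₁ ω} + (μ.real {ω | ¬ B₂ ω}
      + (μ.real {ω | ¬ B₃ ω} + μ.real {ω | ¬ B₄ ω}))) := by
  have hU : (Set.univ : Set Ω) ⊆ {ω | A ω} ∪ ({ω | ¬ B₁ ω} ∪ ({ω | ¬ B₂ ω}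
      ∪ ({ω | ¬ B₃ ω} ∪ {ω | ¬ B₄ ω}))) := by
    intro ω _
    simp only [Set.mem_union, Set.mem_ofPred_eq]
    have := h ω
    tauto
  have h1 := measureReal_mono (μ := μ) hU
  rw [probReal_univ] at h1
  refine h1.trans ((measureReal_union_le _ _).trans (add_le_add_right ?_ _))
  refine (measureReal_union_le _ _).trans (add_le_add_right ?_ _)
  exact (measureReal_union_le _ _).trans (add_le_add_right (measureReal_union_le _ _) _)

end Probability

/-! ### Identities and inequalities between the constants. -/

section Constants

variable {n m p : ℕ} {X : Matrix (Fin n) (Fin p) ℝ} {D : Matrix (Fin m) (Fin p) ℝ}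
  {S : Finset (Fin m)}

theorem finrank_map_scaledLin (hn : 0 < n) :
    Module.finrank ℝ ((LinearMap.ker (rowsLin D S) ⊓ LinearMap.ker (rowsLin D Sᶜ)).map
      (scaledLin X)) = rPrime X D := by
  rw [← finrank_range_restrKer hn, ← ker_split]
  have : restrKer X D
      = scaledLin X ∘ₗ (LinearMap.ker (Matrix.toEuclideanLin D)).subtype := rfl
  rw [this, LinearMap.range_comp, Submodule.range_subtype]

theorem tauBar_mul (hn : 0 < n) (hm : 1 < m) {σ η lamD LamX : ℝ} (hσ : 0 < σ) (hX : 0 < LamX) :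
    tauBar n m σ η lamD LamX * Real.sqrt (Real.log m / n) * (8 * σ * LamX) = η * lamD := by
  have hn' : (0 : ℝ) < n := by exact_mod_cast hn
  have hlog : 0 < Real.log m := Real.log_pos (by exact_mod_cast hm)
  have h1 : Real.sqrt (n / Real.log m) * Real.sqrt (Real.log m / n) = 1 := by
    rw [← Real.sqrt_mul (by positivity), div_mul_div_cancel₀ hlog.ne', div_self hn'.ne',
      Real.sqrt_one]
  calc _ = η / (8 * σ) * (lamD / LamX) * (8 * σ * LamX)
        * (Real.sqrt (n / Real.log m) * Real.sqrt (Real.log m / n)) := by rw [tauBar]; ring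
    _ = _ := by rw [h1]; field_simp

/-- The descent argument needs no `log (max 1 (8 Λ_D))`; being nonnegative, that term is slack. -/
theorem signalLevel_le_signalBound {s : ℕ} {σ η lamD LamD LamX α lam tau : ℝ}
    (hη : 0 < η) (hl : 0 < lam) (hd : 0 < lamD) (hD : 0 < LamD) (htau0 : 0 < tau)
    (h5 : 5 * α < tau)
    (htau : tau * Real.sqrt (Real.log m / n) * (8 * σ * LamX) = η * lamD) :
    2 * (LamD / lamD) * (2 * Real.log s + 5) / (lam * (tau - 5 * α))
      ≤ signalBound n m s σ η lamD LamD LamX α lam tau := by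
  have h5' : 0 < tau - 5 * α := by linarith
  rw [signalBound]
  set t := Real.sqrt (Real.log m / n)
  have hσt : σ * LamX * t = η * lamD / (8 * tau) := by
    field_simp
    linarith
  have e2 : 1 - 5 * α / tau = (tau - 5 * α) / tau := by field_simp
  set M := Real.log (max 1 (8 * LamD)) with hM
  have hM0 : 0 ≤ M := Real.log_nonneg (le_max_left _ _)
  have e : 16 * σ / (η * lam * (1 - 5 * α / tau)) * (LamX * LamD / lamD ^ 2)
      * (2 * Real.log s + 5 + M) * t
      = 2 * (LamD / lamD) * (2 * Real.log s + 5 + M) / (lam * (tau - 5 * α)) := by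
    calc _ = 16 * (σ * LamX * t) / (η * lam * (1 - 5 * α / tau)) * (LamD / lamD ^ 2)
          * (2 * Real.log s + 5 + M) := by ring
      _ = _ := by
        rw [hσt, e2]
        field_simp
        norm_num
  rw [e]
  exact div_le_div_of_nonneg_right (mul_le_mul_of_nonneg_left (by linarith) (by positivity))
    (by positivity)

end Constants

end SplitLBI

/-! ### Combination of the deterministic estimates with the noise events. -/

theorem mainTheorem5 {Ω : Type*} [MeasurableSpace Ω] (μ : Measure Ω) [IsProbabilityMeasure μ]
    (n m p : ℕ) (hn : 0 < n) (hm : 1 < m)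
    (X : Matrix (Fin n) (Fin p) ℝ) (D : Matrix (Fin m) (Fin p) ℝ) (βs : Fin p → ℝ)
    (hβs : βs ∈ identSpace X D)
    (S : Finset (Fin m)) (hS : S = supp (D *ᵥ βs)) (hSne : S.Nonempty)
    (σ : ℝ) (hσ : 0 < σ) (ε : Fin n → Ω → ℝ)
    (hindep : iIndepFun ε μ) (hident : ∀ i j, IdentDistrib (ε i) (ε j) μ μ)
    (hsub : ∀ i, HasSubgaussianMGF (ε i) (Real.toNNReal (σ ^ 2)) μ)
    (y : Ω → Fin n → ℝ) (hy : ∀ ω, y ω = X *ᵥ βs + fun i => ε i ω)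
    (lamD LamD LamX : ℝ) (hconst : ConstBounds X D S lamD LamD LamX)
    (ν : ℝ) (hν : 0 < ν) (hRSC : RSC X D S)
    (η : ℝ) (hη : η ∈ Set.Ioc (0 : ℝ) 1) (hIRR : IRR X D S ν η) :
    (∃ C : ℝ, 0 < C ∧ ∀ ν' : ℝ, 0 < ν' → RSCSplit X D S C ν') ∧
    ∀ C : ℝ, 0 < C → RSCSplit X D S C ν →
    ∀ κ α : ℝ, 0 < κ → 0 < α →
    κ * α * specNorm (hess X D ν) < 2 →
    ∀ lam tau : ℝ, lam = lamHPrime X D C ν κ α → tau = tauBar n m σ η lamD LamX →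
    kappaBound η ν σ lamD LamD LamX (invLamOne X D) (l2norm βs) lam ≤ κ →
    5 * α < tau →
    ∀ k : ℕ, k = ⌊tau / α⌋₊ →
      ((∀ j ∈ S, signalBound n m S.card σ η lamD LamD LamX α lam tau ≤ |(D *ᵥ βs) j|) →
        1 - 8 / (m : ℝ) - 3 * Real.exp (-(4 * n / 5)) ≤
          μ.real {ω | ∀ j, SignType.sign ((D *ᵥ betaTilde X D (y ω) ν κ α k) j)
            = SignType.sign ((D *ᵥ βs) j)}) ∧
      1 - 8 / (m : ℝ) - 2 * (rPrime X D : ℝ) / (m : ℝ) ^ 2 - 3 * Real.exp (-(4 * n / 5)) ≤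
        μ.real {ω |
          l2norm (betaTilde X D (y ω) ν κ α k - βs) ≤
            errorBound n m S.card (rPrime X D) σ η lamD LamD LamX (invLamOne X D) α lam tau
              + 2 * mismatch D (suppIter X D (y ω) ν κ α k) S βs ∧
          (S ⊆ suppIter X D (y ω) ν κ α k →
            l2norm (betaTilde X D (y ω) ν κ α k - βs) ≤
              errorBound n m S.card (rPrime X D) σ η lamD LamD LamX (invLamOne X D) α lam tau)} := by
  refine ⟨exists_rscSplit hn hRSC, ?_⟩
  intro C hC hR κ α hκ hα hstep lam tau hlam htau hkappa h5 k hk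
  obtain rfl : y = fun ω => X *ᵥ βs + fun i => ε i ω := funext hy
  have hB := splitBounds_of hn hν hSne hC hR hconst
  obtain ⟨U, hU⟩ := hB.exists_noiseMap
  set lamH := C / (1 + ν)
  have hm' : (0 : ℝ) < m := by exact_mod_cast (by omega : 0 < m)
  have hd := hB.lamD_pos
  have hD := hB.LamD_pos
  have hX := hB.LamX_pos
  have hH := hB.lamH_pos
  have hη0 := hη.1
  have htau0 : 0 < tau := by linarith
  have hfin := finrank_map_scaledLin (X := X) (D := D) (S := S) hn
  have htt : tau * Real.sqrt (Real.log m / n) * (8 * σ * LamX) = η * lamD := by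
    rw [htau]; exact tauBar_mul hn hm hσ hX
  set t := Real.sqrt (Real.log m / n)
  have hσt : σ * LamX * t = η * lamD / (8 * tau) := by
    field_simp
    linarith
  have hαk : α * k ≤ tau := by
    have := Nat.floor_le (a := tau / α) (by positivity)
    rw [← hk, le_div_iff₀ hα] at this
    linarith
  have hαk' : tau < α * (k + 1) := by
    have := Nat.lt_floor_add_one (tau / α)
    rw [← hk, div_lt_iff₀ hα] at this
    linarith
  set K := LinearMap.ker (rowsLin D S) ⊓ LinearMap.ker (rowsLin D Sᶜ)
  have htarget : rowsLin D Sᶜ (WithLp.toLp 2 βs) = 0 := by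
    have hzero : ∀ i ∉ S, (D *ᵥ βs) i = 0 := by
      intro i hi
      rw [hS] at hi
      by_contra h0
      exact hi (Finset.mem_filter.2 ⟨Finset.mem_univ _, h0⟩)
    ext j
    exact hzero j (Finset.mem_compl.1 j.2)
  let noise : Ω → EuclideanSpace ℝ (Fin n) := fun ω => scaledNoise fun i => ε i ω
  -- Two events suffice for the whole path analysis: the noise norm bounds the oracle, and the
  -- inactive rows of its response keep false positives out.
  have hgood : ∀ ω, ‖noise ω‖ ≤ 2 * σ →
      (∀ j, |(ν⁻¹ • (rowsLin D Sᶜ ∘ₗ U)) (noise ω) j| ≤ 2 * σ * (LamX / lamD) * t) →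
      GoodRun X D S ν κ α lamH lamD LamD LamX η σ tau lam (WithLp.toLp 2 βs) (U (noise ω))
        (fun i => ε i ω) := by
    intro ω h1 h2
    refine ⟨hn, hB, weakIRR_of_IRR hν hIRR, hη0, hη.2, hκ, hα, hσ, hstep, hlam,
      (mem_identSub_iff hn _).2 hβs, htarget, (hU _).1, (hU _).2, h1, fun j => ?_, hkappa⟩
    have h3 : |ν⁻¹ * rowsLin D Sᶜ (U (noise ω)) j| ≤ 2 * σ * (LamX / lamD) * t := h2 j
    calc _ ≤ tau * (2 * σ * (LamX / lamD) * t) := by gcongr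
      _ = 2 * tau * (σ * LamX * t) / lamD := by ring
      _ = η / 4 := by
        rw [hσt]
        field_simp
        norm_num
  have tail_norm := tail_scaledNoise_norm hn hσ hindep hsub
  have tail_compl := tail_scaledNoise_coord hσ hindep hsub hm (ν⁻¹ • (rowsLin D Sᶜ ∘ₗ U))
    (c := LamX / lamD) (by positivity) (fun e => by
      rw [LinearMap.smul_apply, norm_smul, Real.norm_eq_abs, abs_of_pos (inv_pos.2 hν)]
      exact hB.norm_compl_le (hU e).2)
  have tail_active := tail_scaledNoise_coord hσ hindep hsub hm (rowsLin D S ∘ₗ U)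
    (c := LamX / (lamH * lamD)) (by positivity) (fun e => hB.norm_maps_le (hU e).2)
  have tail_proj := tail_scaledNoise_coord hσ hindep hsub hm
    (rowsLin D S ∘ₗ (LinearMap.ker (rowsLin D Sᶜ)).starProjection.toLinearMap ∘ₗ U)
    (c := LamD * (LamX / (lamH * lamD ^ 2))) (by positivity) (fun e => by
      refine (hB.norm_map_proj_le (U e)).trans ?_
      rw [mul_assoc]
      exact mul_le_mul_of_nonneg_left (hB.norm_sub_proj_le (hU e).2) hD.le)
  have he := Real.exp_pos (-(4 * (n : ℝ) / 5))
  have hm2 : 8 / (m : ℝ) = 4 * (2 / m) := by ring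
  have hm3 : 0 < 2 / (m : ℝ) := by positivity
  constructor
  · intro hsig
    have h1 := one_le_measureReal_add (μ := μ)
      (A := fun ω => ∀ j, SignType.sign ((D *ᵥ betaTilde X D (X *ᵥ βs + fun i => ε i ω) ν κ α k) j)
            = SignType.sign ((D *ᵥ βs) j))
      (B₁ := fun ω => ‖noise ω‖ ≤ 2 * σ)
      (B₂ := fun ω => ∀ j, |(ν⁻¹ • (rowsLin D Sᶜ ∘ₗ U)) (noise ω) j| ≤ 2 * σ * (LamX / lamD) * t)
      (B₃ := fun ω => ∀ j, |(rowsLin D S ∘ₗ U) (noise ω) j| ≤ 2 * σ * (LamX / (lamH * lamD)) * t)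
      (B₄ := fun ω => ∀ j, |(rowsLin D S ∘ₗ
        (LinearMap.ker (rowsLin D Sᶜ)).starProjection.toLinearMap ∘ₗ U) (noise ω) j|
          ≤ 2 * σ * (LamD * (LamX / (lamH * lamD ^ 2))) * t) (by
        intro ω b1 b2 b3 b4
        have hrun := hgood ω b1 b2
        have hl := hrun.lam_pos
        have hll := hrun.lam_le
        have hη1 := hη.2
        refine hrun.sign_betaTilde_eq hSne hαk hαk' h5
          (G := 2 * (LamD / lamD) * (2 * Real.log S.card + 5) / (lam * (tau - 5 * α)))
          (div_mul_cancel₀ _ (by have : 0 < tau - 5 * α := by linarith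
                                 positivity)) ?_ ?_ ?_
        · intro j
          refine (signalLevel_le_signalBound hη0 hl hd hD htau0 h5 htt).trans ?_
          rw [rowsLin_apply]
          exact hsig j j.2
        · intro j
          refine (b3 j).trans ?_
          calc _ = 2 * (σ * LamX * t) / (lamH * lamD) := by ring
            _ = η / (4 * tau * lamH) := by
              rw [hσt]
              field_simp
              norm_num
            _ ≤ _ := by gcongr
        · intro j
          refine (b4 j).trans ?_
          calc _ = 2 * (σ * LamX * t) * (LamD / (lamH * lamD ^ 2)) := by ring
            _ = η * (LamD / lamD) / (4 * tau * lamH) := by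
              rw [hσt]
              field_simp
              norm_num
            _ ≤ 1 * (LamD / lamD) / (4 * tau * lam) := by gcongr
            _ = _ := by rw [one_mul])
    -- Three row events cost `6 / m` and the norm event one exponential; the claimed probability is
    -- weaker.
    linarith
  -- A basis indexed by `Fin r'` gives a family of exactly `r'` functionals, hence the loss `2 r' /
  -- m²`.
  · let b := (stdOrthonormalBasis ℝ (K.map (scaledLin X))).reindex (finCongr hfin)
    have tail_ker := tail_scaledNoise_family hσ hindep hsub
      (fun i => (innerₛₗ ℝ (b i : EuclideanSpace ℝ (Fin n))) ∘ₗ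
        (LinearMap.id - scaledLin X ∘ₗ (U - K.starProjection.toLinearMap ∘ₗ U)))
      (c := 1 + LamX ^ 2 / (lamH * lamD ^ 2)) (by positivity) (fun i e => by
        have h1 : ‖(b i : EuclideanSpace ℝ (Fin n))‖ = 1 := b.norm_eq_one i
        refine (abs_real_inner_le_norm (b i : EuclideanSpace ℝ (Fin n))
          (e - scaledLin X (U e - K.starProjection (U e)))).trans ?_
        rw [h1, one_mul]
        refine (norm_sub_le _ _).trans ?_
        have h2 := (hB.bound_x (U e - K.starProjection (U e))).trans
          (mul_le_mul_of_nonneg_left (hB.norm_sub_proj_le (hU e).2) hX.le)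
        calc _ ≤ ‖e‖ + LamX * (LamX / (lamH * lamD ^ 2) * ‖e‖) := add_le_add_right h2 _
          _ = _ := by ring) (m := m) (by exact_mod_cast hm.le)
    rw [Fintype.card_fin] at tail_ker
    have h1 := one_le_measureReal_add (μ := μ)
      (A := fun ω =>
          l2norm (betaTilde X D (X *ᵥ βs + fun i => ε i ω) ν κ α k - βs) ≤
            errorBound n m S.card (rPrime X D) σ η lamD LamD LamX (invLamOne X D) α lam tau
              + 2 * mismatch D (suppIter X D (X *ᵥ βs + fun i => ε i ω) ν κ α k) S βs ∧
          (S ⊆ suppIter X D (X *ᵥ βs + fun i => ε i ω) ν κ α k →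
            l2norm (betaTilde X D (X *ᵥ βs + fun i => ε i ω) ν κ α k - βs) ≤
              errorBound n m S.card (rPrime X D) σ η lamD LamD LamX (invLamOne X D) α lam tau))
      (B₁ := fun ω => ‖noise ω‖ ≤ 2 * σ)
      (B₂ := fun ω => ∀ j, |(ν⁻¹ • (rowsLin D Sᶜ ∘ₗ U)) (noise ω) j| ≤ 2 * σ * (LamX / lamD) * t)
      (B₃ := fun ω => ∀ j, |(rowsLin D S ∘ₗ
        (LinearMap.ker (rowsLin D Sᶜ)).starProjection.toLinearMap ∘ₗ U) (noise ω) j|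
          ≤ 2 * σ * (LamD * (LamX / (lamH * lamD ^ 2))) * t)
      (B₄ := fun ω => ∀ i, |((innerₛₗ ℝ (b i : EuclideanSpace ℝ (Fin n))) ∘ₗ
        (LinearMap.id - scaledLin X ∘ₗ (U - K.starProjection.toLinearMap ∘ₗ U))) (noise ω)|
          ≤ 2 * σ * (1 + LamX ^ 2 / (lamH * lamD ^ 2)) * t) (by
        intro ω b1 b2 b3 b4
        have hrun := hgood ω b1 b2
        have hker := hB.norm_proj_le_of_coord (hU (noise ω)).2 (hU (noise ω)).1 b
          (t := 2 * σ * (1 + LamX ^ 2 / (lamH * lamD ^ 2)) * t) (by positivity) b4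
        rw [Fintype.card_fin] at hker
        have hmain := hrun.betaTilde_error_le_errorBound hSne hαk hαk' h5 htt hker b3
        have hmis : 0 ≤ mismatch D (suppIter X D (X *ᵥ βs + fun i => ε i ω) ν κ α k) S βs :=
          l2norm_nonneg _
        refine ⟨hmain.trans ?_, fun hsub' => hmain.trans ?_⟩
        -- The estimate holds with the mismatch counted once, and doubling it only weakens the
        -- bound.
        · refine add_le_add_right ?_ _
          change mismatch D (suppIter X D (X *ᵥ βs + fun i => ε i ω) ν κ α k) S βs ≤ _
          linarith
        · exact add_le_of_nonpos_right (hrun.mismatch_eq_zero hsub').le)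
    linarith
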